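/- A \emph{nondeterministic streaming string transducer} (NSST) is a tuple $\mathcal T=(Q,\Sigma,\Omega,\mathcal R,\Delta,I,F)$ with a finite set $Q$ of states, finite input and output alphabets $\Sigma=\Sigma(\mathcal T)$ and $\Omega=\Omega(\mathcal T)$, a finite set $\mathcal R$ of registers, a finite bag (multiset) $\Delta$ of transitions $(p,a,\sigma,q)\in Q\times\Sigma\times\operatorname{Asg}(\mathcal R,\Omega)\times Q$, a partial function $I$ from $Q$ to valuations, and a partial function $F:Q\rightharpoonup(\mathcal R\cup\Omega)^*$ such that every register occurs at most once in each $F(q)$. Here a \emph{valuation} is a partial function $\mathcal R\rightharpoonup\Omega^*$, and $\operatorname{Asg}(\mathcal R,\Omega)$ is the set of \emph{copyless assignments}, i.e. partial functions $\sigma:\mathcal R\rightharpoonup(\mathcal R\cup\Omega)^*$ such that every register occurs at most once in all strings $\sigma(Y)$, $Y\in\mathcal R$, together. A valuation $\nu$ extends to strings $u\in(\mathcal R\cup\Omega)^*$ by replacing each register by its value; $\nu(u)$ is undefined if $\nu$ is undefined on some register of $u$; and $(\nu\circ\sigma)(X)=\nu(\sigma(X))$. A \emph{run} over $a_1\cdots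 a_n\in\Sigma^*$ is a sequence $(q_0,\nu_0)\xrightarrow{a_1/\sigma_1}\cdots\xrightarrow{a_n/\sigma_n}(q_n,\nu_n)$ such that $I(q_0)$ is defined, $\nu_0=I(q_0)$, $(q_i,a_{i+1},\sigma_{i+1},q_{i+1})\in\Delta$ and $\nu_{i+1}=\nu_i\circ\sigma_{i+1}$ for all $i<n$. It is \emph{accepting}, with output $\nu_n(F(q_n))$, if $\nu_n(F(q_n))$ is defined. The semantics $[\![\mathcal T]\!](D)$ is the bag of the outputs of all accepting runs over $D\in\Sigma^*$, where choosing different elements (copies) of the bag $\Delta$ counts as different runs. The size $|\mathcal T|$ is the number of symbols needed to write $\mathcal T$ down: the number of states, registers and letters of both alphabets, plus the total length of the descriptions of $\Delta$ (transitions counted with multiplicity), $I$ and $F$, including all their strings. \textbf{Theorem.} For every pair of NSSTs $\mathcal T_1,\mathcal T_2$ with $\Omega(\mathcal T_1)\subseteq\Sigma(\mathcal T_2)$ there is an NSST $\mathcal T$ with input alphabet $\Sigma(\mathcal T_1)$ and output alphabet $\Omega(\mathcal T_2)$ such that, for every $D\in\Sigma(\mathcal T_1)^*$, \[ [\![\mathcal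 T]\!](D)\;=\;\bigcup_{D'\in[\![\mathcal T_1]\!](D)}[\![\mathcal T_2]\!](D'), \] where $\bigcup$ is the (additive) union of bags and $D'$ ranges over the elements of the bag $[\![\mathcal T_1]\!](D)$ with multiplicity. Moreover, $\mathcal T$ is computable from $\mathcal T_1$ and $\mathcal T_2$ (with respect to the natural finite descriptions of NSSTs), and $|\mathcal T|\le C\cdot 2^{P(|\mathcal T_1|,|\mathcal T_2|)}$ for a constant $C$ and a polynomial $P$ that do not depend on $\mathcal T_1$ and $\mathcal T_2$. -/

import Mathlib

/-! Nondeterministic streaming string transducers (NSSTs) with bag semantics.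

Letters are natural numbers and alphabets are finite sets of them; the states and the registers of a
transducer are `Fin n` and `Fin r`. So every transducer is a finite object with an explicit code, and
a construction is effective when it is computable on codes. -/

/-- Strings over registers (`Sum.inl`) and letters (`Sum.inr`). -/
abbrev RegWord (r : ℕ) : Type := List (Fin r ⊕ ℕ)

/-- Assignments: partial functions from registers to strings over registers and letters. -/
abbrev Assignment (r : ℕ) : Type := Fin r → Option (RegWord r)

/-- Valuations: partial functions from registers to strings of letters. -/
abbrev RegVal (r : ℕ) : Type := Fin r → Option (List ℕ)

/-- All letters of the string `u` belong to `A`. -/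
def RegWord.Over {r : ℕ} (u : RegWord r) (A : Finset ℕ) : Prop :=
  ∀ o : ℕ, Sum.inr o ∈ u → o ∈ A

/-- All letters used by the assignment belong to `A`. -/
def Assignment.Over {r : ℕ} (σ : Assignment r) (A : Finset ℕ) : Prop :=
  ∀ (X : Fin r) (u : RegWord r), σ X = some u → u.Over A

/-- Every register occurs at most once in all the assigned strings together. -/
def Assignment.Copyless {r : ℕ} (σ : Assignment r) : Prop :=
  ∀ X : Fin r, ∑ Y : Fin r, ((σ Y).getD []).count (Sum.inl X) ≤ 1

/-- All letters used by the valuation belong to `A`. -/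
def RegVal.Over {r : ℕ} (ν : RegVal r) (A : Finset ℕ) : Prop :=
  ∀ (X : Fin r) (u : List ℕ), ν X = some u → ∀ o ∈ u, o ∈ A

/-- The extension of a valuation to strings: registers are replaced by their contents, letters are
kept; undefined as soon as some register of the string is undefined. -/
def RegVal.eval {r : ℕ} (ν : RegVal r) : RegWord r → Option (List ℕ)
  | [] => some []
  | Sum.inl X :: u => (ν X).bind fun x => (ν.eval u).map fun y => x ++ y
  | Sum.inr o :: u => (ν.eval u).map fun y => o :: y

/-- The composition `ν ∘ σ`, that is `X ↦ ν (σ X)`. -/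
def RegVal.comp {r : ℕ} (ν : RegVal r) (σ : Assignment r) : RegVal r :=
  fun X => (σ X).bind ν.eval

/-- A transition of a transducer with `n` states and `r` registers. -/
structure Transition (n r : ℕ) where
  src : Fin n
  letter : ℕ
  asg : Assignment r
  dst : Fin n

/-- Nondeterministic streaming string transducers. The bag of transitions is given as a list: each
entry is one element of the bag, and equal entries are counted with multiplicity. -/
structure NSST where
  /-- The states are the elements of `Fin numStates`. -/
  numStates : ℕ
  /-- The registers are the elements of `Fin numRegs`. -/
  numRegs : ℕ
  /-- The input alphabet. -/
  inAlph : Finset ℕ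
  /-- The output alphabet. -/
  outAlph : Finset ℕ
  /-- The bag of transitions. -/
  trans : List (Transition numStates numRegs)
  /-- The partial function giving the initial states with their initial valuations. -/
  init : Fin numStates → Option (RegVal numRegs)
  /-- The partial function giving the final states with their output strings. -/
  final : Fin numStates → Option (RegWord numRegs)
  trans_letter_mem : ∀ t ∈ trans, t.letter ∈ inAlph
  trans_asg_over : ∀ t ∈ trans, t.asg.Over outAlph
  trans_asg_copyless : ∀ t ∈ trans, t.asg.Copyless
  init_over : ∀ q ν, init q = some ν → ν.Over outAlph
  final_over : ∀ q u, final q = some u → u.Over outAlph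
  final_copyless : ∀ q u, final q = some u → ∀ X : Fin numRegs, u.count (Sum.inl X) ≤ 1

namespace NSST

/-- A configuration: a state and a valuation of the registers. -/
abbrev Config (T : NSST) : Type := Fin T.numStates × RegVal T.numRegs

/-- The bag of all sequences of steps of `T` over the given string from a given configuration. Each
step is recorded by the assignment that it applies and the configuration that it reaches; every
element of the bag of transitions contributes separately. -/
def stepsFrom (T : NSST) : T.Config → List ℕ → Multiset (List (Assignment T.numRegs × T.Config))
  | _, [] => {[]}
  | c, a :: w =>
    ((T.trans : Multiset (Transition T.numStates T.numRegs)).filter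
      fun t => t.src = c.1 ∧ t.letter = a).bind fun t =>
        (T.stepsFrom (t.dst, c.2.comp t.asg) w).map fun ρ =>
          (t.asg, (t.dst, c.2.comp t.asg)) :: ρ

/-- A run: the initial configuration and the sequence of steps. -/
abbrev Run (T : NSST) : Type := T.Config × List (Assignment T.numRegs × T.Config)

/-- The last configuration of a run. -/
def Run.last {T : NSST} (ρ : T.Run) : T.Config :=
  (ρ.2.getLast?.map Prod.snd).getD ρ.1

/-- The output of a run, undefined if the run is not accepting. -/
def Run.out {T : NSST} (ρ : T.Run) : Option (List ℕ) :=
  (T.final (Run.last ρ).1).bind (Run.last ρ).2.eval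

/-- The bag of all runs (accepting or not) over a string. -/
def allRuns (T : NSST) (w : List ℕ) : Multiset T.Run :=
  (Finset.univ : Finset (Fin T.numStates)).val.bind fun q =>
    match T.init q with
    | none => 0
    | some ν => (T.stepsFrom (q, ν) w).map fun ρ => ((q, ν), ρ)

/-- The bag of all accepting runs over a string. -/
def runs (T : NSST) (w : List ℕ) : Multiset T.Run :=
  (T.allRuns w).filter fun ρ => (Run.out ρ).isSome

/-- The bag semantics: the bag of the outputs of all accepting runs. -/
def sem (T : NSST) (w : List ℕ) : Multiset (List ℕ) :=
  (T.runs w).filterMap Run.out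

/-- The semantics of the composition: the bag union of `T₂.sem D'`, where `D'` ranges over the bag
`T₁.sem D`, each element counted with its multiplicity. -/
def compSem (T₁ T₂ : NSST) (D : List ℕ) : Multiset (List ℕ) :=
  (T₁.sem D).bind T₂.sem

/-- The number of symbols needed to write down a partial map from registers to strings. -/
def tableSize {r : ℕ} {S : Type} (σ : Fin r → Option (List S)) : ℕ :=
  ∑ X : Fin r, (σ X).elim 0 fun u => u.length + 1

/-- The size of a transducer: the number of symbols needed to write it down. It counts states,
registers, letters of both alphabets, and all transitions (with multiplicity), initial and final
entries, together with the lengths of all their strings. -/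
def size (T : NSST) : ℕ :=
  T.numStates + T.numRegs + T.inAlph.card + T.outAlph.card
    + (T.trans.map fun t => tableSize t.asg + 1).sum
    + ∑ q : Fin T.numStates, (T.init q).elim 0 (fun ν => tableSize ν + 1)
    + ∑ q : Fin T.numStates, (T.final q).elim 0 (fun u => u.length + 1)

/-- Codes of strings over registers and letters. -/
abbrev WordCode : Type := List (ℕ ⊕ ℕ)

/-- Codes of transducers: number of states, number of registers, input alphabet, output alphabet,
list of transitions, table of the initial function, table of the final function. -/
abbrev Code : Type :=
  ℕ × ℕ × List ℕ × List ℕ × List (ℕ × ℕ × List (Option WordCode) × ℕ)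
    × List (Option (List (Option (List ℕ)))) × List (Option WordCode)

/-- The code of a string: registers are replaced by their numbers. -/
def wordCode {r : ℕ} (u : RegWord r) : WordCode :=
  u.map (Sum.map Fin.val id)

/-- The explicit finite description of a transducer. -/
def code (T : NSST) : Code :=
  (T.numStates, T.numRegs, T.inAlph.sort, T.outAlph.sort,
    T.trans.map fun t =>
      (t.src.val, t.letter, List.ofFn fun X => (t.asg X).map wordCode, t.dst.val),
    List.ofFn fun q => (T.init q).map fun ν => List.ofFn ν,
    List.ofFn fun q => (T.final q).map wordCode)

end NSST

-- The composed transducer T follows a run of T₁ and must simulate T₂ on an output D' that it never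
-- sees as a whole. A register X of T₁ that contributes to D' holds a factor of D'. For such an X, T
-- guesses what T₂ does on this factor: a block, that is, a first state, a last state and a copyless
-- assignment of the registers of T₂. The new content of X is a concatenation of old contents and
-- letters, so a block on it is a concatenation of blocks on old contents and transitions on letters
-- (`tokenRuns`).
--
-- The assignment of a block is unbounded, but its shape, the sequence of registers in each of its
-- strings, has finitely many values because T₂ is copyless. The shape is kept in the state
-- (`Summary`). The register-free factors are kept in registers of T, at most r + 1 of them for each
-- register X of T₁ and each of the r registers Y of T₂. Updating these factors is copyless, since
-- T₁ uses each X at most once and every block contains each of its factors once.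
--
-- The bag semantics forbids simulating T₂ on a register that is later dropped: its blocks would
-- multiply, or annihilate, the runs. So T guesses at each step the set of registers that
-- contribute. It checks that the previous set consists of the registers read by the strings of the
-- new one, and that the last set is that of the registers in the output string of T₁. The sets are
-- determined backwards, so each accepting run of T₁ admits exactly one correct guess.
--
-- The count rests on multilinearity. Give each register X a list `J X` of available blocks. The sum
-- over the runs of T₂ on a string of tokens is then of degree in X equal to the number of
-- occurrences of X (`hasDegree_tokenRuns`). If the lists contain all blocks on the contents, these
-- runs are those on the evaluated string (`tokenRuns_valBlocks`). Copylessness of T₁ makes all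
-- degrees at most one, so the sum expands over families with one block for each occurring register
-- (`eq_lsum_sections`), which is what the states of T describe. Induction on the input gives
-- `lsum_multiOut`. Replacing registers of T by their contents commutes with all operations on
-- strings (`tokenRuns_hom`, `families_hom`, `symbolicBlocks_hom`), so the symbolic transitions of T
-- compute the actual blocks.
--
-- This yields several initial valuations and output strings for a state; copies of the states
-- restore the required form (`listSem_multi`). The whole construction is primitive recursive on
-- codes. Its size is bounded by an expression built from sums, products and powers with exponent m,
-- where m = |T₁| + |T₂| + 1, hence by two to a polynomial in m.

attribute [fun_prop] Primrec

/-! ### Closure rules for primitive recursive functions. -/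

namespace Primrec

variable {α β γ σ : Type*} [Primcodable α] [Primcodable β] [Primcodable γ] [Primcodable σ]

@[fun_prop] theorem id_fun : Primrec (fun x : α => x) := Primrec.id

@[fun_prop] theorem const_fun (y : β) : Primrec (fun _ : α => y) := Primrec.const y

@[fun_prop] theorem comp_fun {f : β → σ} {g : α → β} (hf : Primrec f) (hg : Primrec g) :
    Primrec fun a => f (g a) := hf.comp hg

@[fun_prop] theorem fst_fun {f : α → β × γ} (hf : Primrec f) : Primrec fun a => (f a).1 :=
  Primrec.fst.comp hf

@[fun_prop] theorem snd_fun {f : α → β × γ} (hf : Primrec f) : Primrec fun a => (f a).2 :=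
  Primrec.snd.comp hf

@[fun_prop] theorem pair_fun {f : α → β} {g : α → γ} (hf : Primrec f) (hg : Primrec g) :
    Primrec fun a => (f a, g a) := Primrec.pair hf hg

@[fun_prop] theorem inl_fun {f : α → β} (hf : Primrec f) :
    Primrec fun a => (Sum.inl (f a) : β ⊕ γ) := Primrec.sumInl.comp hf

@[fun_prop] theorem inr_fun {f : α → γ} (hf : Primrec f) :
    Primrec fun a => (Sum.inr (f a) : β ⊕ γ) := Primrec.sumInr.comp hf

@[fun_prop] theorem sumElim_fun {f : α → β ⊕ γ} {g : α → β → σ} {h : α → γ → σ} (hf : Primrec f)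
    (hg : Primrec fun p : α × β => g p.1 p.2) (hh : Primrec fun p : α × γ => h p.1 p.2) :
    Primrec fun a => Sum.elim (g a) (h a) (f a) :=
  (Primrec.sumCasesOn hf hg hh).of_eq fun a => by cases f a <;> rfl

@[fun_prop] theorem some_fun {f : α → β} (hf : Primrec f) : Primrec fun a => some (f a) :=
  Primrec.option_some.comp hf

@[fun_prop] theorem optionMap_fun {f : α → Option β} {g : α → β → σ} (hf : Primrec f)
    (hg : Primrec fun p : α × β => g p.1 p.2) : Primrec fun a => (f a).map (g a) :=
  Primrec.option_map hf hg

@[fun_prop] theorem optionBind_fun {f : α → Option β} {g : α → β → Option σ} (hf : Primrec f)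
    (hg : Primrec fun p : α × β => g p.1 p.2) : Primrec fun a => (f a).bind (g a) :=
  Primrec.option_bind hf hg

@[fun_prop] theorem optionGetD_fun {f : α → Option β} {g : α → β} (hf : Primrec f)
    (hg : Primrec g) : Primrec fun a => (f a).getD (g a) := Primrec.option_getD.comp hf hg

@[fun_prop] theorem optionElim_fun {f : α → Option β} {d : α → σ} {g : α → β → σ}
    (hf : Primrec f) (hd : Primrec d) (hg : Primrec fun p : α × β => g p.1 p.2) :
    Primrec fun a => (f a).elim (d a) (g a) :=
  (Primrec.option_casesOn hf hd hg).of_eq fun a => by cases f a <;> rfl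

@[fun_prop] theorem optionIsSome_fun {f : α → Option β} (hf : Primrec f) :
    Primrec fun a => (f a).isSome := Primrec.option_isSome.comp hf

@[fun_prop] theorem optionToList_fun {f : α → Option β} (hf : Primrec f) :
    Primrec fun a => (f a).toList := Primrec.optionToList.comp hf

@[fun_prop] theorem cons_fun {f : α → β} {g : α → List β} (hf : Primrec f) (hg : Primrec g) :
    Primrec fun a => f a :: g a := Primrec.list_cons.comp hf hg

@[fun_prop] theorem append_fun {f g : α → List β} (hf : Primrec f) (hg : Primrec g) :
    Primrec fun a => f a ++ g a := Primrec.list_append.comp hf hg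

@[fun_prop] theorem map_fun {f : α → List β} {g : α → β → σ} (hf : Primrec f)
    (hg : Primrec fun p : α × β => g p.1 p.2) : Primrec fun a => (f a).map (g a) :=
  Primrec.list_map hf hg

@[fun_prop] theorem flatMap_fun {f : α → List β} {g : α → β → List σ} (hf : Primrec f)
    (hg : Primrec fun p : α × β => g p.1 p.2) : Primrec fun a => (f a).flatMap (g a) :=
  Primrec.list_flatMap hf hg

@[fun_prop] theorem foldr_fun {f : α → List β} {d : α → σ} {g : α → β → σ → σ} (hf : Primrec f)
    (hd : Primrec d) (hg : Primrec fun p : α × β × σ => g p.1 p.2.1 p.2.2) :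
    Primrec fun a => (f a).foldr (g a) (d a) :=
  Primrec.list_foldr (h := fun a p => g a p.1 p.2) hf hd hg

@[fun_prop] theorem foldl_fun {f : α → List β} {d : α → σ} {g : α → σ → β → σ} (hf : Primrec f)
    (hd : Primrec d) (hg : Primrec fun p : α × σ × β => g p.1 p.2.1 p.2.2) :
    Primrec fun a => (f a).foldl (g a) (d a) :=
  Primrec.list_foldl (h := fun a p => g a p.1 p.2) hf hd hg

@[fun_prop] theorem range_fun {f : α → ℕ} (hf : Primrec f) : Primrec fun a => List.range (f a) :=
  Primrec.list_range.comp hf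

@[fun_prop] theorem length_fun {f : α → List β} (hf : Primrec f) : Primrec fun a => (f a).length :=
  Primrec.list_length.comp hf

@[fun_prop] theorem headI_fun [Inhabited β] {f : α → List β} (hf : Primrec f) :
    Primrec fun a => (f a).headI := Primrec.list_headI.comp hf

@[fun_prop] theorem tail_fun {f : α → List β} (hf : Primrec f) : Primrec fun a => (f a).tail :=
  Primrec.list_tail.comp hf

@[fun_prop] theorem getElem?_fun {f : α → List β} {n : α → ℕ} (hf : Primrec f) (hn : Primrec n) :
    Primrec fun a => (f a)[n a]? := Primrec.list_getElem?.comp hf hn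

@[fun_prop] theorem listGetD_fun {f : α → List β} {n : α → ℕ} {d : α → β} (hf : Primrec f)
    (hn : Primrec n) (hd : Primrec d) : Primrec fun a => (f a).getD (n a) (d a) := by
  simp only [List.getD_eq_getElem?_getD]
  fun_prop

@[fun_prop] theorem idxOf_fun [DecidableEq β] {f : α → β} {g : α → List β} (hf : Primrec f)
    (hg : Primrec g) : Primrec fun a => (g a).idxOf (f a) := Primrec.list_idxOf.comp hf hg

@[fun_prop] theorem add_fun {f g : α → ℕ} (hf : Primrec f) (hg : Primrec g) :
    Primrec fun a => f a + g a := Primrec.nat_add.comp hf hg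

@[fun_prop] theorem mul_fun {f g : α → ℕ} (hf : Primrec f) (hg : Primrec g) :
    Primrec fun a => f a * g a := Primrec.nat_mul.comp hf hg

@[fun_prop] theorem div_fun {f g : α → ℕ} (hf : Primrec f) (hg : Primrec g) :
    Primrec fun a => f a / g a := Primrec.nat_div.comp hf hg

@[fun_prop] theorem mod_fun {f g : α → ℕ} (hf : Primrec f) (hg : Primrec g) :
    Primrec fun a => f a % g a := Primrec.nat_mod.comp hf hg

@[fun_prop] theorem decide_eq_fun {f g : α → β} [∀ a, Decidable (f a = g a)] (hf : Primrec f)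
    (hg : Primrec g) : Primrec fun a => decide (f a = g a) :=
  (Primrec.eq.comp hf hg).decide

@[fun_prop] theorem and_fun {f g : α → Bool} (hf : Primrec f) (hg : Primrec g) :
    Primrec fun a => f a && g a := Primrec.and.comp hf hg

@[fun_prop] theorem or_fun {f g : α → Bool} (hf : Primrec f) (hg : Primrec g) :
    Primrec fun a => f a || g a := Primrec.or.comp hf hg

@[fun_prop] theorem cond_fun {c : α → Bool} {f g : α → β} (hc : Primrec c) (hf : Primrec f)
    (hg : Primrec g) : Primrec fun a => bif c a then f a else g a := Primrec.cond hc hf hg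

@[fun_prop] theorem decide_le_fun {f g : α → ℕ} (hf : Primrec f) (hg : Primrec g) :
    Primrec fun a => decide (f a ≤ g a) := (Primrec.nat_le.comp hf hg).decide

@[fun_prop] theorem filter_fun {f : α → List β} {g : α → β → Bool} (hf : Primrec f)
    (hg : Primrec fun p : α × β => g p.1 p.2) : Primrec fun a => (f a).filter (g a) := by
  have h : Primrec fun a => (f a).flatMap fun b => bif g a b then [b] else [] := by fun_prop
  refine h.of_eq fun a => ?_
  induction f a with
  | nil => rfl
  | cons b l ih => cases hb : g a b <;> simp [hb, ih]

@[fun_prop] theorem any_fun {f : α → List β} {g : α → β → Bool} (hf : Primrec f)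
    (hg : Primrec fun p : α × β => g p.1 p.2) : Primrec fun a => (f a).any (g a) := by
  have h : Primrec fun a => (f a).foldr (fun b acc => g a b || acc) false := by fun_prop
  exact h.of_eq fun a => by induction f a <;> simp_all

@[fun_prop] theorem all_fun {f : α → List β} {g : α → β → Bool} (hf : Primrec f)
    (hg : Primrec fun p : α × β => g p.1 p.2) : Primrec fun a => (f a).all (g a) := by
  have h : Primrec fun a => (f a).foldr (fun b acc => g a b && acc) true := by fun_prop
  exact h.of_eq fun a => by induction f a <;> simp_all

@[fun_prop] theorem replicate_fun {n : α → ℕ} {f : α → β} (hn : Primrec n) (hf : Primrec f) :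
    Primrec fun a => List.replicate (n a) (f a) := by
  have h : Primrec fun a => (List.range (n a)).map fun _ => f a := by fun_prop
  exact h.of_eq fun a => by simp

@[fun_prop] theorem sections_fun {f : α → List (List β)} (hf : Primrec f) :
    Primrec fun a => (f a).sections := by
  have h : Primrec fun a => (f a).foldr (fun l acc => acc.flatMap fun s => l.map fun b => b :: s)
      [[]] := by fun_prop
  refine h.of_eq fun a => ?_
  induction f a with
  | nil => rfl
  | cons l L ih => simp [List.sections, ih]

end Primrec

/-! ### The composition on codes -/

namespace NSST.Compose

/-- Assignments of the second transducer, over an arbitrary output alphabet `Γ`. -/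
abbrev Asg (Γ : Type) : Type := List (Option (List (ℕ ⊕ Γ)))

/-- Transitions over an arbitrary output alphabet. -/
abbrev Trans (Γ : Type) : Type := ℕ × ℕ × Asg Γ × ℕ

/-- A run of the second transducer on a factor of its input, condensed to its first state, its last
state and its effect on the registers. -/
abbrev Block (Γ : Type) : Type := ℕ × ℕ × Asg Γ

/-- What a state of the composition remembers of a block: the two states, and for each register the
registers occurring in the assigned string. -/
abbrev Summary : Type := ℕ × ℕ × List (Option (List ℕ))

/-- The states of the composition, up to multiplicities: a state of the first transducer and, for
each of its registers that contributes to the output, the summary of a block on its content. -/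
abbrev State : Type := ℕ × List (Option Summary)

instance : DecidableEq Summary := inferInstance

instance : DecidableEq State := instDecidableEqProd

section Definitions

variable {Γ : Type}

/-- Substitution of an assignment into a string. -/
def subst (σ : Asg Γ) (u : List (ℕ ⊕ Γ)) : Option (List (ℕ ⊕ Γ)) :=
  u.foldr (fun x acc => acc.bind fun v =>
    Sum.elim (fun Y => (σ.getD Y none).map fun y => y ++ v) (fun g => some (Sum.inr g :: v)) x)
    (some [])

/-- Composition of assignments. -/
def compAsg (σ τ : Asg Γ) : Asg Γ := τ.map fun o => o.bind fun u => subst σ u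

/-- The identity assignment on `r` registers. -/
def idAsg (r : ℕ) : Asg Γ := (List.range r).map fun Y => some [Sum.inl Y]

/-- The maximal register-free factors of a string. -/
def segs (u : List (ℕ ⊕ Γ)) : List (List Γ) :=
  u.foldr (fun x acc =>
    Sum.elim (fun _ => [] :: acc) (fun g => (g :: acc.headI) :: acc.tail) x) [[]]

/-- The registers of a string. -/
def regsOf (u : List (ℕ ⊕ Γ)) : List ℕ := u.flatMap fun x => Sum.elim (fun Y => [Y]) (fun _ => []) x

/-- The letters of a string. -/
def lettersOf (u : List (ℕ ⊕ Γ)) : List Γ :=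
  u.flatMap fun x => Sum.elim (fun _ => []) (fun g => [g]) x

/-- The moves of the second transducer from state `p` on a token: a letter, or a register of the
first transducer whose content is skipped by one of the blocks `J X`. -/
def moves (tr : List (Trans Γ)) (J : ℕ → List (Block Γ)) (x : ℕ ⊕ ℕ) (p : ℕ) :
    List (ℕ × Asg Γ) :=
  Sum.elim (fun X => ((J X).filter fun b => decide (b.1 = p)).map fun b => b.2)
    (fun o => (tr.filter fun t => decide (t.1 = p) && decide (t.2.1 = o)).map fun t => (t.2.2.2, t.2.2.1)) x

/-- The runs of the second transducer on a string of tokens that extend the given partial runs. -/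
def tokenRuns (tr : List (Trans Γ)) (J : ℕ → List (Block Γ)) (u : List (ℕ ⊕ ℕ))
    (L : List (ℕ × Asg Γ)) : List (ℕ × Asg Γ) :=
  u.foldl (fun L x => L.flatMap fun c => (moves tr J x c.1).map fun d => (d.1, compAsg c.2 d.2)) L

/-- The blocks on a string of tokens. -/
def blocks (n r : ℕ) (tr : List (Trans Γ)) (J : ℕ → List (Block Γ)) (u : List (ℕ ⊕ ℕ)) :
    List (Block Γ) :=
  (List.range n).flatMap fun p => (tokenRuns tr J u [(p, idAsg r)]).map fun d => (p, d.1, d.2)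

/-- The families of blocks on the strings `σ X`, for the registers `X < m` selected by `A`. -/
def families (n r m : ℕ) (tr : List (Trans Γ)) (J : ℕ → List (Block Γ)) (A : List Bool)
    (σ : ℕ → Option (List (ℕ ⊕ ℕ))) : List (List (Option (Block Γ))) :=
  ((List.range m).map fun X =>
    bif A.getD X false then
      ((σ X).elim [] fun u => blocks n r tr J u).map fun b => some b
    -- An unselected register has exactly one option, so it does not affect multiplicities.
    else [none]).sections

/-- The summaries of a family of blocks. -/
def summaries (fam : List (Option (Block Γ))) : List (Option Summary) :=
  fam.map fun o => o.map fun b => (b.1, b.2.1, b.2.2.map fun a => a.map fun u => regsOf u)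

/-- The number of the register of the composition that holds the `i`-th register-free factor of the
string assigned to `Y` by the block on the content of `X`. -/
def regIndex (r X Y i : ℕ) : ℕ := (X * r + Y) * (r + 1) + i

/-- The content of the register number `z`, given the family of blocks. -/
def content (r : ℕ) (fam : List (Option (Block Γ))) (z : ℕ) : List Γ :=
  -- A register of the composition without a factor holds the empty word, so none is ever undefined;
  -- undefinedness in the second transducer is recorded by the shapes.
  (((fam.getD (z / (r + 1) / r) none).bind fun b => b.2.2.getD (z / (r + 1) % r) none).map
    fun u => (segs u).getD (z % (r + 1)) []).getD []

/-- The contents of all registers, given the family of blocks. -/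
def contents (m r : ℕ) (fam : List (Option (Block Γ))) : List (Option (List Γ)) :=
  (List.range (m * r * (r + 1))).map fun z => some (content r fam z)

end Definitions

/-- The effect of the block on the content of `X`, written in terms of the registers of the
composition. -/
def unfoldShape (r X : ℕ) (h : List (Option (List ℕ))) : Asg (ℕ ⊕ ℕ) :=
  (List.range h.length).map fun Y => (h.getD Y none).map fun ys =>
    -- A string with k registers has k + 1 register-free factors, one before the first register and
    -- one after each register.
    Sum.inr (Sum.inl (regIndex r X Y 0)) :: (List.range ys.length).flatMap fun i =>
      [Sum.inl (ys.getD i 0), Sum.inr (Sum.inl (regIndex r X Y (i + 1)))]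

/-- The blocks described by a list of summaries. -/
def symbolicBlocks (r : ℕ) (s : List (Option Summary)) (X : ℕ) : List (Block (ℕ ⊕ ℕ)) :=
  (s.getD X none).toList.map fun b => (b.1, b.2.1, unfoldShape r X b.2.2)

/-- Transitions over the letters, seen as transitions over registers of the composition and
letters. -/
def liftTrans (tr : List (Trans ℕ)) : List (Trans (ℕ ⊕ ℕ)) :=
  tr.map fun t => (t.1, t.2.1, t.2.2.1.map fun o => o.map fun u => u.map fun x =>
    Sum.elim (fun Y => Sum.inl Y) (fun g => Sum.inr (Sum.inr g)) x, t.2.2.2)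

/-- All vectors of `m` truth values. -/
def boolVectors (m : ℕ) : List (List Bool) := (List.replicate m [false, true]).sections

/-- The indicator vector of the registers occurring in a string. -/
def occurring (m : ℕ) (v : List (ℕ ⊕ ℕ)) : List Bool :=
  (List.range m).map fun X => v.any fun x => decide (x = Sum.inl X)

/-- The concatenation of the strings assigned to the selected registers. -/
def selected (m : ℕ) (A : List Bool) (σ : List (Option (List (ℕ ⊕ ℕ)))) : List (ℕ ⊕ ℕ) :=
  (List.range m).flatMap fun X => bif A.getD X false then (σ.getD X none).getD [] else []

/-- The steps of the composition from a state: letter read, assignment, next state. -/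
def steps (c₁ c₂ : Code) (s : State) : List (ℕ × List (Option WordCode) × State) :=
  (c₁.2.2.2.2.1.filter fun t => decide (t.1 = s.1)).flatMap fun t =>
    (boolVectors c₁.2.1).flatMap fun A =>
      -- The registers with a block must be exactly those read by the registers guessed for the next
      -- step. This test makes the guess unique along an accepting run.
      bif decide ((s.2.map fun o => o.isSome) = occurring c₁.2.1 (selected c₁.2.1 A t.2.2.1)) then
        (families c₂.1 c₂.2.1 c₁.2.1 (liftTrans c₂.2.2.2.2.1) (fun X => symbolicBlocks c₂.2.1 s.2 X)
          A (fun X => t.2.2.1.getD X none)).map fun fam =>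
            (t.2.1, contents c₁.2.1 c₂.2.1 fam, (t.2.2.2, summaries fam))
      else []

/-- The initial states of the composition, with their valuations and multiplicities. -/
def inits (c₁ c₂ : Code) : List (State × List (Option (List ℕ))) :=
  (List.range c₁.1).flatMap fun q => (c₁.2.2.2.2.2.1.getD q none).toList.flatMap fun ν =>
    -- Every guess is allowed here; it is tested by the first step or, on the empty input, by the
    -- output string.
    (boolVectors c₁.2.1).flatMap fun A =>
      (families c₂.1 c₂.2.1 c₁.2.1 c₂.2.2.2.2.1 (fun _ => []) A
        (fun X => (ν.getD X none).map fun w => w.map fun o => Sum.inr o)).map fun fam =>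
          ((q, summaries fam), contents c₁.2.1 c₂.2.1 fam)

/-- The output strings of a state of the composition, with multiplicities. -/
def finals (c₁ c₂ : Code) (s : State) : List WordCode :=
  (c₁.2.2.2.2.2.2.getD s.1 none).toList.flatMap fun u =>
    bif decide ((s.2.map fun o => o.isSome) = occurring c₁.2.1 u) then
      (List.range c₂.1).flatMap fun p => (c₂.2.2.2.2.2.1.getD p none).toList.flatMap fun ν =>
        -- The initial valuation is used as an assignment without registers, so substituting the
        -- final assignment into the output string of the second transducer leaves letters only.
        (tokenRuns (liftTrans c₂.2.2.2.2.1) (fun X => symbolicBlocks c₂.2.1 s.2 X) u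
          [(p, ν.map fun o => o.map fun w => w.map fun a => Sum.inr (Sum.inr a))]).flatMap fun d =>
            (c₂.2.2.2.2.2.2.getD d.1 none).toList.flatMap fun v =>
              (subst d.2 (v.map fun x => Sum.elim (fun Y => Sum.inl Y)
                (fun g => Sum.inr (Sum.inr g)) x)).toList.map fun y => lettersOf y
    else []

/-- The copyless shapes of assignments on `r` registers. -/
def shapes (r : ℕ) : List (List (Option (List ℕ))) :=
  -- A string without repetitions over r registers has length at most r.
  (List.replicate r (none :: (List.range (r + 1)).flatMap fun j =>
    (List.replicate j (List.range r)).sections.map fun ys => some ys)).sections.filter fun h =>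
      (List.range r).all fun Y =>
        decide (((h.flatMap fun o => o.getD []).filter fun Y' => decide (Y' = Y)).length ≤ 1)

/-- The states of the composition. -/
def states (c₁ c₂ : Code) : List State :=
  (List.range c₁.1).flatMap fun q =>
    (List.replicate c₁.2.1 (none :: (List.range c₂.1).flatMap fun p =>
      (List.range c₂.1).flatMap fun p' =>
        (shapes c₂.2.1).map fun h => some (p, p', h))).sections.map fun s => (q, s)

/-! ### Copies of states carrying one initial valuation and one output string each. -/

section Multi

variable {S : Type}

/-- The states of the transducer built from a machine with several initial valuations and several
output strings for each state. -/
def multiStates (S₀ : List S) (K L : ℕ) : List (ℕ × ℕ × S) :=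
  (List.range K).flatMap fun k => (List.range L).flatMap fun l => S₀.map fun s => (k, l, s)

/-- The transitions of the transducer built from a machine with several initial valuations and
several output strings for each state. -/
def multiTrans (S₀ : List S) (K L : ℕ) (step : S → List (ℕ × List (Option WordCode) × S)) :
    List ((ℕ × ℕ × S) × ℕ × List (Option WordCode) × ℕ × ℕ × S) :=
  -- Only copies with `l = 0` are left, and all copies with `k = 0` are entered: `k` matters for the
  -- first configuration only, and `l` is guessed when the last one is entered.
  (List.range K).flatMap fun k => S₀.flatMap fun s => (step s).flatMap fun t =>
    (List.range L).map fun l => ((k, 0, s), t.1, t.2.1, (0, l, t.2.2))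

/-- The initial function of the transducer built from a machine with several initial valuations. -/
def multiInit [DecidableEq S] (ini : List (S × List (Option (List ℕ)))) (s : ℕ × ℕ × S) :
    Option (List (Option (List ℕ))) :=
  (ini[s.1]?).bind fun e => bif decide (e.1 = s.2.2) then some e.2 else none

/-- The final function of the transducer built from a machine with several output strings. -/
def multiFinal (fin : S → List WordCode) (s : ℕ × ℕ × S) : Option WordCode := (fin s.2.2)[s.2.1]?

/-- The code of a transducer whose states are the elements of a list. -/
def numberedCode [DecidableEq S] (S₀ : List S) (r : ℕ) (inA outA : List ℕ)
    (tr : List (S × ℕ × List (Option WordCode) × S))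
    (ini : S → Option (List (Option (List ℕ)))) (fin : S → Option WordCode) : Code :=
  (S₀.length, r, inA, outA,
    tr.map fun t => (S₀.idxOf t.1, t.2.1, t.2.2.1, S₀.idxOf t.2.2.2), S₀.map ini, S₀.map fin)

end Multi

/-- The number of copies of the states needed for the initial valuations. -/
def initBound (c₁ c₂ : Code) : ℕ := (inits c₁ c₂).length + 1

/-- The number of copies of the states needed for the output strings. -/
def finalBound (c₁ c₂ : Code) : ℕ :=
  -- The total over all states bounds the number for each of them; the summand 1 keeps the index 0
  -- available.
  ((states c₁ c₂).flatMap fun s => finals c₁ c₂ s).length + 1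

/-- The code of the composition. -/
def composeCode (c₁ c₂ : Code) : Code :=
  numberedCode (multiStates (states c₁ c₂) (initBound c₁ c₂) (finalBound c₁ c₂))
    (c₁.2.1 * c₂.2.1 * (c₂.2.1 + 1)) c₁.2.2.1 c₂.2.2.2.1
    (multiTrans (states c₁ c₂) (initBound c₁ c₂) (finalBound c₁ c₂) fun s => steps c₁ c₂ s)
    (fun s => multiInit (inits c₁ c₂) s) (fun s => multiFinal (fun st => finals c₁ c₂ st) s)

/-! ### Computability of the composition -/

section Computability

variable {α Γ S : Type} [Primcodable α] [Primcodable Γ] [Primcodable S]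

@[fun_prop] theorem subst_primrec {f : α → Asg Γ} {g : α → List (ℕ ⊕ Γ)} (hf : Primrec f)
    (hg : Primrec g) : Primrec fun a => subst (f a) (g a) := by
  unfold subst; fun_prop

@[fun_prop] theorem compAsg_primrec {f g : α → Asg Γ} (hf : Primrec f) (hg : Primrec g) :
    Primrec fun a => compAsg (f a) (g a) := by
  unfold compAsg; fun_prop

@[fun_prop] theorem idAsg_primrec {f : α → ℕ} (hf : Primrec f) :
    Primrec fun a => (idAsg (f a) : Asg Γ) := by
  unfold idAsg; fun_prop

@[fun_prop] theorem segs_primrec {f : α → List (ℕ ⊕ Γ)} (hf : Primrec f) :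
    Primrec fun a => segs (f a) := by
  unfold segs; fun_prop

@[fun_prop] theorem regsOf_primrec {f : α → List (ℕ ⊕ Γ)} (hf : Primrec f) :
    Primrec fun a => regsOf (f a) := by
  unfold regsOf; fun_prop

@[fun_prop] theorem lettersOf_primrec {f : α → List (ℕ ⊕ Γ)} (hf : Primrec f) :
    Primrec fun a => lettersOf (f a) := by
  unfold lettersOf; fun_prop

@[fun_prop] theorem moves_primrec {tr : α → List (Trans Γ)} {J : α → ℕ → List (Block Γ)}
    {x : α → ℕ ⊕ ℕ} {p : α → ℕ} (ht : Primrec tr) (hJ : Primrec fun a : α × ℕ => J a.1 a.2)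
    (hx : Primrec x) (hp : Primrec p) : Primrec fun a => moves (tr a) (J a) (x a) (p a) := by
  unfold moves; fun_prop

@[fun_prop] theorem tokenRuns_primrec {tr : α → List (Trans Γ)} {J : α → ℕ → List (Block Γ)}
    {u : α → List (ℕ ⊕ ℕ)} {L : α → List (ℕ × Asg Γ)} (ht : Primrec tr)
    (hJ : Primrec fun a : α × ℕ => J a.1 a.2) (hu : Primrec u) (hL : Primrec L) :
    Primrec fun a => tokenRuns (tr a) (J a) (u a) (L a) := by
  unfold tokenRuns; fun_prop

@[fun_prop] theorem blocks_primrec {n r : α → ℕ} {tr : α → List (Trans Γ)}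
    {J : α → ℕ → List (Block Γ)} {u : α → List (ℕ ⊕ ℕ)} (hn : Primrec n) (hr : Primrec r)
    (ht : Primrec tr) (hJ : Primrec fun a : α × ℕ => J a.1 a.2) (hu : Primrec u) :
    Primrec fun a => blocks (n a) (r a) (tr a) (J a) (u a) := by
  unfold blocks; fun_prop

@[fun_prop] theorem families_primrec {n r m : α → ℕ} {tr : α → List (Trans Γ)}
    {J : α → ℕ → List (Block Γ)} {A : α → List Bool} {σ : α → ℕ → Option (List (ℕ ⊕ ℕ))}
    (hn : Primrec n) (hr : Primrec r) (hm : Primrec m)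
    (ht : Primrec tr) (hJ : Primrec fun a : α × ℕ => J a.1 a.2) (hA : Primrec A)
    (hσ : Primrec fun a : α × ℕ => σ a.1 a.2) :
    Primrec fun a => families (n a) (r a) (m a) (tr a) (J a) (A a) (σ a) := by
  unfold families; fun_prop

@[fun_prop] theorem summaries_primrec {f : α → List (Option (Block Γ))} (hf : Primrec f) :
    Primrec fun a => summaries (f a) := by
  unfold summaries; fun_prop

@[fun_prop] theorem contents_primrec {m r : α → ℕ} {f : α → List (Option (Block Γ))}
    (hm : Primrec m) (hr : Primrec r) (hf : Primrec f) :
    Primrec fun a => contents (m a) (r a) (f a) := by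
  unfold contents content; fun_prop

@[fun_prop] theorem symbolicBlocks_primrec {r X : α → ℕ} {s : α → List (Option Summary)}
    (hr : Primrec r) (hs : Primrec s) (hX : Primrec X) :
    Primrec fun a => symbolicBlocks (r a) (s a) (X a) := by
  unfold symbolicBlocks unfoldShape regIndex; fun_prop

@[fun_prop] theorem liftTrans_primrec {f : α → List (Trans ℕ)} (hf : Primrec f) :
    Primrec fun a => liftTrans (f a) := by
  unfold liftTrans; fun_prop

@[fun_prop] theorem boolVectors_primrec {m : α → ℕ} (hm : Primrec m) :
    Primrec fun a => boolVectors (m a) := by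
  unfold boolVectors; fun_prop

@[fun_prop] theorem occurring_primrec {m : α → ℕ} {v : α → List (ℕ ⊕ ℕ)} (hm : Primrec m)
    (hv : Primrec v) : Primrec fun a => occurring (m a) (v a) := by
  unfold occurring; fun_prop

@[fun_prop] theorem selected_primrec {m : α → ℕ} {A : α → List Bool}
    {σ : α → List (Option (List (ℕ ⊕ ℕ)))} (hm : Primrec m) (hA : Primrec A) (hσ : Primrec σ) :
    Primrec fun a => selected (m a) (A a) (σ a) := by
  unfold selected; fun_prop

@[fun_prop] theorem steps_primrec {c₁ c₂ : α → Code} {s : α → State} (h₁ : Primrec c₁)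
    (h₂ : Primrec c₂) (hs : Primrec s) : Primrec fun a => steps (c₁ a) (c₂ a) (s a) := by
  unfold steps; fun_prop

@[fun_prop] theorem inits_primrec {c₁ c₂ : α → Code} (h₁ : Primrec c₁)
    (h₂ : Primrec c₂) : Primrec fun a => inits (c₁ a) (c₂ a) := by
  unfold inits; fun_prop

@[fun_prop] theorem finals_primrec {c₁ c₂ : α → Code} {s : α → State} (h₁ : Primrec c₁)
    (h₂ : Primrec c₂) (hs : Primrec s) : Primrec fun a => finals (c₁ a) (c₂ a) (s a) := by
  unfold finals; fun_prop

@[fun_prop] theorem shapes_primrec {r : α → ℕ} (hr : Primrec r) :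
    Primrec fun a => shapes (r a) := by
  unfold shapes; fun_prop

@[fun_prop] theorem states_primrec {c₁ c₂ : α → Code} (h₁ : Primrec c₁)
    (h₂ : Primrec c₂) : Primrec fun a => states (c₁ a) (c₂ a) := by
  unfold states; fun_prop

@[fun_prop] theorem multiStates_primrec {S₀ : α → List S} {K L : α → ℕ} (hS : Primrec S₀)
    (hK : Primrec K) (hL : Primrec L) : Primrec fun a => multiStates (S₀ a) (K a) (L a) := by
  unfold multiStates; fun_prop

@[fun_prop] theorem multiTrans_primrec {S₀ : α → List S} {K L : α → ℕ}
    {step : α → S → List (ℕ × List (Option WordCode) × S)} (hS : Primrec S₀)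
    (hK : Primrec K) (hL : Primrec L) (hs : Primrec fun a : α × S => step a.1 a.2) :
    Primrec fun a => multiTrans (S₀ a) (K a) (L a) (step a) := by
  unfold multiTrans; fun_prop

@[fun_prop] theorem multiInit_primrec [DecidableEq S] {ini : α → List (S × List (Option (List ℕ)))}
    {s : α → ℕ × ℕ × S} (hi : Primrec ini) (hs : Primrec s) :
    Primrec fun a => multiInit (ini a) (s a) := by
  unfold multiInit; fun_prop

@[fun_prop] theorem multiFinal_primrec {fin : α → S → List WordCode}
    {s : α → ℕ × ℕ × S} (hi : Primrec fun a : α × S => fin a.1 a.2) (hs : Primrec s) :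
    Primrec fun a => multiFinal (fin a) (s a) := by
  unfold multiFinal; fun_prop

@[fun_prop] theorem numberedCode_primrec [DecidableEq S] {S₀ : α → List S} {r : α → ℕ} {inA outA : α → List ℕ}
    {tr : α → List (S × ℕ × List (Option WordCode) × S)}
    {ini : α → S → Option (List (Option (List ℕ)))} {fin : α → S → Option WordCode}
    (hS : Primrec S₀) (hr : Primrec r) (hi : Primrec inA) (ho : Primrec outA) (ht : Primrec tr)
    (hini : Primrec fun a : α × S => ini a.1 a.2) (hfin : Primrec fun a : α × S => fin a.1 a.2) :
    Primrec fun a => numberedCode (S₀ a) (r a) (inA a) (outA a) (tr a) (ini a) (fin a) := by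
  unfold numberedCode; fun_prop

theorem composeCode_computable : Computable₂ composeCode := by
  have h : Primrec fun c : Code × Code => composeCode c.1 c.2 := by
    unfold composeCode initBound finalBound; fun_prop
  exact h.to_comp

end Computability

end NSST.Compose

/-! ### Sums over lists -/

namespace NSST.Compose

section ListSums

variable {α β M : Type*} [AddCommMonoid M]

/-- The sum of `f` over a list. -/
def lsum (l : List α) (f : α → M) : M := (l.map f).sum

@[simp] theorem lsum_nil (f : α → M) : lsum [] f = 0 := rfl

@[simp] theorem lsum_cons (a : α) (l : List α) (f : α → M) :
    lsum (a :: l) f = f a + lsum l f := by simp [lsum]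

theorem lsum_singleton (a : α) (f : α → M) : lsum [a] f = f a := by simp

@[simp] theorem lsum_append (l l' : List α) (f : α → M) :
    lsum (l ++ l') f = lsum l f + lsum l' f := by simp [lsum]

@[simp] theorem lsum_map (g : α → β) (l : List α) (f : β → M) :
    lsum (l.map g) f = lsum l fun a => f (g a) := by simp [lsum, Function.comp_def]

@[simp] theorem lsum_flatMap (g : α → List β) (l : List α) (f : β → M) :
    lsum (l.flatMap g) f = lsum l fun a => lsum (g a) f := by
  induction l <;> simp_all

theorem lsum_congr {l : List α} {f g : α → M} (h : ∀ a ∈ l, f a = g a) : lsum l f = lsum l g := by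
  rw [lsum, lsum, List.map_congr_left h]

@[simp] theorem lsum_zero (l : List α) : lsum l (fun _ => (0 : M)) = 0 := by
  induction l <;> simp_all

theorem lsum_add (l : List α) (f g : α → M) :
    lsum l (fun a => f a + g a) = lsum l f + lsum l g := by
  induction l with
  | nil => simp
  | cons a l ih => simp only [lsum_cons, ih]; abel

theorem lsum_comm (l : List α) (l' : List β) (f : α → β → M) :
    lsum l (fun a => lsum l' (f a)) = lsum l' fun b => lsum l fun a => f a b := by
  induction l with
  | nil => simp
  | cons a l ih => simp only [lsum_cons, ih, lsum_add]

theorem lsum_filter (l : List α) (p : α → Bool) (f : α → M) :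
    lsum (l.filter p) f = lsum l fun a => bif p a then f a else 0 := by
  induction l with
  | nil => simp
  | cons a l ih => cases h : p a <;> simp [h, ih]

theorem lsum_cond (b : Bool) (l l' : List α) (f : α → M) :
    lsum (bif b then l else l') f = bif b then lsum l f else lsum l' f := by cases b <;> rfl

theorem lsum_decide_eq [DecidableEq α] {l : List α} (hl : l.Nodup) {a : α} (ha : a ∈ l)
    (f : α → M) : (lsum l fun b => bif decide (a = b) then f b else 0) = f a := by
  induction l with
  | nil => simp at ha
  | cons b l ih =>
    rw [List.nodup_cons] at hl
    rw [lsum_cons]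
    by_cases hab : a = b
    · subst hab
      rw [lsum_congr (g := fun _ => 0)]
      · simp
      · intro b hb
        have : a ≠ b := fun h => hl.1 (h ▸ hb)
        simp [this]
    · rw [ih hl.2 (by simpa [hab] using ha)]
      simp [hab]

theorem lsum_sections_cons (l : List α) (L : List (List α)) (f : List α → M) :
    lsum (l :: L).sections f = lsum L.sections fun s => lsum l fun a => f (a :: s) := by
  simp [List.sections]

/-- Turns a sum over copies of a state, where copy `i` carries entry `i`, into a sum over the
entries. Copies beyond the list contribute nothing. -/
theorem lsum_range_getElem? (l : List α) {n : ℕ} (hn : l.length ≤ n) (f : α → M) :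
    (lsum (List.range n) fun i => lsum (l[i]?).toList f) = lsum l f := by
  induction l generalizing n with
  | nil => simp
  | cons a l ih =>
    obtain ⟨n, rfl⟩ : ∃ k, n = k + 1 := ⟨n - 1, by simp at hn; omega⟩
    rw [List.range_succ_eq_map]
    simp [ih (by simpa using hn : l.length ≤ n)]

theorem bind_eq_lsum (l : List α) (f : α → Multiset β) :
    (l : Multiset α).bind f = lsum l f := by
  simp [Multiset.bind, Multiset.join, lsum]

theorem lsum_bind {γ : Type*} (l : List α) (f : α → Multiset β) (g : β → Multiset γ) :
    (lsum l f).bind g = lsum l fun a => (f a).bind g := by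
  induction l <;> simp_all [Multiset.add_bind]

end ListSums

/-! ### Semantics of codes -/

/-- Valuations of registers that are given by their numbers. -/
abbrev Val : Type := ℕ → Option (List ℕ)

/-- The valuation given by a table. -/
def tableVal (l : List (Option (List ℕ))) : Val := fun X => l.getD X none

/-- The extension of a valuation to strings. -/
def evalWord (ν : Val) : WordCode → Option (List ℕ)
  | [] => some []
  | Sum.inl X :: u => (ν X).bind fun x => (evalWord ν u).map fun y => x ++ y
  | Sum.inr o :: u => (evalWord ν u).map fun y => o :: y

/-- The composition of a valuation and an assignment. -/
def compVal (ν : Val) (σ : List (Option WordCode)) : Val :=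
  fun X => (σ.getD X none).bind (evalWord ν)

/-- The bag of outputs of the runs from a configuration. -/
def outFrom {S : Type} [DecidableEq S] (tr : List (S × ℕ × List (Option WordCode) × S))
    (fin : S → Option WordCode) : List ℕ → S → Val → Multiset (List ℕ)
  | [], s, ν => lsum (fin s).toList fun u => ((evalWord ν u).toList : Multiset (List ℕ))
  | a :: w, s, ν => lsum (tr.filter fun t => decide (t.1 = s) && decide (t.2.1 = a)) fun t =>
      outFrom tr fin w t.2.2.2 (compVal ν t.2.2.1)

/-- The bag semantics of a transducer whose states are the elements of a list. -/
def listSem {S : Type} [DecidableEq S] (S₀ : List S) (tr : List (S × ℕ × List (Option WordCode) × S))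
    (ini : S → Option (List (Option (List ℕ)))) (fin : S → Option WordCode) (w : List ℕ) :
    Multiset (List ℕ) :=
  lsum S₀ fun s => lsum (ini s).toList fun v => outFrom tr fin w s (tableVal v)

/-- The bag semantics of a code. -/
def codeSem (c : Code) (w : List ℕ) : Multiset (List ℕ) :=
  listSem (List.range c.1) c.2.2.2.2.1 (fun q => c.2.2.2.2.2.1.getD q none)
    (fun q => c.2.2.2.2.2.2.getD q none) w

/-- A valuation of the registers `Fin r`, seen as a valuation of numbers. -/
def extendVal {r : ℕ} (ν : RegVal r) : Val := fun X => if h : X < r then ν ⟨X, h⟩ else none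

theorem getD_ofFn {α : Type*} {r : ℕ} (f : Fin r → α) (d : α) (X : ℕ) :
    (List.ofFn f).getD X d = if h : X < r then f ⟨X, h⟩ else d := by
  simp only [List.getD_eq_getElem?_getD, List.getElem?_ofFn]
  split <;> simp

theorem evalWord_wordCode {r : ℕ} (ν : RegVal r) (u : RegWord r) :
    evalWord (extendVal ν) (wordCode u) = ν.eval u := by
  induction u with
  | nil => rfl
  | cons x u ih =>
    have ih' : evalWord (extendVal ν) (List.map (Sum.map Fin.val id) u) = ν.eval u := ih
    cases x with
    | inl X => simp [wordCode, evalWord, RegVal.eval, ih', extendVal]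
    | inr o => simp [wordCode, evalWord, RegVal.eval, ih']

theorem compVal_extendVal {r : ℕ} (ν : RegVal r) (σ : Assignment r) :
    compVal (extendVal ν) (List.ofFn fun X => (σ X).map wordCode) = extendVal (ν.comp σ) := by
  funext X
  simp only [compVal, getD_ofFn, extendVal, RegVal.comp]
  split
  · rename_i h
    cases σ ⟨X, h⟩ with
    | none => rfl
    | some u => exact evalWord_wordCode ν u
  · rfl

theorem tableVal_ofFn {r : ℕ} (ν : RegVal r) : tableVal (List.ofFn ν) = extendVal ν := by
  funext X
  simp only [tableVal, getD_ofFn, extendVal]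

/-! ### Agreement of the semantics by runs with the semantics of codes. -/

section Link

variable (T : NSST)

theorem last_cons (c c' : T.Config) (σ : Assignment T.numRegs)
    (ρ : List (Assignment T.numRegs × T.Config)) :
    Run.last (T := T) (c, (σ, c') :: ρ) = Run.last (T := T) (c', ρ) := by
  cases ρ with
  | nil => rfl
  | cons x ρ => simp [Run.last, List.getLast?_cons]

theorem filterMap_bind {α β γ : Type*} (s : Multiset α) (f : α → Multiset β) (g : β → Option γ) :
    (s.bind f).filterMap g = s.bind fun a => (f a).filterMap g := by
  induction s using Multiset.induction <;> simp_all [Multiset.filterMap_add]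

/-- The bag of outputs of the runs from a configuration of a transducer. -/
theorem filterMap_stepsFrom (w : List ℕ) (c : T.Config) :
    (T.stepsFrom c w).filterMap (fun ρ => Run.out (T := T) (c, ρ)) =
      outFrom T.code.2.2.2.2.1 (fun q => T.code.2.2.2.2.2.2.getD q none) w c.1.val
        (extendVal c.2) := by
  induction w generalizing c with
  | nil =>
    have h : (T.code.2.2.2.2.2.2.getD c.1.val none) = (T.final c.1).map wordCode := by
      simp [code]
    simp only [stepsFrom, outFrom, h, Run.out, Run.last]
    cases hf : T.final c.1 with
    | none => simp [hf, ← Multiset.cons_zero]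
    | some u =>
      simp only [Option.map_some, Option.toList_some, lsum_singleton, evalWord_wordCode]
      cases he : c.2.eval u <;> simp [hf, he, ← Multiset.cons_zero]
  | cons a w ih =>
    simp only [stepsFrom, outFrom, filterMap_bind, Multiset.filterMap_map, Function.comp_def]
    rw [Multiset.filter_coe, bind_eq_lsum, lsum_filter, lsum_filter]
    simp only [code, lsum_map]
    refine lsum_congr fun t _ => ?_
    by_cases h : t.src = c.1 ∧ t.letter = a
    · have h' : t.src.val = c.1.val := by rw [h.1]
      simp only [h, and_self, decide_true, Bool.and_self, cond_true]
      have := ih (t.dst, c.2.comp t.asg)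
      simp only [code] at this
      rw [compVal_extendVal, ← this]
      refine congrArg (Multiset.filterMap · _) (funext fun ρ => ?_)
      simp only [Run.out, last_cons]
    · have h' : ¬ (t.src.val = c.1.val ∧ t.letter = a) := fun h' => h ⟨Fin.ext h'.1, h'.2⟩
      rw [← Bool.decide_and]
      simp [h, h']

theorem sem_eq_codeSem (w : List ℕ) : T.sem w = codeSem T.code w := by
  -- Discarding the runs without output beforehand changes nothing, since `filterMap` discards them
  -- as well.
  have h₁ : T.sem w = (T.allRuns w).filterMap Run.out := by
    rw [sem, runs, Multiset.filterMap_filter]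
    refine congrArg (Multiset.filterMap · _) (funext fun ρ => ?_)
    cases h : Run.out ρ <;> simp
  have h₂ : (Finset.univ : Finset (Fin T.numStates)).val =
      ((List.finRange T.numStates : List (Fin T.numStates)) : Multiset _) := rfl
  rw [h₁, allRuns, filterMap_bind, h₂, bind_eq_lsum, codeSem, listSem]
  have h₃ : List.range T.code.1 = (List.finRange T.numStates).map Fin.val := by
    simp [code]
  rw [h₃, lsum_map]
  refine lsum_congr fun q _ => ?_
  have h₄ : T.code.2.2.2.2.2.1.getD q.val none = (T.init q).map fun ν => List.ofFn ν := by
    simp [code]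
  simp only [h₄]
  cases hq : T.init q with
  | none => simp
  | some ν =>
    simp only [Multiset.filterMap_map, Option.map_some, Option.toList_some, lsum_singleton,
      tableVal_ofFn]
    exact filterMap_stepsFrom T w (q, ν)

end Link

/-! ### Numbering the states -/

section Numbering

variable {S : Type} [DecidableEq S] {S₀ : List S} {tr : List (S × ℕ × List (Option WordCode) × S)}

/-- On members of `S₀` the map `idxOf` is injective, so comparing the numbers of states is comparing
the states. Targets are required to be in `S₀` to continue the induction. -/
theorem outFrom_idxOf (htr : ∀ t ∈ tr, t.1 ∈ S₀ ∧ t.2.2.2 ∈ S₀)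
    (fin : S → Option WordCode) (w : List ℕ) {s : S} (hs : s ∈ S₀) (ν : Val) :
    outFrom (tr.map fun t => (S₀.idxOf t.1, t.2.1, t.2.2.1, S₀.idxOf t.2.2.2))
      (fun q => (S₀.map fin).getD q none) w (S₀.idxOf s) ν = outFrom tr fin w s ν := by
  induction w generalizing s ν with
  | nil =>
    have h : (S₀.map fin).getD (S₀.idxOf s) none = fin s := by
      simp [List.getD_eq_getElem?_getD, List.getElem?_idxOf hs]
    simp only [outFrom, h]
  | cons a w ih =>
    simp only [outFrom, lsum_filter, lsum_map]
    refine lsum_congr fun t ht => ?_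
    rw [ih (htr t ht).2]
    congr 2
    rw [decide_eq_decide]
    exact List.idxOf_inj (htr t ht).1

/-- Without repetitions in `S₀`, the numbers of its members in order are exactly the range, so the
sums over first states agree term by term. -/
theorem codeSem_numberedCode (hS : S₀.Nodup) (htr : ∀ t ∈ tr, t.1 ∈ S₀ ∧ t.2.2.2 ∈ S₀) (r : ℕ)
    (inA outA : List ℕ) (ini : S → Option (List (Option (List ℕ)))) (fin : S → Option WordCode)
    (w : List ℕ) :
    codeSem (numberedCode S₀ r inA outA tr ini fin) w = listSem S₀ tr ini fin w := by
  have h : List.range S₀.length = S₀.map fun s => S₀.idxOf s := by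
    refine List.ext_getElem (by simp) fun i h₁ h₂ => ?_
    simp [hS.idxOf_getElem]
  simp only [codeSem, numberedCode, listSem, h, lsum_map]
  refine lsum_congr fun s hs => ?_
  have h' : (S₀.map ini).getD (S₀.idxOf s) none = ini s := by
    simp [List.getD_eq_getElem?_getD, List.getElem?_idxOf hs]
  rw [h']
  exact lsum_congr fun v _ => outFrom_idxOf htr fin w hs _

end Numbering

/-! ### Several initial valuations and output strings -/

theorem mem_multiStates {S : Type} {S₀ : List S} {K L k l : ℕ} {s : S} :
    (k, l, s) ∈ multiStates S₀ K L ↔ k < K ∧ l < L ∧ s ∈ S₀ := by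
  simp [multiStates]

theorem nodup_multiStates {S : Type} {S₀ : List S} {K L : ℕ} (hS : S₀.Nodup) : (multiStates S₀ K L).Nodup := by
  unfold multiStates
  refine List.nodup_flatMap.2 ⟨fun k _ => List.nodup_flatMap.2 ⟨fun l _ => ?_, ?_⟩, ?_⟩
  · exact hS.map fun s s' h => by simpa using h
  · refine List.nodup_range.imp fun {l l'} h => ?_
    simp only [Function.onFun, List.disjoint_left, List.mem_map]
    rintro _ ⟨s, _, rfl⟩ ⟨s', _, h'⟩
    simp only [Prod.mk.injEq] at h'
    exact h h'.2.1.symm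
  · refine List.nodup_range.imp fun {k k'} h => ?_
    simp only [Function.onFun, List.disjoint_left, List.mem_map, List.mem_flatMap]
    rintro _ ⟨l, _, s, _, rfl⟩ ⟨l', _, s', _, h'⟩
    simp only [Prod.mk.injEq] at h'
    exact h h'.1.symm

section Multi

variable {S : Type} [DecidableEq S]

/-- The bag of outputs from a configuration of a machine with several output strings. -/
def multiOut (step : S → List (ℕ × List (Option WordCode) × S)) (fin : S → List WordCode) :
    List ℕ → S → Val → Multiset (List ℕ)
  | [], s, ν => lsum (fin s) fun u => ((evalWord ν u).toList : Multiset (List ℕ))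
  | a :: w, s, ν => lsum ((step s).filter fun t => decide (t.1 = a)) fun t =>
      multiOut step fin w t.2.2 (compVal ν t.2.1)

variable {S₀ : List S} {step : S → List (ℕ × List (Option WordCode) × S)}
  {fin : S → List WordCode} {K L : ℕ}

/-- A copy with `l ≠ 0` has no outgoing transition; copy 0 imitates every step of `s` once for each
index `l'` of the target. -/
theorem lsum_filter_multiTrans {M : Type*} [AddCommMonoid M] (hS : S₀.Nodup) {k l a : ℕ} {s : S}
    (hk : k < K) (hs : s ∈ S₀)
    (f : (ℕ × ℕ × S) × ℕ × List (Option WordCode) × ℕ × ℕ × S → M) :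
    lsum ((multiTrans S₀ K L step).filter fun t =>
      decide (t.1 = (k, l, s)) && decide (t.2.1 = a)) f =
    bif decide (0 = l) then lsum ((step s).filter fun t => decide (t.1 = a)) fun t =>
      lsum (List.range L) fun l' => f ((k, 0, s), t.1, t.2.1, (0, l', t.2.2)) else 0 := by
  simp only [lsum_filter, multiTrans, lsum_flatMap, lsum_map]
  have h : ∀ k' s', decide ((k', 0, s') = (k, l, s)) =
      (decide (k = k') && (decide (s = s') && decide (0 = l))) := by
    intro k' s'
    rw [← Bool.decide_and, ← Bool.decide_and, decide_eq_decide]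
    simp only [Prod.mk.injEq]
    tauto
  simp only [h]
  -- The conjunction is split into nested tests, so that each sum with an equality test collapses to
  -- a single term.
  have e : ∀ k' s' (t : ℕ × List (Option WordCode) × S) l',
      (bif decide (k = k') && (decide (s = s') && decide (0 = l)) && decide (t.1 = a) then
        f ((k', 0, s'), t.1, t.2.1, 0, l', t.2.2) else 0) =
      bif decide (0 = l) then (bif decide (k = k') then (bif decide (s = s') then
        (bif decide (t.1 = a) then f ((k', 0, s'), t.1, t.2.1, 0, l', t.2.2) else 0)
          else 0) else 0) else 0 := by
    intro k' s' t l'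
    cases decide (k = k') <;> cases decide (s = s') <;> cases decide (0 = l) <;> rfl
  have pull : ∀ {α : Type} (b : Bool) (x : List α) (g : α → M),
      (lsum x fun y => bif b then g y else 0) = bif b then lsum x g else 0 := by
    intro α b x g
    cases b <;> simp
  simp only [e, pull]
  rw [lsum_decide_eq List.nodup_range (List.mem_range.2 hk), lsum_decide_eq hS hs]

/-- Summed over `l`, the copies of `s` behave like `s`. At the end of the word copy `l` carries
output string number `l`; before the end only copy 0 moves, and its targets again run over all `l`.
-/
theorem lsum_outFrom_multi (hS : S₀.Nodup) (hstep : ∀ s ∈ S₀, ∀ t ∈ step s, t.2.2 ∈ S₀)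
    (hfin : ∀ s ∈ S₀, (fin s).length < L) (hK : 0 < K) (w : List ℕ) {k : ℕ} {s : S} (hk : k < K)
    (hs : s ∈ S₀) (ν : Val) :
    (lsum (List.range L) fun l =>
      outFrom (multiTrans S₀ K L step) (multiFinal fin) w (k, l, s) ν) =
    multiOut step fin w s ν := by
  induction w generalizing k s ν with
  | nil =>
    simp only [outFrom, multiOut, multiFinal]
    exact lsum_range_getElem? _ (hfin s hs).le _
  | cons a w ih =>
    simp only [outFrom, multiOut, lsum_filter_multiTrans hS hk hs]
    rw [lsum_decide_eq List.nodup_range (List.mem_range.2 (Nat.zero_lt_of_lt (hfin s hs)))]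
    exact lsum_congr fun t ht => ih hK (hstep s hs t (List.mem_of_mem_filter ht)) _

/-- The index `k` of the first copy selects entry `k` of `ini`, so an entry is counted once even if
several entries concern the same state. -/
theorem listSem_multi (hS : S₀.Nodup) (hstep : ∀ s ∈ S₀, ∀ t ∈ step s, t.2.2 ∈ S₀)
    (hfin : ∀ s ∈ S₀, (fin s).length < L) {ini : List (S × List (Option (List ℕ)))}
    (hini : ∀ e ∈ ini, e.1 ∈ S₀) (hK : ini.length < K) (w : List ℕ) :
    listSem (multiStates S₀ K L) (multiTrans S₀ K L step) (multiInit ini) (multiFinal fin) w =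
    lsum ini fun e => multiOut step fin w e.1 (tableVal e.2) := by
  simp only [listSem, multiStates, lsum_flatMap, lsum_map]
  have h : ∀ k ∈ List.range K, (lsum (List.range L) fun l => lsum S₀ fun s =>
      lsum (multiInit ini (k, l, s)).toList fun v =>
        outFrom (multiTrans S₀ K L step) (multiFinal fin) w (k, l, s) (tableVal v)) =
      lsum (ini[k]?).toList fun e => multiOut step fin w e.1 (tableVal e.2) := by
    intro k hk
    rw [List.mem_range] at hk
    cases he : ini[k]? with
    | none => simp [multiInit, he]
    | some e =>
      rw [lsum_comm, Option.toList_some, lsum_singleton]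
      have hi : ∀ l s, multiInit ini (k, l, s) = bif decide (e.1 = s) then some e.2 else none := by
        intro l s
        simp [multiInit, he]
      have hsum : ∀ s ∈ S₀, (lsum (List.range L) fun l => lsum (multiInit ini (k, l, s)).toList
          fun v => outFrom (multiTrans S₀ K L step) (multiFinal fin) w (k, l, s) (tableVal v)) =
          bif decide (e.1 = s) then multiOut step fin w s (tableVal e.2) else 0 := by
        intro s hs
        simp only [hi]
        by_cases hes : e.1 = s
        · simp only [hes, decide_true, cond_true, Option.toList_some, lsum_singleton]
          exact lsum_outFrom_multi hS hstep hfin (by omega) w hk hs _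
        · simp [hes]
      rw [lsum_congr hsum]
      exact lsum_decide_eq hS (hini e (List.mem_of_getElem? he))
        (fun s => multiOut step fin w s (tableVal e.2))
  rw [lsum_congr h]
  exact lsum_range_getElem? _ hK.le _

end Multi

instance {α β : Type*} [BEq α] [BEq β] [LawfulBEq α] [LawfulBEq β] : LawfulBEq (α ⊕ β) where
  eq_of_beq {a b} h := by
    cases a <;> cases b <;> first | exact congrArg _ (eq_of_beq h) | cases h
  rfl {a} := by
    cases a with
    | inl a => exact beq_self_eq_true a
    | inr b => exact beq_self_eq_true b

/-! ### Functionals of the blocks available for each register -/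

section Degree

variable {B M : Type*} [AddCommMonoid M]

/-- A functional is of degree `0` in `X` if it does not depend on the list of `X`, and of degree `1`
if it is additive in this list. Nothing is said about higher degrees. -/
def HasDegree (X : ℕ) : ℕ → ((ℕ → List B) → M) → Prop
  | 0, Φ => ∀ J L, Φ (Function.update J X L) = Φ J
  | 1, Φ => ∀ J, Φ J = lsum (J X) fun b => Φ (Function.update J X [b])
  | _ + 2, _ => True

theorem HasDegree.lsum {α : Type*} {X n : ℕ} {Φ : α → (ℕ → List B) → M} (l : List α)
    (h : ∀ a ∈ l, HasDegree X n (Φ a)) : HasDegree X n fun J => lsum l fun a => Φ a J := by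
  match n, h with
  | 0, h => exact fun J L => lsum_congr fun a ha => h a ha J L
  | 1, h =>
    intro J
    rw [lsum_comm]
    exact lsum_congr fun a ha => h a ha J
  | _ + 2, _ => trivial

/-- Choosing a block from the list of `Y` raises the degree in `Y` by one: a functional that ignores
a list becomes additive in it when summed over it. From degree 2 on there is nothing to show. -/
theorem HasDegree.lsum_blocks {α : Type*} {X Y n : ℕ} {Φ : α → (ℕ → List B) → M} (g : B → List α)
    (h : ∀ a, HasDegree X n (Φ a)) :
    HasDegree X (n + if Y = X then 1 else 0)
      fun J => Compose.lsum (J Y) fun b => Compose.lsum (g b) fun a => Φ a J := by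
  by_cases hY : Y = X
  · subst hY
    simp only [if_true]
    match n, h with
    | 0, h =>
      intro J
      refine lsum_congr fun b _ => ?_
      simp only [Function.update_self, lsum_singleton]
      exact lsum_congr fun a _ => (h a J [b]).symm
    | _ + 1, _ => trivial
  · simp only [hY, if_false, add_zero]
    match n, h with
    | 0, h =>
      intro J L
      simp only [Function.update_of_ne hY]
      exact lsum_congr fun b _ => lsum_congr fun a _ => h a J L
    | 1, h =>
      intro J
      simp only [Function.update_of_ne hY]
      rw [lsum_comm]
      refine lsum_congr fun b _ => ?_
      rw [lsum_comm]
      exact lsum_congr fun a _ => h a J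
    | _ + 2, _ => trivial

/-- The options for one register: one of the blocks if the register is selected. -/
def pick (b : Bool) (l : List B) : List (Option B) := bif b then l.map fun x => some x else [none]

/-- The blocks of a family, register by register. -/
def familyBlocks (fam : List (Option B)) (X : ℕ) : List B := (fam.getD X none).toList

/-- Induction on the number `k` of registers not yet expanded. The choices below `pre.length` are
fixed in `pre`; the next register is expanded by additivity if it is selected and discarded by
independence otherwise. -/
theorem eq_lsum_sections_aux {Φ : (ℕ → List B) → M} {A : ℕ → Bool} {m : ℕ} {J : ℕ → List B}
    (hJ : ∀ X, m ≤ X → J X = []) (hΦ : ∀ X < m, HasDegree X (if A X then 1 else 0) Φ) (k : ℕ)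
    (pre : List (Option B)) (hk : pre.length + k = m) :
    Φ (fun X => if X < pre.length then familyBlocks pre X else J X) =
      lsum ((List.range' pre.length k).map fun X => pick (A X) (J X)).sections fun fam =>
        Φ (familyBlocks (pre ++ fam)) := by
  induction k generalizing pre with
  | zero =>
    simp only [List.range'_zero, List.map_nil, List.sections, lsum_singleton, List.append_nil]
    congr 1
    funext X
    split
    · rfl
    -- Beyond `m` the family has no entry, which matches the empty list only because of `hJ`.
    · rw [hJ X (by omega)]
      simp [familyBlocks, List.getElem?_eq_none (by omega : pre.length ≤ X)]
  | succ k ih =>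
    rw [List.range'_succ, List.map_cons, lsum_sections_cons, lsum_comm]
    have hlen : ∀ x : Option B, (pre ++ [x]).length = pre.length + 1 := by simp
    have h : ∀ x : Option B, (lsum ((List.range' (pre.length + 1) k).map fun X =>
        pick (A X) (J X)).sections fun fam => Φ (familyBlocks (pre ++ x :: fam))) =
        Φ (Function.update (fun X => if X < pre.length then familyBlocks pre X else J X)
          pre.length x.toList) := by
      intro x
      have := ih (pre ++ [x]) (by simp; omega)
      rw [hlen] at this
      simp only [List.append_assoc, List.singleton_append] at this
      rw [← this]
      congr 1
      funext X
      rcases lt_trichotomy X pre.length with hX | hX | hX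
      · rw [Function.update_of_ne hX.ne]
        simp [hX, Nat.lt_succ_of_lt hX, familyBlocks]
      · subst hX
        simp [familyBlocks]
      · rw [Function.update_of_ne hX.ne']
        simp [hX.not_gt, (Nat.succ_le_of_lt hX).not_gt]
    simp only [h]
    have hX := hΦ pre.length (by omega)
    cases hA : A pre.length with
    | true =>
      rw [hA] at hX
      simp only [if_true] at hX
      rw [hX]
      simp [pick]
    | false =>
      rw [hA] at hX
      simp only [pick, cond_false, lsum_singleton]
      -- The functional ignores the list of an unselected register, so this list may be emptied,
      -- which is what the entry `none` does.
      exact (hX _ _).symm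

/-- A functional of degree at most `1` in every register is the sum of its values at single
blocks. -/
theorem eq_lsum_sections {Φ : (ℕ → List B) → M} {A : ℕ → Bool} {m : ℕ} {J : ℕ → List B}
    (hJ : ∀ X, m ≤ X → J X = []) (hΦ : ∀ X < m, HasDegree X (if A X then 1 else 0) Φ) :
    Φ J = lsum ((List.range m).map fun X => pick (A X) (J X)).sections fun fam =>
      Φ (familyBlocks fam) := by
  have := eq_lsum_sections_aux hJ hΦ m [] (by simp)
  simpa [List.range_eq_range'] using this

end Degree

/-! ### Runs on tokens -/

section TokenRuns

variable {Γ : Type} {tr : List (Trans Γ)} {J : ℕ → List (Block Γ)}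

theorem tokenRuns_eq_flatMap (u : List (ℕ ⊕ ℕ)) (L : List (ℕ × Asg Γ)) :
    tokenRuns tr J u L = L.flatMap fun c => tokenRuns tr J u [c] := by
  induction u generalizing L with
  | nil => simp [tokenRuns]
  | cons x u ih =>
    change tokenRuns tr J u _ = L.flatMap fun c => tokenRuns tr J u _
    rw [ih]
    simp only [List.flatMap_assoc, List.flatMap_singleton]
    exact List.flatMap_congr fun c _ => (ih _).symm

theorem tokenRuns_cons (x : ℕ ⊕ ℕ) (u : List (ℕ ⊕ ℕ)) (c : ℕ × Asg Γ) :
    tokenRuns tr J (x :: u) [c] =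
      (moves tr J x c.1).flatMap fun d => tokenRuns tr J u [(d.1, compAsg c.2 d.2)] := by
  change tokenRuns tr J u _ = _
  rw [tokenRuns_eq_flatMap]
  simp [List.flatMap_map]

theorem tokenRuns_append (u v : List (ℕ ⊕ ℕ)) (L : List (ℕ × Asg Γ)) :
    tokenRuns tr J (u ++ v) L = tokenRuns tr J v (tokenRuns tr J u L) := by
  simp [tokenRuns]

/-- An invariant of the moves holds along token runs. -/
theorem tokenRuns_induction {P : ℕ × Asg Γ → Prop} {u : List (ℕ ⊕ ℕ)}
    (h : ∀ x ∈ u, ∀ c, P c → ∀ d ∈ moves tr J x c.1, P (d.1, compAsg c.2 d.2))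
    {c : ℕ × Asg Γ} (hc : P c) : ∀ d ∈ tokenRuns tr J u [c], P d := by
  induction u generalizing c with
  | nil => simpa [tokenRuns] using hc
  | cons x u ih =>
    intro d hd
    rw [tokenRuns_cons, List.mem_flatMap] at hd
    obtain ⟨e, he, hd⟩ := hd
    exact ih (fun y hy => h y (List.mem_cons_of_mem _ hy)) (h x (List.mem_cons_self ..) c hc e he)
      d hd

/-- Each occurrence of the token `X` draws one block from `J X`, and the run consults `J X` nowhere
else. `Φ` may depend on `J` itself, which allows several strings to be treated in succession. -/
theorem hasDegree_tokenRuns {M : Type*} [AddCommMonoid M] {X n : ℕ}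
    {Φ : ℕ × Asg Γ → (ℕ → List (Block Γ)) → M}
    (h : ∀ d, HasDegree X n (Φ d)) (u : List (ℕ ⊕ ℕ)) (c : ℕ × Asg Γ) :
    HasDegree X (n + u.count (Sum.inl X)) fun J => lsum (tokenRuns tr J u [c]) fun d => Φ d J := by
  induction u generalizing c with
  | nil => simpa [tokenRuns] using h c
  | cons x u ih =>
    simp only [tokenRuns_cons, lsum_flatMap]
    cases x with
    | inr o =>
      rw [List.count_cons_of_ne (by simp)]
      exact HasDegree.lsum _ fun d _ => ih _
    | inl Y =>
      -- The test that a block starts in the current state is hidden in a list of length at most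
      -- one.
      have := HasDegree.lsum_blocks (Y := Y)
        (fun b : Block Γ => bif decide (b.1 = c.1) then [b.2] else [])
        fun d => ih (d.1, compAsg c.2 d.2)
      simp only [moves, Sum.elim_inl, lsum_map, lsum_filter]
      simp only [lsum_cond, lsum_singleton, lsum_nil] at this
      convert this using 1
      by_cases hY : Y = X <;> simp [hY, add_assoc]

theorem hasDegree_blocks {M : Type*} [AddCommMonoid M] {X n k r : ℕ}
    {Φ : Block Γ → (ℕ → List (Block Γ)) → M}
    (h : ∀ d, HasDegree X n (Φ d)) (u : List (ℕ ⊕ ℕ)) :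
    HasDegree X (n + u.count (Sum.inl X)) fun J => lsum (blocks k r tr J u) fun d => Φ d J := by
  simp only [blocks, lsum_flatMap, lsum_map]
  exact HasDegree.lsum _ fun p _ => hasDegree_tokenRuns (fun d => h (p, d.1, d.2)) u _

/-- The concatenation of the strings of the selected registers. -/
def selectedWord (m : ℕ) (A : List Bool) (σ : ℕ → Option (List (ℕ ⊕ ℕ))) : List (ℕ ⊕ ℕ) :=
  (List.range m).flatMap fun X => bif A.getD X false then (σ X).getD [] else []

/-- The components of a family are chosen one after the other, so their degrees add up to the number
of occurrences in the concatenated selected strings. -/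
theorem hasDegree_families {M : Type*} [AddCommMonoid M] {X n k r m : ℕ}
    {Φ : List (Option (Block Γ)) → (ℕ → List (Block Γ)) → M} (h : ∀ d, HasDegree X n (Φ d))
    (A : List Bool) (σ : ℕ → Option (List (ℕ ⊕ ℕ))) :
    HasDegree X (n + (selectedWord m A σ).count (Sum.inl X)) fun J =>
      lsum (families k r m tr J A σ) fun fam => Φ fam J := by
  unfold families selectedWord
  induction List.range m generalizing n Φ with
  | nil => simpa [List.sections] using h []
  | cons Y l ih =>
    simp only [List.map_cons, lsum_sections_cons, List.flatMap_cons, List.count_append]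
    rw [← add_assoc]
    refine ih fun s => ?_
    cases A.getD Y false with
    | false => simpa using h _
    | true =>
      cases σ Y with
      | none =>
        simp only [cond_true, Option.elim_none, List.map_nil, lsum_nil, Option.getD_none,
          List.count_nil, add_zero]
        -- A selected register with undefined string admits no family, and the zero functional has
        -- every degree.
        exact HasDegree.lsum (Φ := fun (a : Unit) J => (0 : M)) [] (by simp)
      | some u =>
        simp only [cond_true, Option.elim_some, lsum_map, Option.getD_some]
        exact hasDegree_blocks (fun d => h _) u

end TokenRuns

/-! ### Algebra of assignments -/

section Asg

variable {Γ : Type}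

theorem subst_nil (σ : Asg Γ) : subst σ [] = some [] := rfl

theorem subst_inl (σ : Asg Γ) (Y : ℕ) (u : List (ℕ ⊕ Γ)) :
    subst σ (Sum.inl Y :: u) =
      (subst σ u).bind fun v => (σ.getD Y none).map fun y => y ++ v := rfl

theorem subst_inr (σ : Asg Γ) (g : Γ) (u : List (ℕ ⊕ Γ)) :
    subst σ (Sum.inr g :: u) = (subst σ u).map fun v => Sum.inr g :: v := by
  change (subst σ u).bind _ = _
  cases subst σ u <;> rfl

theorem subst_append (σ : Asg Γ) (u v : List (ℕ ⊕ Γ)) :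
    subst σ (u ++ v) = (subst σ u).bind fun x => (subst σ v).map fun y => x ++ y := by
  induction u with
  | nil => cases h : subst σ v <;> simp [subst_nil, h]
  | cons x u ih =>
    cases x with
    | inl Y =>
      rw [List.cons_append, subst_inl, subst_inl, ih]
      cases subst σ u <;> cases subst σ v <;> cases σ.getD Y none <;> simp
    | inr g =>
      rw [List.cons_append, subst_inr, subst_inr, ih]
      cases subst σ u <;> cases subst σ v <;> simp

theorem getD_compAsg (σ τ : Asg Γ) (Y : ℕ) :
    (compAsg σ τ).getD Y none = (τ.getD Y none).bind (subst σ) := by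
  simp only [compAsg, List.getD_eq_getElem?_getD, List.getElem?_map]
  cases τ[Y]? <;> rfl

theorem length_compAsg (σ τ : Asg Γ) : (compAsg σ τ).length = τ.length := by simp [compAsg]

theorem length_idAsg (r : ℕ) : (idAsg r : Asg Γ).length = r := by simp [idAsg]

theorem subst_compAsg (ρ σ : Asg Γ) (u : List (ℕ ⊕ Γ)) :
    subst (compAsg ρ σ) u = (subst σ u).bind (subst ρ) := by
  induction u with
  | nil => rfl
  | cons x u ih =>
    cases x with
    | inl Y =>
      rw [subst_inl, subst_inl, ih, getD_compAsg]
      cases h : subst σ u with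
      | none => rfl
      | some v =>
        cases σ.getD Y none with
        | none => cases h' : subst ρ v <;> simp [h']
        | some y =>
          simp only [Option.bind_some, Option.map_some, subst_append]
          cases subst ρ v <;> cases subst ρ y <;> rfl
    | inr g =>
      rw [subst_inr, subst_inr, ih]
      cases h : subst σ u with
      | none => rfl
      | some v => simp [subst_inr]

theorem compAsg_assoc (ρ σ τ : Asg Γ) :
    compAsg (compAsg ρ σ) τ = compAsg ρ (compAsg σ τ) := by
  simp only [compAsg, List.map_map, Function.comp_def]
  refine List.map_congr_left fun o _ => ?_
  cases o with
  | none => rfl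
  | some u => exact subst_compAsg ρ σ u

theorem compAsg_idAsg {r : ℕ} (σ : Asg Γ) (h : σ.length = r) : compAsg σ (idAsg r) = σ := by
  subst h
  refine List.ext_getElem (by simp [compAsg, idAsg]) fun i h₁ h₂ => ?_
  simp only [compAsg, idAsg, List.map_map, List.getElem_map, List.getElem_range,
    Function.comp_apply, Option.bind_some, subst_inl, subst_nil]
  cases h : σ[i] <;> simp [h, List.getElem?_eq_getElem h₂]

variable {tr : List (Trans Γ)} {J : ℕ → List (Block Γ)}

/-- Moves act on the right of the current assignment, so by associativity an assignment on the left
can be factored out. This is why blocks computed from the identity can be inserted after any partial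
run. -/
theorem tokenRuns_compAsg (u : List (ℕ ⊕ ℕ)) (p : ℕ) (σ τ : Asg Γ) :
    tokenRuns tr J u [(p, compAsg σ τ)] =
      (tokenRuns tr J u [(p, τ)]).map fun d => (d.1, compAsg σ d.2) := by
  induction u generalizing p τ with
  | nil => simp [tokenRuns]
  | cons x u ih =>
    simp only [tokenRuns_cons, List.map_flatMap, compAsg_assoc, ih]

theorem tokenRuns_eq_map {r : ℕ} (u : List (ℕ ⊕ ℕ)) (p : ℕ) (σ : Asg Γ) (h : σ.length = r) :
    tokenRuns tr J u [(p, σ)] =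
      (tokenRuns tr J u [(p, idAsg r)]).map fun d => (d.1, compAsg σ d.2) := by
  rw [← tokenRuns_compAsg, compAsg_idAsg σ h]

theorem filter_flatMap_pair {α β : Type} [DecidableEq α] {l : List α} (hl : l.Nodup) (g : α → List β)
    {a : α} (ha : a ∈ l) :
    (((l.flatMap fun b => (g b).map fun y => (b, y)).filter fun z => decide (z.1 = a)).map
      fun z => z.2) = g a := by
  induction l with
  | nil => simp at ha
  | cons b l ih =>
    rw [List.nodup_cons] at hl
    rw [List.flatMap_cons, List.filter_append, List.map_append]
    by_cases hab : b = a
    · subst hab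
      have h : ((l.flatMap fun c => (g c).map fun y => (c, y)).filter fun z => decide (z.1 = b)) = [] := by
        rw [List.filter_eq_nil_iff]
        intro z hz
        obtain ⟨c, hc, hz⟩ := List.mem_flatMap.1 hz
        obtain ⟨y, _, rfl⟩ := List.mem_map.1 hz
        simp only [decide_eq_true_eq]
        rintro rfl
        exact hl.1 hc
      rw [h, List.filter_eq_self.2 (by simp)]
      simp
    · rw [ih hl.2 (by simpa [Ne.symm hab] using ha), List.filter_eq_nil_iff.2]
      · rfl
      · simp [hab]

/-- A block records its first state, so keeping the blocks that start in `p` recovers, with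
multiplicities, the runs from `p`. -/
theorem moves_blocks {n r X p : ℕ} (hp : p < n) {u : List (ℕ ⊕ ℕ)} {J' : ℕ → List (Block Γ)}
    (hX : J' X = blocks n r tr J u) :
    moves tr J' (Sum.inl X) p = tokenRuns tr J u [(p, idAsg r)] := by
  simp only [moves, Sum.elim_inl, hX, blocks]
  exact filter_flatMap_pair (g := fun p => tokenRuns tr J u [(p, idAsg r)]) List.nodup_range
    (List.mem_range.2 hp)

/-- The blocks on the contents of the registers under a valuation. -/
def valBlocks (n r : ℕ) (tr : List (Trans Γ)) (ν : Val) (X : ℕ) : List (Block Γ) :=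
  (ν X).elim [] fun w => blocks n r tr (fun _ => []) (w.map fun o => Sum.inr o)

/-- Skipping the content of a register by any one of all its blocks amounts to reading this content
letter by letter. An undefined register has no blocks, hence stops every run, in accordance with the
undefined value of `u`. -/
theorem tokenRuns_valBlocks {n r : ℕ} (htr : ∀ t ∈ tr, t.2.2.2 < n ∧ t.2.2.1.length = r) (ν : Val)
    (u : List (ℕ ⊕ ℕ)) (c : ℕ × Asg Γ) (hc : c.1 < n ∧ c.2.length = r) :
    tokenRuns tr (valBlocks n r tr ν) u [c] = (evalWord ν u).elim []
      fun w => tokenRuns tr (fun _ => []) (w.map fun o => Sum.inr o) [c] := by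
  induction u generalizing c with
  | nil => rfl
  | cons x u ih =>
    cases x with
    | inr o =>
      have hm : ∀ d ∈ moves tr (valBlocks n r tr ν) (Sum.inr o) c.1,
          d.1 < n ∧ (compAsg c.2 d.2).length = r := by
        intro d hd
        simp only [moves, Sum.elim_inr, List.mem_map, List.mem_filter] at hd
        obtain ⟨t, ⟨ht, _⟩, rfl⟩ := hd
        simpa [length_compAsg] using htr t ht
      rw [tokenRuns_cons, List.flatMap_congr fun d hd => ih (d.1, compAsg c.2 d.2) (hm d hd)]
      simp only [evalWord]
      cases evalWord ν u with
      | none => simp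
      | some w => simp [tokenRuns_cons, moves]
    | inl X =>
      cases hX : ν X with
      | none => simp [tokenRuns_cons, moves, valBlocks, evalWord, hX]
      | some x =>
        rw [tokenRuns_cons, moves_blocks (r := r) (u := x.map fun o => Sum.inr o) (J := fun _ => []) hc.1
          (by simp only [valBlocks, hX, Option.elim_some])]
        have hm : ∀ d ∈ tokenRuns tr (fun _ => []) (x.map fun o => Sum.inr o) [(c.1, idAsg r)],
            d.1 < n ∧ d.2.length = r := by
          refine tokenRuns_induction (P := fun d => d.1 < n ∧ d.2.length = r) ?_
            ⟨hc.1, length_idAsg r⟩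
          intro y hy e he d hd
          obtain ⟨o, _, rfl⟩ := List.mem_map.1 hy
          simp only [moves, Sum.elim_inr, List.mem_map, List.mem_filter] at hd
          obtain ⟨t, ⟨ht, _⟩, rfl⟩ := hd
          simpa [length_compAsg] using htr t ht
        rw [List.flatMap_congr fun d hd => ih (d.1, compAsg c.2 d.2)
          (by simpa [length_compAsg] using hm d hd)]
        simp only [evalWord, hX, Option.bind_some]
        cases evalWord ν u with
        | none => simp
        | some w =>
          simp only [Option.elim_some, Option.map_some, List.map_append, tokenRuns_append]
          -- Reading `x` from `c.2` is composing `c.2` with the blocks on `x`; the length of `c.2`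
          -- matters, as `idAsg r` is neutral only for assignments of length `r`.
          rw [show c = (c.1, c.2) from rfl, tokenRuns_eq_map (x.map fun o => Sum.inr o) c.1 c.2 hc.2,
            tokenRuns_eq_flatMap (w.map fun o => Sum.inr o) (List.map _ _), List.flatMap_map]

theorem blocks_valBlocks {n r : ℕ} (htr : ∀ t ∈ tr, t.2.2.2 < n ∧ t.2.2.1.length = r) (ν : Val)
    (o : Option (List (ℕ ⊕ ℕ))) :
    (o.elim [] fun u => blocks n r tr (valBlocks n r tr ν) u) = (o.bind (evalWord ν)).elim []
      fun w => blocks n r tr (fun _ => []) (w.map fun o => Sum.inr o) := by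
  cases o with
  | none => rfl
  | some u =>
    simp only [Option.elim_some, Option.bind_some, blocks]
    have h : ∀ p ∈ List.range n, (tokenRuns tr (valBlocks n r tr ν) u [(p, idAsg r)]).map
        (fun d => (p, d.1, d.2)) = (evalWord ν u).elim [] fun w =>
          (tokenRuns tr (fun _ => []) (w.map fun o => Sum.inr o) [(p, idAsg r)]).map
            fun d => (p, d.1, d.2) := by
      intro p hp
      rw [tokenRuns_valBlocks htr ν u _ ⟨List.mem_range.1 hp, length_idAsg r⟩]
      cases evalWord ν u <;> rfl
    rw [List.flatMap_congr h]
    cases evalWord ν u <;> simp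

end Asg

set_option linter.unusedSectionVars false

/-! ### Copyless assignments -/

section Good

variable {Γ : Type}

/-- All symbols of the strings of an assignment. -/
def flat (σ : Asg Γ) : List (ℕ ⊕ Γ) := σ.flatMap fun o => o.getD []

theorem mem_flat {σ : Asg Γ} {x : ℕ ⊕ Γ} : x ∈ flat σ ↔ ∃ u, some u ∈ σ ∧ x ∈ u := by
  simp only [flat, List.mem_flatMap]
  constructor
  · rintro ⟨_ | u, ho, hx⟩
    · simp at hx
    · exact ⟨u, ho, hx⟩
  · rintro ⟨u, hu, hx⟩
    exact ⟨some u, hu, hx⟩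

/-- The string that replaces a symbol under an assignment. -/
def image (σ : Asg Γ) (x : ℕ ⊕ Γ) : List (ℕ ⊕ Γ) :=
  Sum.elim (fun Y => (σ.getD Y none).getD []) (fun g => [Sum.inr g]) x

theorem subst_eq_some {σ : Asg Γ} {u v : List (ℕ ⊕ Γ)} (h : subst σ u = some v) :
    v = u.flatMap (image σ) := by
  induction u generalizing v with
  | nil => simpa [subst_nil] using h.symm
  | cons x u ih =>
    cases x with
    | inl Y =>
      rw [subst_inl] at h
      cases hu : subst σ u with
      | none => simp [hu] at h
      | some w =>
        rw [hu] at h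
        simp only [Option.bind_some, Option.map_eq_some_iff] at h
        obtain ⟨y, hy, rfl⟩ := h
        rw [List.flatMap_cons, ← ih hu, image, Sum.elim_inl, hy, Option.getD_some]
    | inr g =>
      rw [subst_inr, Option.map_eq_some_iff] at h
      obtain ⟨w, hw, rfl⟩ := h
      rw [List.flatMap_cons, ← ih hw, image, Sum.elim_inr, List.singleton_append]

/-- Equality fails in general, because a string with an undefined register disappears as a whole. -/
theorem flat_compAsg_sublist (σ τ : Asg Γ) :
    (flat (compAsg σ τ)).Sublist ((flat τ).flatMap (image σ)) := by
  induction τ with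
  | nil => simp [flat, compAsg]
  | cons o τ ih =>
    have e₁ : flat (compAsg σ (o :: τ)) = (o.bind (subst σ)).getD [] ++ flat (compAsg σ τ) := rfl
    have e₂ : flat (o :: τ) = o.getD [] ++ flat τ := rfl
    rw [e₁, e₂, List.flatMap_append]
    refine List.Sublist.append ?_ ih
    cases o with
    | none => simp
    | some u =>
      cases h : subst σ u with
      | none => simp [h]
      | some v => simp [h, subst_eq_some h]

theorem mem_image {σ : Asg Γ} {x y : ℕ ⊕ Γ} (h : x ∈ image σ y) :
    x ∈ flat σ ∨ ∃ g, x = Sum.inr g ∧ y = Sum.inr g := by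
  cases y with
  | inl Y =>
    left
    rw [mem_flat]
    simp only [image, Sum.elim_inl, List.getD_eq_getElem?_getD] at h
    cases ho : σ[Y]? with
    | none => simp [ho] at h
    | some o =>
      cases o with
      | none => simp [ho] at h
      | some u =>
        rw [ho] at h
        exact ⟨u, List.mem_of_getElem? ho, h⟩
  | inr g =>
    right
    simp only [image, Sum.elim_inr, List.mem_singleton] at h
    exact ⟨g, h, rfl⟩

theorem mem_flat_compAsg {σ τ : Asg Γ} {x : ℕ ⊕ Γ} (h : x ∈ flat (compAsg σ τ)) :
    x ∈ flat σ ∨ ∃ g, x = Sum.inr g ∧ x ∈ flat τ := by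
  obtain ⟨y, hy, hx⟩ := List.mem_flatMap.1 ((flat_compAsg_sublist σ τ).subset h)
  rcases mem_image hx with h | ⟨g, rfl, rfl⟩
  · exact Or.inl h
  · exact Or.inr ⟨g, rfl, hy⟩

theorem mem_regsOf {u : List (ℕ ⊕ Γ)} {Y : ℕ} : Y ∈ regsOf u ↔ Sum.inl Y ∈ u := by
  simp only [regsOf, List.mem_flatMap]
  constructor
  · rintro ⟨_ | g, hx, hY⟩
    · simp only [Sum.elim_inl, List.mem_singleton] at hY
      exact hY ▸ hx
    · simp at hY
  · exact fun h => ⟨_, h, by simp⟩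

theorem regsOf_flat (σ : Asg Γ) :
    regsOf (flat σ) = (σ.map fun a => a.map fun u => regsOf u).flatMap fun o => o.getD [] := by
  induction σ with
  | nil => rfl
  | cons o σ ih =>
    have e : flat (o :: σ) = o.getD [] ++ flat σ := rfl
    rw [List.map_cons, List.flatMap_cons, ← ih, e]
    cases o <;> simp [regsOf]

variable {n r : ℕ} {tr : List (Trans Γ)} {J : ℕ → List (Block Γ)}

theorem flat_idAsg (r : ℕ) : flat (idAsg r : Asg Γ) = (List.range r).map Sum.inl := by
  rw [flat, idAsg, List.flatMap_map, List.map_eq_flatMap]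
  rfl

theorem mem_blocks {u : List (ℕ ⊕ ℕ)} {b : Block Γ} :
    b ∈ blocks n r tr J u ↔ b.1 < n ∧ b.2 ∈ tokenRuns tr J u [(b.1, idAsg r)] := by
  simp only [blocks, List.mem_flatMap, List.mem_map, List.mem_range]
  constructor
  · rintro ⟨p, hp, d, hd, rfl⟩
    exact ⟨hp, hd⟩
  · exact fun h => ⟨b.1, h.1, b.2, h.2, rfl⟩

theorem mem_families {m : ℕ} {A : List Bool} {σ : ℕ → Option (List (ℕ ⊕ ℕ))}
    {fam : List (Option (Block Γ))} (h : fam ∈ families n r m tr J A σ) :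
    fam.length = m ∧ ∀ X b, fam.getD X none = some b → A.getD X false = true ∧
      ∃ u, σ X = some u ∧ b ∈ blocks n r tr J u := by
  rw [families, List.mem_sections] at h
  have hlen : fam.length = m := by simpa using h.length_eq
  refine ⟨hlen, fun X b hb => ?_⟩
  have hX : X < fam.length := by
    by_contra hX
    simp [List.getElem?_eq_none (not_lt.1 hX)] at hb
  have := h.get hX (by simpa [hlen] using hX)
  simp only [List.get_eq_getElem, List.getElem_map, List.getElem_range] at this
  rw [List.getD_eq_getElem _ _ hX] at hb
  rw [hb] at this
  cases hA : A.getD X false with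
  | false =>
    rw [hA] at this
    simp at this
  | true =>
    rw [hA] at this
    cases hσ : σ X with
    | none => simp [hσ] at this
    | some u => exact ⟨rfl, u, rfl, by simpa [hσ] using this⟩

variable [BEq Γ] [LawfulBEq Γ]

theorem count_regsOf (u : List (ℕ ⊕ Γ)) (Y : ℕ) : (regsOf u).count Y = u.count (Sum.inl Y) := by
  induction u with
  | nil => rfl
  | cons x u ih =>
    have e : regsOf (x :: u) = Sum.elim (fun Y => [Y]) (fun _ => []) x ++ regsOf u := rfl
    rw [e, List.count_append, ih]
    cases x with
    | inl Z => by_cases h : Z = Y <;> simp [h, add_comm]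
    | inr g => simp

theorem count_lettersOf (u : List (ℕ ⊕ Γ)) (g : Γ) :
    (lettersOf u).count g = u.count (Sum.inr g) := by
  induction u with
  | nil => rfl
  | cons x u ih =>
    have e : lettersOf (x :: u) = Sum.elim (fun _ => []) (fun g => [g]) x ++ lettersOf u := rfl
    rw [e, List.count_append, ih]
    cases x with
    | inl Z => simp
    | inr g' => by_cases h : g' = g <;> simp [h, add_comm]

theorem sum_count_getD (σ : Asg Γ) (x : ℕ ⊕ Γ) :
    ∑ Y ∈ Finset.range σ.length, ((σ.getD Y none).getD []).count x = (flat σ).count x := by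
  induction σ with
  | nil => rfl
  | cons o σ ih =>
    have e : flat (o :: σ) = o.getD [] ++ flat σ := rfl
    rw [List.length_cons, Finset.sum_range_succ', e, List.count_append, ← ih, add_comm]
    simp

theorem sum_count_nodup_le (σ : Asg Γ) (x : ℕ ⊕ Γ) {l : List ℕ} (hl : l.Nodup) :
    (l.map fun Y => ((σ.getD Y none).getD []).count x).sum ≤ (flat σ).count x := by
  rw [← sum_count_getD, ← List.sum_toFinset _ hl]
  refine Finset.sum_le_sum_of_ne_zero fun Y _ hY => ?_
  rw [Finset.mem_range]
  by_contra h
  apply hY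
  simp [List.getElem?_eq_none (not_lt.1 h)]

theorem count_flatMap_image (σ : Asg Γ) (u : List (ℕ ⊕ Γ)) (x : ℕ ⊕ Γ) :
    (u.flatMap (image σ)).count x = ((regsOf u).map fun Y => ((σ.getD Y none).getD []).count x).sum
      + if x.isRight then u.count x else 0 := by
  induction u with
  | nil => simp [regsOf]
  | cons y u ih =>
    rw [List.flatMap_cons, List.count_append, ih]
    cases y with
    | inl Y =>
      have e : regsOf (Sum.inl Y :: u) = Y :: regsOf u := rfl
      rw [e]
      cases x <;> simp [image, add_assoc]
    | inr g =>
      have e : regsOf (Sum.inr g :: u) = regsOf u := rfl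
      rw [e]
      cases x with
      | inl X => simp [image]
      | inr g' => by_cases h : g = g' <;> simp [image, h]; omega

/-- Since `τ` is copyless, each string of `σ` is inserted at most once. For a register `x` this
makes composition preserve copylessness; for a letter it bounds the occurrences of the registers of
the composition, which are letters of the symbolic strings. -/
theorem count_flat_compAsg_le (σ τ : Asg Γ) (hτ : ∀ Y, (flat τ).count (Sum.inl Y) ≤ 1)
    (x : ℕ ⊕ Γ) : (flat (compAsg σ τ)).count x ≤
      (flat σ).count x + if x.isRight then (flat τ).count x else 0 := by
  refine ((flat_compAsg_sublist σ τ).count_le x).trans ?_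
  rw [count_flatMap_image]
  refine Nat.add_le_add_right (sum_count_nodup_le σ x ?_) _
  rw [List.nodup_iff_count_le_one]
  intro Y
  rw [count_regsOf]
  exact hτ Y

/-- Copyless assignments on `r` registers. -/
structure GoodAsg (r : ℕ) (σ : Asg Γ) : Prop where
  length_eq : σ.length = r
  lt_of_mem : ∀ Y, Sum.inl Y ∈ flat σ → Y < r
  count_le : ∀ Y, (flat σ).count (Sum.inl Y) ≤ 1

theorem GoodAsg.comp {r : ℕ} {σ τ : Asg Γ} (hσ : GoodAsg r σ) (hτ : GoodAsg r τ) :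
    GoodAsg r (compAsg σ τ) where
  length_eq := by rw [length_compAsg, hτ.length_eq]
  lt_of_mem Y h := by
    rcases mem_flat_compAsg h with h | ⟨g, h, _⟩
    · exact hσ.lt_of_mem Y h
    · simp at h
  count_le Y := by
    have := count_flat_compAsg_le σ τ hτ.count_le (Sum.inl Y)
    simpa using this.trans (by simpa using hσ.count_le Y)

theorem goodAsg_idAsg (r : ℕ) : GoodAsg r (idAsg r : Asg Γ) where
  length_eq := length_idAsg r
  lt_of_mem Y h := by simpa [flat_idAsg] using h
  count_le Y := by
    rw [flat_idAsg]
    exact List.nodup_iff_count_le_one.1 (List.nodup_range.map Sum.inl_injective) _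

/-- Transitions between states below `n` with copyless assignments. -/
def GoodTrans (n r : ℕ) (tr : List (Trans Γ)) : Prop :=
  ∀ t ∈ tr, t.2.2.2 < n ∧ GoodAsg r t.2.2.1

/-- Blocks between states below `n` with copyless assignments. -/
structure GoodBlock (n r : ℕ) (b : Block Γ) : Prop where
  fst_lt : b.1 < n
  snd_lt : b.2.1 < n
  good : GoodAsg r b.2.2

theorem good_of_mem_moves (htr : GoodTrans n r tr) (hJ : ∀ X, ∀ b ∈ J X, GoodBlock n r b)
    {x : ℕ ⊕ ℕ} {p : ℕ} {d : ℕ × Asg Γ} (hd : d ∈ moves tr J x p) : d.1 < n ∧ GoodAsg r d.2 := by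
  cases x with
  | inl X =>
    simp only [moves, Sum.elim_inl, List.mem_map, List.mem_filter] at hd
    obtain ⟨b, ⟨hb, _⟩, rfl⟩ := hd
    exact ⟨(hJ X b hb).snd_lt, (hJ X b hb).good⟩
  | inr o =>
    simp only [moves, Sum.elim_inr, List.mem_map, List.mem_filter] at hd
    obtain ⟨t, ⟨ht, _⟩, rfl⟩ := hd
    exact htr t ht

theorem good_of_mem_tokenRuns (htr : GoodTrans n r tr) (hJ : ∀ X, ∀ b ∈ J X, GoodBlock n r b)
    {u : List (ℕ ⊕ ℕ)} {c : ℕ × Asg Γ} (hc : c.1 < n ∧ GoodAsg r c.2) {d : ℕ × Asg Γ}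
    (hd : d ∈ tokenRuns tr J u [c]) : d.1 < n ∧ GoodAsg r d.2 :=
  tokenRuns_induction (P := fun d => d.1 < n ∧ GoodAsg r d.2) (fun _ _ _ hc _ hd =>
    ⟨(good_of_mem_moves htr hJ hd).1, hc.2.comp (good_of_mem_moves htr hJ hd).2⟩) hc d hd

theorem good_of_mem_blocks (htr : GoodTrans n r tr) (hJ : ∀ X, ∀ b ∈ J X, GoodBlock n r b)
    {u : List (ℕ ⊕ ℕ)} {b : Block Γ} (hb : b ∈ blocks n r tr J u) : GoodBlock n r b := by
  rw [mem_blocks] at hb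
  have := good_of_mem_tokenRuns htr hJ ⟨hb.1, goodAsg_idAsg r⟩ hb.2
  exact ⟨hb.1, this.1, this.2⟩

theorem good_of_mem_families (htr : GoodTrans n r tr) (hJ : ∀ X, ∀ b ∈ J X, GoodBlock n r b)
    {m : ℕ} {A : List Bool} {σ : ℕ → Option (List (ℕ ⊕ ℕ))} {fam : List (Option (Block Γ))}
    (h : fam ∈ families n r m tr J A σ) {X : ℕ} {b : Block Γ} (hb : fam.getD X none = some b) :
    GoodBlock n r b := by
  obtain ⟨_, u, _, hb⟩ := (mem_families h).2 X b hb
  exact good_of_mem_blocks htr hJ hb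

end Good

/-! ### Substitution of words for letters -/

section Hom

variable {Γ Δ : Type} (g : Γ → List Δ)

/-- Replacement of letters by words in a string. -/
def homWord (u : List (ℕ ⊕ Γ)) : List (ℕ ⊕ Δ) :=
  u.flatMap fun x => Sum.elim (fun Y => [Sum.inl Y]) (fun a => (g a).map Sum.inr) x

/-- Replacement of letters by words in an assignment. -/
def homAsg (σ : Asg Γ) : Asg Δ := σ.map fun o => o.map (homWord g)

/-- Replacement of letters by words in a block. -/
def homBlock (b : Block Γ) : Block Δ := (b.1, b.2.1, homAsg g b.2.2)

theorem homWord_cons (x : ℕ ⊕ Γ) (u : List (ℕ ⊕ Γ)) : homWord g (x :: u) =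
    Sum.elim (fun Y => [Sum.inl Y]) (fun a => (g a).map Sum.inr) x ++ homWord g u := rfl

theorem homWord_append (u v : List (ℕ ⊕ Γ)) :
    homWord g (u ++ v) = homWord g u ++ homWord g v := by simp [homWord]

theorem subst_map_inr (σ : Asg Δ) (l : List Δ) (v : List (ℕ ⊕ Δ)) :
    subst σ (l.map Sum.inr ++ v) = (subst σ v).map fun y => l.map Sum.inr ++ y := by
  induction l with
  | nil => simp
  | cons a l ih => simp [subst_inr, ih, Function.comp_def]

/-- Substitution never inspects letters, and words of letters contain no registers. All the
commutation results on runs, blocks and families rest on this. -/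
theorem subst_hom (σ : Asg Γ) (u : List (ℕ ⊕ Γ)) :
    subst (homAsg g σ) (homWord g u) = (subst σ u).map (homWord g) := by
  induction u with
  | nil => rfl
  | cons x u ih =>
    rw [homWord_cons]
    cases x with
    | inl Y =>
      have h : (homAsg g σ).getD Y none = (σ.getD Y none).map (homWord g) := by
        simp only [homAsg, List.getD_eq_getElem?_getD, List.getElem?_map]
        cases σ[Y]? <;> rfl
      rw [Sum.elim_inl, List.singleton_append, subst_inl, subst_inl, ih, h]
      cases subst σ u <;> cases σ.getD Y none <;> simp [homWord_append]
    | inr a =>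
      rw [Sum.elim_inr, subst_map_inr, subst_inr, ih]
      cases subst σ u <;> simp [homWord_cons]

theorem homAsg_compAsg (σ τ : Asg Γ) :
    homAsg g (compAsg σ τ) = compAsg (homAsg g σ) (homAsg g τ) := by
  simp only [homAsg, compAsg, List.map_map, Function.comp_def]
  refine List.map_congr_left fun o _ => ?_
  cases o with
  | none => rfl
  | some u => exact (subst_hom g σ u).symm

theorem homAsg_idAsg (r : ℕ) : homAsg g (idAsg r) = idAsg r := by
  simp [homAsg, idAsg, homWord]

theorem regsOf_homWord (u : List (ℕ ⊕ Γ)) : regsOf (homWord g u) = regsOf u := by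
  induction u with
  | nil => rfl
  | cons x u ih =>
    have e : ∀ v w : List (ℕ ⊕ Δ), regsOf (v ++ w) = regsOf v ++ regsOf w := by simp [regsOf]
    rw [homWord_cons, e, ih]
    cases x with
    | inl Y => rfl
    | inr a =>
      have : regsOf ((g a).map (Sum.inr : Δ → ℕ ⊕ Δ)) = [] := by simp [regsOf]
      rw [Sum.elim_inr, this]
      rfl

theorem segs_inl (Y : ℕ) (u : List (ℕ ⊕ Γ)) : segs (Sum.inl Y :: u) = [] :: segs u := rfl

theorem segs_inr (a : Γ) (u : List (ℕ ⊕ Γ)) :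
    segs (Sum.inr a :: u) = (a :: (segs u).headI) :: (segs u).tail := rfl

theorem segs_ne_nil (u : List (ℕ ⊕ Γ)) : segs u ≠ [] := by
  cases u with
  | nil => simp [segs]
  | cons x u => cases x <;> simp [segs_inl, segs_inr]

theorem segs_map_inr_append (l : List Δ) (u : List (ℕ ⊕ Δ)) :
    segs (l.map Sum.inr ++ u) = (l ++ (segs u).headI) :: (segs u).tail := by
  induction l with
  | nil =>
    obtain ⟨a, t, h⟩ := List.exists_cons_of_ne_nil (segs_ne_nil u)
    simp [h]
  | cons a l ih => simp [segs_inr, ih]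

/-- The inserted words contain no registers, so no factor is split. -/
theorem segs_homWord (u : List (ℕ ⊕ Γ)) :
    segs (homWord g u) = (segs u).map fun l => l.flatMap g := by
  induction u with
  | nil => simp [homWord, segs]
  | cons x u ih =>
    rw [homWord_cons]
    cases x with
    | inl Y => simp [segs_inl, ih]
    | inr a =>
      rw [Sum.elim_inr, segs_map_inr_append, segs_inr, ih]
      obtain ⟨b, t, h⟩ := List.exists_cons_of_ne_nil (segs_ne_nil u)
      simp [h]

variable {g} {tr : List (Trans Γ)} {tr' : List (Trans Δ)} {J : ℕ → List (Block Γ)}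
  {J' : ℕ → List (Block Δ)}

/-- States and input letters are untouched by the replacement, so the same moves are available in
the same order. Equality of lists preserves multiplicities. -/
theorem moves_hom (htr : tr' = tr.map fun t => (t.1, t.2.1, homAsg g t.2.2.1, t.2.2.2))
    (hJ : ∀ X, J' X = (J X).map (homBlock g)) (x : ℕ ⊕ ℕ) (p : ℕ) :
    moves tr' J' x p = (moves tr J x p).map fun d => (d.1, homAsg g d.2) := by
  cases x with
  | inl X =>
    simp only [moves, Sum.elim_inl, hJ, List.filter_map, List.map_map]
    rfl
  | inr o =>
    subst htr
    simp only [moves, Sum.elim_inr, List.filter_map, List.map_map]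
    rfl

theorem tokenRuns_hom (htr : tr' = tr.map fun t => (t.1, t.2.1, homAsg g t.2.2.1, t.2.2.2))
    (hJ : ∀ X, J' X = (J X).map (homBlock g)) (u : List (ℕ ⊕ ℕ)) (c : ℕ × Asg Γ) :
    tokenRuns tr' J' u [(c.1, homAsg g c.2)] =
      (tokenRuns tr J u [c]).map fun d => (d.1, homAsg g d.2) := by
  induction u generalizing c with
  | nil => rfl
  | cons x u ih =>
    simp only [tokenRuns_cons, moves_hom htr hJ, List.flatMap_map, List.map_flatMap,
      ← homAsg_compAsg]
    exact List.flatMap_congr fun d _ => ih (d.1, compAsg c.2 d.2)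

theorem blocks_hom (htr : tr' = tr.map fun t => (t.1, t.2.1, homAsg g t.2.2.1, t.2.2.2))
    (hJ : ∀ X, J' X = (J X).map (homBlock g)) (n r : ℕ) (u : List (ℕ ⊕ ℕ)) :
    blocks n r tr' J' u = (blocks n r tr J u).map (homBlock g) := by
  simp only [blocks, List.map_flatMap, List.map_map]
  refine List.flatMap_congr fun p _ => ?_
  have := tokenRuns_hom htr hJ u (p, idAsg r)
  rw [homAsg_idAsg] at this
  rw [this, List.map_map]
  rfl

theorem sections_map {α β : Type*} (f : α → β) (L : List (List α)) :
    (L.map (List.map f)).sections = L.sections.map (List.map f) := by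
  induction L with
  | nil => rfl
  | cons l L ih =>
    simp [List.sections, ih, List.flatMap_map, List.map_flatMap, Function.comp_def]

theorem families_hom (htr : tr' = tr.map fun t => (t.1, t.2.1, homAsg g t.2.2.1, t.2.2.2))
    (hJ : ∀ X, J' X = (J X).map (homBlock g)) (n r m : ℕ) (A : List Bool)
    (σ : ℕ → Option (List (ℕ ⊕ ℕ))) :
    families n r m tr' J' A σ =
      (families n r m tr J A σ).map (List.map (Option.map (homBlock g))) := by
  unfold families
  rw [← sections_map, List.map_map]
  congr 1
  refine List.map_congr_left fun X _ => ?_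
  simp only [Function.comp_apply]
  cases A.getD X false with
  | false => rfl
  | true =>
    cases σ X with
    | none => rfl
    | some u => simp [blocks_hom htr hJ]

theorem summaries_hom (fam : List (Option (Block Γ))) :
    summaries (fam.map (Option.map (homBlock g))) = summaries fam := by
  simp only [summaries, List.map_map]
  refine List.map_congr_left fun o _ => ?_
  cases o with
  | none => rfl
  | some b =>
    simp only [Function.comp_apply, Option.map_some, homBlock, homAsg, List.map_map]
    congr 3
    refine List.map_congr_left fun o _ => ?_
    cases o <;> simp [regsOf_homWord]

theorem content_hom (r : ℕ) (fam : List (Option (Block Γ))) (z : ℕ) :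
    content r (fam.map (Option.map (homBlock g))) z = (content r fam z).flatMap g := by
  simp only [content]
  rw [show (fam.map (Option.map (homBlock g))).getD (z / (r + 1) / r) none =
    (fam.getD (z / (r + 1) / r) none).map (homBlock g) by
      simp only [List.getD_eq_getElem?_getD, List.getElem?_map]
      cases fam[z / (r + 1) / r]? <;> rfl]
  cases fam.getD (z / (r + 1) / r) none with
  | none => rfl
  | some b =>
    simp only [Option.map_some, Option.bind_some, homBlock]
    rw [show (homAsg g b.2.2).getD (z / (r + 1) % r) none =
      (b.2.2.getD (z / (r + 1) % r) none).map (homWord g) by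
        simp only [homAsg, List.getD_eq_getElem?_getD, List.getElem?_map]
        cases b.2.2[z / (r + 1) % r]? <;> rfl]
    cases b.2.2.getD (z / (r + 1) % r) none with
    | none => rfl
    | some u =>
      simp only [Option.map_some, Option.getD_some, segs_homWord, List.getD_eq_getElem?_getD,
        List.getElem?_map]
      cases (segs u)[z % (r + 1)]? <;> rfl

end Hom

/-! ### Reading summaries in the contents of the registers -/

section Symbolic

/-- A register opens a new empty factor and a letter extends the first factor. The alternation
obtained is the pattern of `unfoldShape`. -/
theorem eq_segs_regsOf {Γ : Type} (u : List (ℕ ⊕ Γ)) :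
    ((segs u).getD 0 []).map Sum.inr ++ ((List.range (regsOf u).length).flatMap fun i =>
      Sum.inl ((regsOf u).getD i 0) :: ((segs u).getD (i + 1) []).map Sum.inr) = u := by
  induction u with
  | nil => simp [segs, regsOf]
  | cons x u ih =>
    cases x with
    | inl Y =>
      have e : regsOf (Sum.inl Y :: u) = Y :: regsOf u := rfl
      rw [e, segs_inl, List.length_cons, List.range_succ_eq_map, List.flatMap_cons,
        List.flatMap_map]
      simp only [List.getD_cons_zero, List.map_nil, List.nil_append, List.getD_cons_succ,
        List.cons_append, Nat.succ_eq_add_one, Nat.zero_add]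
      rw [ih]
    | inr a =>
      have e : regsOf (Sum.inr a :: u) = regsOf u := rfl
      obtain ⟨b, t, h⟩ := List.exists_cons_of_ne_nil (segs_ne_nil u)
      rw [h] at ih
      rw [e, segs_inr, h]
      simpa using ih

/-- `X`, `Y` and `i` are the digits of the index in a mixed radix system with bases `r` and `r + 1`.
-/
theorem regIndex_div {r X Y i : ℕ} (hY : Y < r) (hi : i ≤ r) :
    regIndex r X Y i / (r + 1) / r = X ∧ regIndex r X Y i / (r + 1) % r = Y ∧
      regIndex r X Y i % (r + 1) = i := by
  have h₁ : regIndex r X Y i / (r + 1) = X * r + Y := by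
    rw [regIndex, mul_comm, Nat.mul_add_div (by omega), Nat.div_eq_of_lt (by omega), add_zero]
  have h₂ : regIndex r X Y i % (r + 1) = i := by
    rw [regIndex, mul_comm, Nat.mul_add_mod, Nat.mod_eq_of_lt (by omega)]
  rw [h₁, h₂, mul_comm X r]
  refine ⟨?_, ?_, rfl⟩
  · rw [Nat.mul_add_div (by omega), Nat.div_eq_of_lt hY, add_zero]
  · rw [Nat.mul_add_mod, Nat.mod_eq_of_lt hY]

theorem regIndex_lt {m r X Y i : ℕ} (hX : X < m) (hY : Y < r) (hi : i ≤ r) :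
    regIndex r X Y i < m * r * (r + 1) := by
  have h₁ : X * r + Y + 1 ≤ m * r := by
    calc X * r + Y + 1 ≤ X * r + r := by omega
      _ = (X + 1) * r := by ring
      _ ≤ m * r := Nat.mul_le_mul_right r hX
  calc regIndex r X Y i < (X * r + Y) * (r + 1) + (r + 1) := by unfold regIndex; omega
    _ = (X * r + Y + 1) * (r + 1) := by ring
    _ ≤ m * r * (r + 1) := Nat.mul_le_mul_right _ h₁

/-- The words denoted by registers of the composition and letters. -/
def wordOf (r : ℕ) (fam : List (Option (Block ℕ))) (x : ℕ ⊕ ℕ) : List ℕ :=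
  Sum.elim (fun z => content r fam z) (fun o => [o]) x

/-- Lifted transitions mention no register of the composition, and `wordOf` maps each letter to
itself. -/
theorem liftTrans_hom (r : ℕ) (fam : List (Option (Block ℕ))) (tr : List (Trans ℕ)) :
    tr = (liftTrans tr).map fun t =>
      (t.1, t.2.1, homAsg (wordOf r fam) t.2.2.1, t.2.2.2) := by
  have hw : ∀ u : List (ℕ ⊕ ℕ), homWord (wordOf r fam) (u.map fun x =>
      Sum.elim (fun Y => Sum.inl Y) (fun g => Sum.inr (Sum.inr g)) x) = u := by
    intro u
    induction u with
    | nil => rfl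
    | cons x u ih =>
      rw [List.map_cons, homWord_cons, ih]
      cases x <;> rfl
  rw [liftTrans, List.map_map]
  conv_lhs => rw [← List.map_id tr]
  refine List.map_congr_left fun t _ => ?_
  simp only [id, Function.comp_apply, homAsg, List.map_map, Function.comp_def, Option.map_map, hw]
  simp

/-- The registers of the string are distinct and below `r`. Hence the string has at most r + 1
factors, the number for which `regIndex` provides room. -/
theorem length_regsOf_le {Γ : Type} [BEq Γ] [LawfulBEq Γ] {r : ℕ} {σ : Asg Γ} (hσ : GoodAsg r σ)
    {u : List (ℕ ⊕ Γ)} (hu : some u ∈ σ) : (regsOf u).length ≤ r := by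
  have hsub : u.Sublist (flat σ) :=
    List.sublist_flatten_of_mem (List.mem_map.2 ⟨_, hu, rfl⟩)
  have hnd : (regsOf u).Nodup := by
    rw [List.nodup_iff_count_le_one]
    intro Y
    rw [count_regsOf]
    exact (hsub.count_le _).trans (hσ.count_le Y)
  have : (regsOf u).toFinset ⊆ Finset.range r := by
    intro Y hY
    rw [List.mem_toFinset, mem_regsOf] at hY
    exact Finset.mem_range.2 (hσ.lt_of_mem Y (hsub.subset hY))
  have h := Finset.card_le_card this
  rwa [List.toFinset_card_of_nodup hnd, Finset.card_range] at h

/-- The symbol for factor `i` decodes to exactly this factor of the block in `fam`, so substitution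
restores the original strings. -/
theorem homAsg_unfoldShape {n r X : ℕ} {fam : List (Option (Block ℕ))} {b : Block ℕ}
    (hX : fam.getD X none = some b) (hb : GoodBlock n r b) :
    homAsg (wordOf r fam) (unfoldShape r X (b.2.2.map fun a => a.map fun u => regsOf u)) =
      b.2.2 := by
  refine List.ext_getElem (by simp [homAsg, unfoldShape]) fun Y h₁ h₂ => ?_
  have hY : Y < r := hb.good.length_eq ▸ h₂
  simp only [homAsg, unfoldShape, List.getElem_map, List.getElem_range]
  rw [List.getD_eq_getElem _ _ (by simpa using h₂), List.getElem_map]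
  cases hu : b.2.2[Y] with
  | none => rfl
  | some u =>
    have hlen := length_regsOf_le hb.good (hu ▸ List.getElem_mem h₂)
    have hc : ∀ i ≤ r, wordOf r fam (Sum.inl (regIndex r X Y i)) = (segs u).getD i [] := by
      intro i hi
      obtain ⟨e₁, e₂, e₃⟩ := regIndex_div (X := X) hY hi
      simp only [wordOf, Sum.elim_inl, content, e₁, e₂, e₃, hX, Option.bind_some]
      rw [List.getD_eq_getElem _ _ h₂, hu]
      rfl
    simp only [Option.map_some, Option.some.injEq]
    conv_rhs => rw [← eq_segs_regsOf u]
    rw [homWord_cons, Sum.elim_inr, hc 0 (Nat.zero_le r)]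
    congr 1
    rw [homWord, List.flatMap_assoc]
    refine List.flatMap_congr fun i hi => ?_
    have hi' : i + 1 ≤ r := (List.mem_range.1 hi).trans_le hlen
    simp [hc (i + 1) hi']

/-- The blocks described by the summaries of a family are those of the family. -/
theorem symbolicBlocks_hom {n r : ℕ} {fam : List (Option (Block ℕ))}
    (hfam : ∀ X b, fam.getD X none = some b → GoodBlock n r b) (X : ℕ) :
    familyBlocks fam X =
      (symbolicBlocks r (summaries fam) X).map (homBlock (wordOf r fam)) := by
  have h : (summaries fam).getD X none = (fam.getD X none).map fun b =>
      (b.1, b.2.1, b.2.2.map fun a => a.map fun u => regsOf u) := by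
    simp only [summaries, List.getD_eq_getElem?_getD, List.getElem?_map]
    cases fam[X]? <;> rfl
  rw [familyBlocks, symbolicBlocks, h]
  cases hX : fam.getD X none with
  | none => rfl
  | some b => simp [homBlock, homAsg_unfoldShape hX (hfam X b hX)]

theorem tableVal_contents (m r : ℕ) (fam : List (Option (Block ℕ))) (z : ℕ) :
    tableVal (contents m r fam) z = if z < m * r * (r + 1) then some (content r fam z) else none := by
  simp only [tableVal, contents, List.getD_eq_getElem?_getD, List.getElem?_map]
  split <;> rename_i h
  · simp [h]
  · simp [h]

theorem evalWord_contents {m r : ℕ} (fam : List (Option (Block ℕ))) {w : WordCode}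
    (hw : ∀ z, Sum.inl z ∈ w → z < m * r * (r + 1)) :
    evalWord (tableVal (contents m r fam)) w = some (w.flatMap (wordOf r fam)) := by
  induction w with
  | nil => rfl
  | cons x w ih =>
    have ih := ih fun z hz => hw z (List.mem_cons_of_mem _ hz)
    cases x with
    | inl z =>
      rw [evalWord, ih, tableVal_contents, if_pos (hw z (List.mem_cons_self ..))]
      rfl
    | inr o =>
      rw [evalWord, ih]
      rfl

/-- Applying the symbolic contents of the next family to the contents of the registers. -/
theorem compVal_contents {m r : ℕ} (fam : List (Option (Block ℕ)))
    (fam' : List (Option (Block (ℕ ⊕ ℕ))))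
    (h : ∀ z z', Sum.inl z' ∈ content r fam' z → z' < m * r * (r + 1)) :
    compVal (tableVal (contents m r fam)) (contents m r fam') =
      tableVal (contents m r (fam'.map (Option.map (homBlock (wordOf r fam))))) := by
  funext z
  rw [tableVal_contents, content_hom]
  simp only [compVal, contents, List.getD_eq_getElem?_getD, List.getElem?_map]
  split <;> rename_i hz
  · simp only [List.getElem?_range hz, Option.map_some, Option.getD_some, Option.bind_some]
    exact evalWord_contents fam (h z)
  · simp [hz]

end Symbolic

/-! ### Letters in runs on tokens -/

section Letters

variable {Γ : Type} {n r : ℕ} {tr : List (Trans Γ)} {J : ℕ → List (Block Γ)} {Q : Γ → Prop}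

/-- Composition creates no letters. The predicate `Q` serves both to stay inside the output alphabet
and to keep the registers of the composition in range. -/
theorem letters_of_mem_tokenRuns {u : List (ℕ ⊕ ℕ)}
    (htr : ∀ t ∈ tr, ∀ g, Sum.inr g ∈ flat t.2.2.1 → Q g)
    (hJ : ∀ X, ∀ b ∈ J X, ∀ g, Sum.inr g ∈ flat b.2.2 → Q g) {c : ℕ × Asg Γ}
    (hc : ∀ g, Sum.inr g ∈ flat c.2 → Q g) {d : ℕ × Asg Γ} (hd : d ∈ tokenRuns tr J u [c]) :
    ∀ g, Sum.inr g ∈ flat d.2 → Q g := by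
  refine tokenRuns_induction (P := fun d => ∀ g, Sum.inr g ∈ flat d.2 → Q g) ?_ hc d hd
  intro x _ c hc d hd g hg
  rcases mem_flat_compAsg hg with h | ⟨g', hg', h⟩
  · exact hc g h
  · cases x with
    | inl X =>
      simp only [moves, Sum.elim_inl, List.mem_map, List.mem_filter] at hd
      obtain ⟨b, ⟨hb, _⟩, rfl⟩ := hd
      exact hJ X b hb g h
    | inr o =>
      simp only [moves, Sum.elim_inr, List.mem_map, List.mem_filter] at hd
      obtain ⟨t, ⟨ht, _⟩, rfl⟩ := hd
      exact htr t ht g h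

theorem letters_of_mem_families (htr : ∀ t ∈ tr, ∀ g, Sum.inr g ∈ flat t.2.2.1 → Q g)
    (hJ : ∀ X, ∀ b ∈ J X, ∀ g, Sum.inr g ∈ flat b.2.2 → Q g)
    {m : ℕ} {A : List Bool} {σ : ℕ → Option (List (ℕ ⊕ ℕ))} {fam : List (Option (Block Γ))}
    (h : fam ∈ families n r m tr J A σ) {X : ℕ} {b : Block Γ} (hb : fam.getD X none = some b) :
    ∀ g, Sum.inr g ∈ flat b.2.2 → Q g := by
  obtain ⟨_, u, _, hb⟩ := (mem_families h).2 X b hb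
  exact letters_of_mem_tokenRuns htr hJ (by simp [flat_idAsg]) (mem_blocks.1 hb).2

theorem mem_of_mem_segs {u : List (ℕ ⊕ Γ)} {l : List Γ} {g : Γ} (hl : l ∈ segs u) (hg : g ∈ l) :
    Sum.inr g ∈ u := by
  induction u generalizing l with
  | nil =>
    simp only [segs, List.foldr_nil, List.mem_singleton] at hl
    subst hl
    simp at hg
  | cons x u ih =>
    cases x with
    | inl Y =>
      rw [segs_inl, List.mem_cons] at hl
      rcases hl with rfl | hl
      · simp at hg
      · exact List.mem_cons_of_mem _ (ih hl hg)
    | inr a =>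
      obtain ⟨b, t, h⟩ := List.exists_cons_of_ne_nil (segs_ne_nil u)
      rw [segs_inr, h, List.mem_cons] at hl
      rcases hl with rfl | hl
      · rcases List.mem_cons.1 hg with rfl | hg
        · exact List.mem_cons_self ..
        · exact List.mem_cons_of_mem _ (ih (l := b) (by simp [h]) hg)
      · exact List.mem_cons_of_mem _ (ih (l := l) (by rw [h]; exact List.mem_cons_of_mem _ hl) hg)

theorem getD_mem_of_eq_some {α : Type*} {l : List (Option α)} {i : ℕ} {a : α}
    (h : l.getD i none = some a) : some a ∈ l := by
  rw [List.getD_eq_getElem?_getD] at h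
  cases ho : l[i]? with
  | none => simp [ho] at h
  | some o =>
    rw [ho, Option.getD_some] at h
    exact h ▸ List.mem_of_getElem? ho

theorem mem_content {fam : List (Option (Block Γ))} {z : ℕ} {g : Γ} (hg : g ∈ content r fam z) :
    ∃ X b, fam.getD X none = some b ∧ Sum.inr g ∈ flat b.2.2 := by
  unfold content at hg
  cases hb : fam.getD (z / (r + 1) / r) none with
  | none =>
    rw [hb] at hg
    simp at hg
  | some b =>
    refine ⟨_, b, hb, ?_⟩
    rw [hb, Option.bind_some] at hg
    cases hu : b.2.2.getD (z / (r + 1) % r) none with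
    | none =>
      rw [hu] at hg
      simp at hg
    | some u =>
      rw [hu, Option.map_some, Option.getD_some, List.getD_eq_getElem?_getD] at hg
      cases hl : (segs u)[z % (r + 1)]? with
      | none => simp [hl] at hg
      | some l =>
        rw [hl, Option.getD_some] at hg
        exact mem_flat.2 ⟨u, getD_mem_of_eq_some hu, mem_of_mem_segs (List.mem_of_getElem? hl) hg⟩

end Letters

/-! ### Shapes and states -/

section Shapes

/-- Copyless shapes of assignments on `r` registers. -/
structure GoodShape (r : ℕ) (h : List (Option (List ℕ))) : Prop where
  length_eq : h.length = r
  length_le : ∀ ys, some ys ∈ h → ys.length ≤ r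
  lt_of_mem : ∀ Y ∈ h.flatMap fun o => o.getD [], Y < r
  count_le : ∀ Y, (h.flatMap fun o => o.getD []).count Y ≤ 1

/-- The lists of summaries that occur in states. -/
structure GoodSummaries (m n r : ℕ) (s : List (Option Summary)) : Prop where
  length_eq : s.length = m
  fst_lt : ∀ b, some b ∈ s → b.1 < n
  snd_lt : ∀ b, some b ∈ s → b.2.1 < n
  shape : ∀ b, some b ∈ s → GoodShape r b.2.2

theorem mem_flatMap_getD {α : Type*} {h : List (Option (List α))} {Y : α} :
    Y ∈ (h.flatMap fun o => o.getD []) ↔ ∃ ys, some ys ∈ h ∧ Y ∈ ys := by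
  rw [List.mem_flatMap]
  constructor
  · rintro ⟨_ | u, ho, hx⟩
    · simp at hx
    · exact ⟨u, ho, hx⟩
  · rintro ⟨u, hu, hx⟩
    exact ⟨some u, hu, hx⟩

theorem goodShape_of_goodAsg {Γ : Type} [BEq Γ] [LawfulBEq Γ] {r : ℕ} {σ : Asg Γ} (hσ : GoodAsg r σ) :
    GoodShape r (σ.map fun a => a.map fun u => regsOf u) where
  length_eq := by simp [hσ.length_eq]
  length_le ys h := by
    obtain ⟨o, ho, e⟩ := List.mem_map.1 h
    obtain ⟨u, rfl, rfl⟩ := Option.map_eq_some_iff.1 e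
    exact length_regsOf_le hσ ho
  lt_of_mem Y h := by
    rw [← regsOf_flat, mem_regsOf] at h
    exact hσ.lt_of_mem Y h
  count_le Y := by
    rw [← regsOf_flat, count_regsOf]
    exact hσ.count_le Y

theorem goodSummaries_summaries {Γ : Type} [BEq Γ] [LawfulBEq Γ] {m n r : ℕ}
    {fam : List (Option (Block Γ))} (hlen : fam.length = m)
    (hfam : ∀ X b, fam.getD X none = some b → GoodBlock n r b) :
    GoodSummaries m n r (summaries fam) := by
  have key : ∀ b, some b ∈ summaries fam → ∃ b' : Block Γ, GoodBlock n r b' ∧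
      b = (b'.1, b'.2.1, b'.2.2.map fun a => a.map fun u => regsOf u) := by
    intro b hb
    obtain ⟨o, ho, e⟩ := List.mem_map.1 hb
    obtain ⟨b', rfl, rfl⟩ := Option.map_eq_some_iff.1 e
    obtain ⟨X, hX, e⟩ := List.getElem_of_mem ho
    exact ⟨b', hfam X b' (by rw [List.getD_eq_getElem _ _ hX, e]), rfl⟩
  refine ⟨by simp [summaries, hlen], fun b hb => ?_, fun b hb => ?_, fun b hb => ?_⟩ <;>
    obtain ⟨b', h, rfl⟩ := key b hb
  · exact h.fst_lt
  · exact h.snd_lt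
  · exact goodShape_of_goodAsg h.good

theorem regsOf_unfoldShape (r X : ℕ) (h : List (Option (List ℕ))) :
    ((unfoldShape r X h).map fun a => a.map fun u => regsOf u) = h := by
  refine List.ext_getElem (by simp [unfoldShape]) fun Y h₁ h₂ => ?_
  simp only [unfoldShape, List.getElem_map, List.getElem_range, Option.map_map]
  rw [List.getD_eq_getElem _ _ h₂]
  cases h[Y] with
  | none => rfl
  | some ys =>
    simp only [Option.map_some, Function.comp_apply, Option.some.injEq]
    have : ∀ v : List (ℕ ⊕ (ℕ ⊕ ℕ)), regsOf (Sum.inr (Sum.inl (regIndex r X Y 0)) :: v) =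
      regsOf v := fun v => rfl
    rw [this, regsOf, List.flatMap_assoc]
    have e : ∀ i, [(Sum.inl (ys.getD i 0) : ℕ ⊕ (ℕ ⊕ ℕ)),
        Sum.inr (Sum.inl (regIndex r X Y (i + 1)))].flatMap
          (fun x => Sum.elim (fun Y => [Y]) (fun _ => []) x) = [ys.getD i 0] := fun i => rfl
    simp only [e, ← List.map_eq_flatMap]
    refine List.ext_getElem (by simp) fun i h₁ h₂ => ?_
    simp [List.getElem?_eq_getElem h₂]

theorem lettersOf_flat_unfoldShape (r X : ℕ) (h : List (Option (List ℕ))) :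
    lettersOf (flat (unfoldShape r X h)) = (List.range h.length).flatMap fun Y =>
      (h.getD Y none).elim [] fun ys =>
        (List.range (ys.length + 1)).map fun i => Sum.inl (regIndex r X Y i) := by
  rw [lettersOf, flat, unfoldShape, List.flatMap_map, List.flatMap_assoc]
  refine List.flatMap_congr fun Y _ => ?_
  cases h.getD Y none with
  | none => rfl
  | some ys =>
    simp only [Option.map_some, Option.getD_some, Option.elim_some, List.flatMap_cons,
      List.flatMap_assoc, List.range_succ_eq_map, List.map_cons, List.map_map, Sum.elim_inr,
      Sum.elim_inl, List.nil_append, List.singleton_append, List.flatMap_nil, List.append_nil]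
    congr 1
    simp [List.map_eq_flatMap]

/-- Different `Y` give different indices by decoding, and for one `Y` the indices differ by `i`. So
a symbolic block mentions each register of the composition at most once. -/
theorem nodup_lettersOf_unfoldShape {r X : ℕ} {h : List (Option (List ℕ))} (hh : GoodShape r h) :
    (lettersOf (flat (unfoldShape r X h))).Nodup := by
  rw [lettersOf_flat_unfoldShape, hh.length_eq]
  have key : ∀ Y ∈ List.range r, ∀ x, x ∈ ((h.getD Y none).elim [] fun ys =>
      (List.range (ys.length + 1)).map fun i => (Sum.inl (regIndex r X Y i) : ℕ ⊕ ℕ)) →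
      ∃ i ≤ r, x = Sum.inl (regIndex r X Y i) := by
    intro Y _ x hx
    cases hys : h.getD Y none with
    | none =>
      rw [hys] at hx
      simp at hx
    | some ys =>
      rw [hys, Option.elim_some, List.mem_map] at hx
      obtain ⟨i, hi, rfl⟩ := hx
      have := hh.length_le ys (getD_mem_of_eq_some hys)
      exact ⟨i, by rw [List.mem_range] at hi; omega, rfl⟩
  refine List.nodup_flatMap.2 ⟨fun Y hY => ?_, ?_⟩
  · cases hys : h.getD Y none with
    | none => simp
    | some ys =>
      refine List.nodup_range.map fun i j hij => ?_
      simpa [regIndex] using hij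
  · refine List.Pairwise.imp_of_mem ?_ (List.nodup_range (n := r))
    intro Y Y' hY hY' hne x hx hx'
    obtain ⟨i, hi, rfl⟩ := key Y hY x hx
    obtain ⟨i', hi', e⟩ := key Y' hY' _ hx'
    rw [Sum.inl.injEq] at e
    have h₁ := (regIndex_div (X := X) (List.mem_range.1 hY) hi).2.1
    have h₂ := (regIndex_div (X := X) (List.mem_range.1 hY') hi').2.1
    rw [e, h₂] at h₁
    exact hne h₁.symm

theorem mem_lettersOf {Γ : Type} {u : List (ℕ ⊕ Γ)} {g : Γ} : g ∈ lettersOf u ↔ Sum.inr g ∈ u := by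
  simp only [lettersOf, List.mem_flatMap]
  constructor
  · rintro ⟨_ | g, hx, hY⟩
    · simp at hY
    · simp only [Sum.elim_inr, List.mem_singleton] at hY
      exact hY ▸ hx
  · exact fun h => ⟨_, h, by simp⟩

theorem mem_flat_unfoldShape {r X : ℕ} {h : List (Option (List ℕ))} (hh : GoodShape r h) {g : ℕ ⊕ ℕ}
    (hg : Sum.inr g ∈ flat (unfoldShape r X h)) :
    ∃ Y < r, ∃ i ≤ r, g = Sum.inl (regIndex r X Y i) := by
  rw [← mem_lettersOf, lettersOf_flat_unfoldShape, List.mem_flatMap] at hg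
  obtain ⟨Y, hY, hg⟩ := hg
  refine ⟨Y, by simpa [hh.length_eq] using hY, ?_⟩
  cases hys : h.getD Y none with
  | none =>
    rw [hys] at hg
    simp at hg
  | some ys =>
    rw [hys, Option.elim_some, List.mem_map] at hg
    obtain ⟨i, hi, rfl⟩ := hg
    have := hh.length_le ys (getD_mem_of_eq_some hys)
    exact ⟨i, by rw [List.mem_range] at hi; omega, rfl⟩

variable {m n r : ℕ} {s : List (Option Summary)}

theorem mem_symbolicBlocks {X : ℕ} {b : Block (ℕ ⊕ ℕ)} (hb : b ∈ symbolicBlocks r s X) :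
    ∃ b', s.getD X none = some b' ∧ b = (b'.1, b'.2.1, unfoldShape r X b'.2.2) := by
  simp only [symbolicBlocks, List.mem_map, Option.mem_toList] at hb
  obtain ⟨b', h, rfl⟩ := hb
  exact ⟨b', h, rfl⟩

theorem goodBlock_symbolicBlocks (hs : GoodSummaries m n r s) {X : ℕ} {b : Block (ℕ ⊕ ℕ)}
    (hb : b ∈ symbolicBlocks r s X) : GoodBlock n r b := by
  obtain ⟨b', h, rfl⟩ := mem_symbolicBlocks hb
  have hmem := getD_mem_of_eq_some h
  have hh := hs.shape b' hmem
  refine ⟨hs.fst_lt b' hmem, hs.snd_lt b' hmem, ⟨?_, fun Y hY => ?_, fun Y => ?_⟩⟩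
  · simp [unfoldShape, hh.length_eq]
  · rw [← mem_regsOf, regsOf_flat, regsOf_unfoldShape] at hY
    exact hh.lt_of_mem Y hY
  · rw [← count_regsOf, regsOf_flat, regsOf_unfoldShape]
    exact hh.count_le Y

theorem letters_symbolicBlocks (hs : GoodSummaries m n r s) {X : ℕ} {b : Block (ℕ ⊕ ℕ)}
    (hb : b ∈ symbolicBlocks r s X) {g : ℕ ⊕ ℕ} (hg : Sum.inr g ∈ flat b.2.2) :
    ∃ Y < r, ∃ i ≤ r, X < m ∧ g = Sum.inl (regIndex r X Y i) := by
  obtain ⟨b', h, rfl⟩ := mem_symbolicBlocks hb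
  obtain ⟨Y, hY, i, hi, e⟩ := mem_flat_unfoldShape (hs.shape b' (getD_mem_of_eq_some h)) hg
  refine ⟨Y, hY, i, hi, ?_, e⟩
  by_contra hX
  rw [← hs.length_eq, not_lt] at hX
  simp [List.getElem?_eq_none hX] at h

/-- Each register of the composition belongs to a single register of the first transducer, found by
the two divisions. -/
theorem count_symbolicBlocks_le (hs : GoodSummaries m n r s) {X : ℕ} {b : Block (ℕ ⊕ ℕ)}
    (hb : b ∈ symbolicBlocks r s X) (z : ℕ) :
    (flat b.2.2).count (Sum.inr (Sum.inl z)) ≤ if z / (r + 1) / r = X then 1 else 0 := by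
  split <;> rename_i hz
  · obtain ⟨b', h, rfl⟩ := mem_symbolicBlocks hb
    rw [← count_lettersOf]
    exact List.nodup_iff_count_le_one.1
      (nodup_lettersOf_unfoldShape (hs.shape b' (getD_mem_of_eq_some h))) _
  · rw [Nat.le_zero, List.count_eq_zero]
    intro hg
    obtain ⟨Y, hY, i, hi, _, e⟩ := letters_symbolicBlocks hs hb hg
    rw [Sum.inl.injEq] at e
    exact hz (e ▸ (regIndex_div hY hi).1)

end Shapes

/-- The codes that describe transducers. -/
structure WellFormed (c : Code) : Prop where
  src_lt : ∀ t ∈ c.2.2.2.2.1, t.1 < c.1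
  dst_lt : ∀ t ∈ c.2.2.2.2.1, t.2.2.2 < c.1
  letter_mem : ∀ t ∈ c.2.2.2.2.1, t.2.1 ∈ c.2.2.1
  asg_good : ∀ t ∈ c.2.2.2.2.1, GoodAsg c.2.1 t.2.2.1
  asg_over : ∀ t ∈ c.2.2.2.2.1, ∀ o, Sum.inr o ∈ flat t.2.2.1 → o ∈ c.2.2.2.1
  init_length : c.2.2.2.2.2.1.length = c.1
  init_table_length : ∀ v, some v ∈ c.2.2.2.2.2.1 → v.length = c.2.1
  init_over : ∀ v, some v ∈ c.2.2.2.2.2.1 → ∀ w, some w ∈ v → ∀ o ∈ w, o ∈ c.2.2.2.1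
  final_length : c.2.2.2.2.2.2.length = c.1
  final_lt : ∀ u, some u ∈ c.2.2.2.2.2.2 → ∀ Y, Sum.inl Y ∈ u → Y < c.2.1
  final_count : ∀ u, some u ∈ c.2.2.2.2.2.2 → ∀ Y, u.count (Sum.inl Y) ≤ 1
  final_over : ∀ u, some u ∈ c.2.2.2.2.2.2 → ∀ o, Sum.inr o ∈ u → o ∈ c.2.2.2.1

/-! ### Vectors of truth values -/

theorem mem_boolVectors {m : ℕ} {A : List Bool} : A ∈ boolVectors m ↔ A.length = m := by
  rw [boolVectors, List.mem_sections]
  constructor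
  · intro h
    simpa using h.length_eq
  · rintro rfl
    induction A with
    | nil => exact List.Forall₂.nil
    | cons b A ih => exact List.Forall₂.cons (by cases b <;> simp) ih

theorem nodup_sections {α : Type*} {L : List (List α)} (h : ∀ l ∈ L, l.Nodup) :
    L.sections.Nodup := by
  induction L with
  | nil => simp [List.sections]
  | cons l L ih =>
    rw [List.sections, List.nodup_flatMap]
    refine ⟨fun s _ => (h l (List.mem_cons_self ..)).map fun a b hab => by simpa using hab, ?_⟩
    refine (ih fun l hl => h l (List.mem_cons_of_mem _ hl)).imp fun {s s'} hss => ?_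
    simp only [Function.onFun, List.disjoint_left, List.mem_map]
    rintro _ ⟨a, _, rfl⟩ ⟨a', _, h'⟩
    simp only [List.cons.injEq] at h'
    exact hss h'.2.symm

theorem nodup_boolVectors (m : ℕ) : (boolVectors m).Nodup :=
  nodup_sections fun l hl => by rw [List.eq_of_mem_replicate hl]; decide

/-- The guess need not be stored separately: the state shows it as the set of positions that carry a
summary. -/
theorem isSome_of_mem_families {Γ : Type} {n r m : ℕ} {tr : List (Trans Γ)}
    {J : ℕ → List (Block Γ)} {A : List Bool} {σ : ℕ → Option (List (ℕ ⊕ ℕ))}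
    {fam : List (Option (Block Γ))} (hA : A.length = m) (h : fam ∈ families n r m tr J A σ) :
    ((summaries fam).map fun o => o.isSome) = A := by
  rw [families, List.mem_sections] at h
  have hlen : fam.length = m := by simpa using h.length_eq
  refine List.ext_getElem (by simp [summaries, hlen, hA]) fun X h₁ h₂ => ?_
  have hX : X < fam.length := by omega
  have := h.get hX (by simpa [hlen] using hX)
  simp only [List.get_eq_getElem, List.getElem_map, List.getElem_range] at this
  rw [List.getD_eq_getElem _ _ h₂] at this
  simp only [summaries, List.getElem_map]
  cases hb : A[X] with
  | false =>
    rw [hb, cond_false, List.mem_singleton] at this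
    rw [this]
    rfl
  | true =>
    rw [hb, cond_true, List.mem_map] at this
    obtain ⟨b, _, e⟩ := this
    rw [← e]
    rfl

theorem getD_occurring (m : ℕ) (v : List (ℕ ⊕ ℕ)) {X : ℕ} (hX : X < m) :
    (occurring m v).getD X false = decide (0 < v.count (Sum.inl X)) := by
  rw [occurring, List.getD_eq_getElem _ _ (by simpa using hX), List.getElem_map, List.getElem_range,
    Bool.eq_iff_iff]
  simp [List.any_eq_true, List.count_pos_iff]

/-! ### Expansion over families of blocks -/

section Expansion

variable {Γ : Type} {n r m : ℕ} {tr : List (Trans Γ)} {M : Type*} [AddCommMonoid M]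

/-- Summing over the families on the registers occurring in `v` a functional that uses exactly these
registers, once each, gives its value at the bags of all blocks. -/
theorem lsum_families_occurring {Φ : (ℕ → List (Block Γ)) → M} {v : List (ℕ ⊕ ℕ)} {ν : Val}
    (hν : ∀ X, m ≤ X → ν X = none) (hv : ∀ X, v.count (Sum.inl X) ≤ 1)
    (hΦ : ∀ X, HasDegree X (v.count (Sum.inl X)) Φ) :
    (lsum (families n r m tr (fun _ => []) (occurring m v)
      fun X => (ν X).map fun w => w.map fun o => Sum.inr o) fun fam => Φ (familyBlocks fam)) =
    Φ (valBlocks n r tr ν) := by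
  rw [eq_lsum_sections (Φ := Φ) (A := fun X => (occurring m v).getD X false) (m := m)
    (J := valBlocks n r tr ν)]
  · unfold families
    congr 2
    refine List.map_congr_left fun X _ => ?_
    simp only [pick, valBlocks]
    cases ν X <;> rfl
  · intro X hX
    rw [valBlocks, hν X hX]
    rfl
  · intro X hX
    have h₁ := hv X
    have h₂ := hΦ X
    rw [getD_occurring m v hX]
    rcases Nat.eq_zero_or_pos (v.count (Sum.inl X)) with h | h
    · rw [h] at h₂
      simpa [h] using h₂
    · have e : v.count (Sum.inl X) = 1 := le_antisymm h₁ h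
      rw [e] at h₂
      simpa [e] using h₂

/-- Among all guesses only the set of registers occurring in `v` passes the test, so summing over
guesses causes no repetition. -/
theorem lsum_boolVectors_families {Φ : (ℕ → List (Block Γ)) → M} {v : List (ℕ ⊕ ℕ)} {ν : Val}
    (hν : ∀ X, m ≤ X → ν X = none) (hv : ∀ X, v.count (Sum.inl X) ≤ 1)
    (hΦ : ∀ X, HasDegree X (v.count (Sum.inl X)) Φ) :
    (lsum (boolVectors m) fun A => lsum (families n r m tr (fun _ => []) A
      fun X => (ν X).map fun w => w.map fun o => Sum.inr o) fun fam =>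
        bif decide (A = occurring m v) then Φ (familyBlocks fam) else 0) =
    Φ (valBlocks n r tr ν) := by
  rw [← lsum_families_occurring hν hv hΦ, ← lsum_decide_eq (nodup_boolVectors m)
    (mem_boolVectors.2 (by simp [occurring] : (occurring m v).length = m))
    (fun A => lsum (families n r m tr (fun _ => []) A
      fun X => (ν X).map fun w => w.map fun o => Sum.inr o) fun fam => Φ (familyBlocks fam))]
  refine lsum_congr fun A _ => ?_
  by_cases h : A = occurring m v
  · simp [h]
  · simp [h, Ne.symm h]

/-- All blocks on the new contents arise from all blocks on the old contents and the transitions on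
letters; this is the update of the invariant by one step of the first transducer. -/
theorem families_valBlocks (htr : ∀ t ∈ tr, t.2.2.2 < n ∧ t.2.2.1.length = r) (ν : Val)
    (A : List Bool) (σ : List (Option WordCode)) :
    families n r m tr (valBlocks n r tr ν) A (fun X => σ.getD X none) =
      families n r m tr (fun _ => []) A
        fun X => (compVal ν σ X).map fun w => w.map fun o => Sum.inr o := by
  unfold families
  congr 1
  refine List.map_congr_left fun X _ => ?_
  simp only [blocks_valBlocks htr, compVal]
  cases (σ.getD X none).bind (evalWord ν) <;> rfl

end Expansion

/-! ### The bag of outputs of the composition -/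

section Output

variable {c₁ c₂ : Code}

theorem count_selectedWord_le {m : ℕ} {σ : Asg ℕ} (hσ : GoodAsg m σ) (A : List Bool) (X : ℕ) :
    (selectedWord m A fun Y => σ.getD Y none).count (Sum.inl X) ≤ 1 := by
  refine le_trans ?_ (hσ.count_le X)
  rw [← sum_count_getD, hσ.length_eq, selectedWord, List.count_flatMap, Finset.sum_range,
    ← List.sum_ofFn, List.ofFn_eq_map, ← List.map_coe_finRange_eq_range, List.map_map]
  refine List.sum_le_sum fun Y _ => ?_
  simp only [Function.comp_apply]
  cases A.getD Y false <;> simp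

theorem goodTrans_of_wellFormed (h : WellFormed c₂) : GoodTrans c₂.1 c₂.2.1 c₂.2.2.2.2.1 :=
  fun t ht => ⟨h.dst_lt t ht, h.asg_good t ht⟩

theorem flat_lift (σ : Asg ℕ) :
    flat (σ.map fun o => o.map fun u => u.map fun x =>
      Sum.elim (fun Y => Sum.inl Y) (fun g => Sum.inr (Sum.inr g : ℕ ⊕ ℕ)) x) =
    (flat σ).map fun x => Sum.elim (fun Y => Sum.inl Y) (fun g => Sum.inr (Sum.inr g)) x := by
  simp only [flat, List.flatMap_map, List.map_flatMap]
  refine List.flatMap_congr fun o _ => ?_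
  cases o <;> rfl

theorem lift_injective : Function.Injective (fun x : ℕ ⊕ ℕ =>
    (Sum.elim (fun Y => Sum.inl Y) (fun g => Sum.inr (Sum.inr g)) x : ℕ ⊕ (ℕ ⊕ ℕ))) := by
  intro x y h
  cases x <;> cases y <;> simp_all

theorem goodTrans_liftTrans {n r : ℕ} {tr : List (Trans ℕ)} (h : GoodTrans n r tr) :
    GoodTrans n r (liftTrans tr) := by
  intro t ht
  obtain ⟨t', ht', rfl⟩ := List.mem_map.1 ht
  obtain ⟨h₁, h₂⟩ := h t' ht'
  refine ⟨h₁, ⟨by simp [h₂.length_eq], fun Y hY => ?_, fun Y => ?_⟩⟩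
  · rw [flat_lift] at hY
    refine h₂.lt_of_mem Y ?_
    rw [← List.mem_map_of_injective lift_injective]
    exact hY
  · rw [flat_lift]
    refine le_of_eq_of_le ?_ (h₂.count_le Y)
    exact List.count_map_of_injective _ _ lift_injective (Sum.inl Y)

theorem letters_liftTrans {tr : List (Trans ℕ)} {Q : ℕ ⊕ ℕ → Prop}
    (h : ∀ t ∈ tr, ∀ o, Sum.inr o ∈ flat t.2.2.1 → Q (Sum.inr o)) :
    ∀ t ∈ liftTrans tr, ∀ g, Sum.inr g ∈ flat t.2.2.1 → Q g := by
  intro t ht g hg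
  obtain ⟨t', ht', rfl⟩ := List.mem_map.1 ht
  rw [flat_lift, List.mem_map] at hg
  obtain ⟨x, hx, e⟩ := hg
  cases x with
  | inl Y => simp at e
  | inr o =>
    simp only [Sum.elim_inr, Sum.inr.injEq] at e
    exact e ▸ h t' ht' o hx

theorem inl_mem_symbolicBlocks {m n r X z : ℕ} {s : List (Option Summary)}
    (hs : GoodSummaries m n r s) {b : Block (ℕ ⊕ ℕ)} (hb : b ∈ symbolicBlocks r s X)
    (hz : Sum.inr (Sum.inl z) ∈ flat b.2.2) : z < m * r * (r + 1) := by
  obtain ⟨Y, hY, i, hi, hX, e⟩ := letters_symbolicBlocks hs hb hz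
  rw [Sum.inl.injEq] at e
  exact e ▸ regIndex_lt hX hY hi

/-- The registers of the composition in the contents of a symbolic family are in range. -/
theorem inl_mem_content {m n r k l : ℕ} {s : List (Option Summary)} (hs : GoodSummaries m n r s)
    {tr : List (Trans ℕ)} {A : List Bool} {σ : ℕ → Option (List (ℕ ⊕ ℕ))}
    {fam : List (Option (Block (ℕ ⊕ ℕ)))}
    (h : fam ∈ families k r l (liftTrans tr) (symbolicBlocks r s) A σ) (z z' : ℕ)
    (hz : Sum.inl z' ∈ content r fam z) : z' < m * r * (r + 1) := by
  obtain ⟨X, b, hb, hg⟩ := mem_content hz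
  have := letters_of_mem_families (Q := fun g => ∀ z', g = Sum.inl z' → z' < m * r * (r + 1))
    (letters_liftTrans (by simp)) ?_ h hb _ hg
  · exact this z' rfl
  · rintro X b hb g hg z' rfl
    exact inl_mem_symbolicBlocks hs hb hg

/-- Passage from symbolic to actual families: inserting the contents of the registers leaves the
summaries unchanged and turns the assignment of a transition into the next contents. -/
theorem lsum_multiOut_cons {M : Type*} [AddCommMonoid M]
    {fam : List (Option (Block ℕ))} (hlen : fam.length = c₁.2.1)
    (hfam : ∀ X b, fam.getD X none = some b → GoodBlock c₂.1 c₂.2.1 b) (A : List Bool)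
    (σ : List (Option WordCode)) (f : List (Option Summary) → Val → M) :
    (lsum (families c₂.1 c₂.2.1 c₁.2.1 (liftTrans c₂.2.2.2.2.1)
      (fun X => symbolicBlocks c₂.2.1 (summaries fam) X) A (fun X => σ.getD X none)) fun fam' =>
        f (summaries fam') (compVal (tableVal (contents c₁.2.1 c₂.2.1 fam))
          (contents c₁.2.1 c₂.2.1 fam'))) =
    lsum (families c₂.1 c₂.2.1 c₁.2.1 c₂.2.2.2.2.1 (familyBlocks fam) A (fun X => σ.getD X none))
      fun fam' => f (summaries fam') (tableVal (contents c₁.2.1 c₂.2.1 fam')) := by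
  rw [families_hom (liftTrans_hom c₂.2.1 fam _) (symbolicBlocks_hom hfam), lsum_map]
  refine lsum_congr fun fam' hfam' => ?_
  rw [summaries_hom, compVal_contents fam fam'
    fun z x hz => inl_mem_content (goodSummaries_summaries hlen hfam) hfam' z x hz]

/-- The outputs of the second transducer on the string of tokens `u`. -/
def tokenOutputs {Γ : Type} (c₂ : Code) (tr : List (Trans Γ)) (e : ℕ → Γ) (J : ℕ → List (Block Γ))
    (u : List (ℕ ⊕ ℕ)) : List (List Γ) :=
  (List.range c₂.1).flatMap fun p => (c₂.2.2.2.2.2.1.getD p none).toList.flatMap fun ν =>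
    (tokenRuns tr J u [(p, ν.map fun o => o.map fun w => w.map fun a => Sum.inr (e a))]).flatMap
      fun d => (c₂.2.2.2.2.2.2.getD d.1 none).toList.flatMap fun v =>
        (subst d.2 (v.map fun x => Sum.elim (fun Y => Sum.inl Y) (fun g => Sum.inr (e g)) x)).toList.map
          fun y => lettersOf y

theorem letters_of_mem_tokenOutputs {Γ : Type} {tr : List (Trans Γ)} {e : ℕ → Γ}
    {J : ℕ → List (Block Γ)} {Q : Γ → Prop} (htr : ∀ t ∈ tr, ∀ g, Sum.inr g ∈ flat t.2.2.1 → Q g)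
    (hJ : ∀ X, ∀ b ∈ J X, ∀ g, Sum.inr g ∈ flat b.2.2 → Q g)
    (hinit : ∀ v, some v ∈ c₂.2.2.2.2.2.1 → ∀ w, some w ∈ v → ∀ o ∈ w, Q (e o))
    (hfinal : ∀ u, some u ∈ c₂.2.2.2.2.2.2 → ∀ o, Sum.inr o ∈ u → Q (e o))
    {u : List (ℕ ⊕ ℕ)} {y : List Γ} (hy : y ∈ tokenOutputs c₂ tr e J u) : ∀ g ∈ y, Q g := by
  intro g hg
  simp only [tokenOutputs, List.mem_flatMap, List.mem_map, Option.mem_toList] at hy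
  obtain ⟨p, _, ν, hν, d, hd, v, hv, y', hy', rfl⟩ := hy
  rw [mem_lettersOf, subst_eq_some hy', List.mem_flatMap] at hg
  obtain ⟨x, hx, hg⟩ := hg
  rcases mem_image hg with hg | ⟨g', e₁, e₂⟩
  · refine letters_of_mem_tokenRuns htr hJ (fun g hg => ?_) hd g hg
    obtain ⟨w, hw, hg⟩ := mem_flat.1 hg
    obtain ⟨o, ho, e₁⟩ := List.mem_map.1 hw
    obtain ⟨w', rfl, rfl⟩ := Option.map_eq_some_iff.1 e₁
    obtain ⟨o, ho', e₂⟩ := List.mem_map.1 hg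
    rw [Sum.inr.injEq] at e₂
    exact e₂ ▸ hinit ν (getD_mem_of_eq_some hν) w' ho o ho'
  · rw [e₂, ← e₁] at hx
    obtain ⟨x', hx', e₃⟩ := List.mem_map.1 hx
    cases x' with
    | inl Y => simp at e₃
    | inr o =>
      simp only [Sum.elim_inr, Sum.inr.injEq] at e₃
      exact e₃ ▸ hfinal v (getD_mem_of_eq_some hv) o hx'

theorem finals_eq (c₁ c₂ : Code) (s : State) : finals c₁ c₂ s =
    (c₁.2.2.2.2.2.2.getD s.1 none).toList.flatMap fun u =>
      bif decide ((s.2.map fun o => o.isSome) = occurring c₁.2.1 u) then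
        tokenOutputs c₂ (liftTrans c₂.2.2.2.2.1) Sum.inr (symbolicBlocks c₂.2.1 s.2) u
      else [] := rfl

theorem lettersOf_homWord {Γ Δ : Type} (g : Γ → List Δ) (u : List (ℕ ⊕ Γ)) :
    lettersOf (homWord g u) = (lettersOf u).flatMap g := by
  induction u with
  | nil => rfl
  | cons x u ih =>
    have e : ∀ v w : List (ℕ ⊕ Δ), lettersOf (v ++ w) = lettersOf v ++ lettersOf w := by
      simp [lettersOf]
    rw [homWord_cons, e, ih]
    cases x with
    | inl Y => rfl
    | inr a =>
      have : lettersOf ((g a).map (Sum.inr : Δ → ℕ ⊕ Δ)) = g a := by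
        simp [lettersOf, List.flatMap_map]
      rw [Sum.elim_inr, this]
      rfl

theorem tokenOutputs_hom (r : ℕ) (fam : List (Option (Block ℕ))) {J : ℕ → List (Block ℕ)}
    {J' : ℕ → List (Block (ℕ ⊕ ℕ))} (hJ : ∀ X, J X = (J' X).map (homBlock (wordOf r fam)))
    (u : List (ℕ ⊕ ℕ)) :
    tokenOutputs c₂ c₂.2.2.2.2.1 id J u =
      (tokenOutputs c₂ (liftTrans c₂.2.2.2.2.1) Sum.inr J' u).map
        fun y => y.flatMap (wordOf r fam) := by
  unfold tokenOutputs
  simp only [List.map_flatMap]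
  refine List.flatMap_congr fun p _ => List.flatMap_congr fun ν _ => ?_
  have hinit : (ν.map fun o => o.map fun w => w.map fun a => (Sum.inr (id a) : ℕ ⊕ ℕ)) =
      homAsg (wordOf r fam) (ν.map fun o => o.map fun w => w.map fun a => Sum.inr (Sum.inr a)) := by
    rw [homAsg, List.map_map]
    refine List.map_congr_left fun o _ => ?_
    cases o with
    | none => rfl
    | some w =>
      clear * -
      simp only [Option.map_some, Function.comp_apply, Option.some.injEq]
      induction w with
      | nil => rfl
      | cons a w ih =>
        rw [List.map_cons, List.map_cons, homWord_cons, ← ih]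
        rfl
  have hrun := tokenRuns_hom (liftTrans_hom r fam c₂.2.2.2.2.1) hJ u
    (p, ν.map fun o => o.map fun w => w.map fun a => Sum.inr (Sum.inr a))
  rw [hinit, hrun, List.flatMap_map]
  refine List.flatMap_congr fun d _ => List.flatMap_congr fun v _ => ?_
  have hv : ∀ v : WordCode,
      (v.map fun x => Sum.elim (fun Y => Sum.inl Y) (fun g => Sum.inr (id g)) x) =
      homWord (wordOf r fam) (v.map fun x =>
        Sum.elim (fun Y => Sum.inl Y) (fun g => Sum.inr (Sum.inr g)) x) := by
    intro v
    induction v with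
    | nil => rfl
    | cons x v ih =>
      rw [List.map_cons, List.map_cons, homWord_cons, ← ih]
      cases x <;> rfl
  rw [hv v, subst_hom]
  cases subst d.2 (v.map fun x => Sum.elim (fun Y => Sum.inl Y) (fun g => Sum.inr (Sum.inr g)) x) with
  | none => rfl
  | some y => simp [lettersOf_homWord]

theorem map_lettersOf_subst (σ : Asg ℕ) (u : WordCode) :
    (subst σ u).map lettersOf = evalWord (fun X => (σ.getD X none).map lettersOf) u := by
  have e : ∀ v w : List (ℕ ⊕ ℕ), lettersOf (v ++ w) = lettersOf v ++ lettersOf w := by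
    simp [lettersOf]
  induction u with
  | nil => rfl
  | cons x u ih =>
    cases x with
    | inl Y =>
      rw [subst_inl, evalWord, ← ih]
      cases subst σ u <;> cases σ.getD Y none <;> simp [e]
    | inr o =>
      rw [subst_inr, evalWord, ← ih]
      cases subst σ u <;> simp [lettersOf]

/-- An assignment becomes a valuation by erasing registers, and substitution then becomes
evaluation. Where this is applied, the initial assignment contains no registers. -/
theorem lsum_tokenRuns_eq_outFrom (w : List ℕ) (p : ℕ) (σ : Asg ℕ) (tr : List (Trans ℕ))
    (fin : ℕ → Option WordCode) :
    (lsum (tokenRuns tr (fun _ => []) (w.map fun o => Sum.inr o) [(p, σ)]) fun d =>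
      lsum (fin d.1).toList fun v => (((subst d.2 v).map lettersOf).toList : Multiset (List ℕ))) =
    outFrom tr fin w p fun X => (σ.getD X none).map lettersOf := by
  induction w generalizing p σ with
  | nil =>
    simp only [List.map_nil, tokenRuns, List.foldl_nil, lsum_singleton, outFrom,
      map_lettersOf_subst]
  | cons a w ih =>
    rw [List.map_cons, tokenRuns_cons, lsum_flatMap]
    simp only [moves, Sum.elim_inr, lsum_map, ih, outFrom]
    refine lsum_congr fun t _ => ?_
    congr 1
    funext X
    rw [getD_compAsg, compVal]
    cases t.2.2.1.getD X none with
    | none => rfl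
    | some u => exact map_lettersOf_subst σ u

theorem lsum_tokenOutputs (w : List ℕ) :
    (lsum (tokenOutputs c₂ c₂.2.2.2.2.1 id (fun _ => []) (w.map fun o => Sum.inr o))
      fun y => ({y} : Multiset (List ℕ))) = codeSem c₂ w := by
  simp only [tokenOutputs, lsum_flatMap, lsum_map, codeSem, listSem]
  refine lsum_congr fun p _ => lsum_congr fun ν _ => ?_
  have hid : ∀ v : WordCode, (v.map fun x =>
      Sum.elim (fun Y => Sum.inl Y) (fun g => Sum.inr (id g)) x) = v := by
    intro v
    conv_rhs => rw [← List.map_id v]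
    exact List.map_congr_left fun x _ => by cases x <;> rfl
  have ho : ∀ o : Option (List (ℕ ⊕ ℕ)), (lsum o.toList fun y => ({lettersOf y} : Multiset (List ℕ))) =
      ((o.map lettersOf).toList : Multiset (List ℕ)) := by
    intro o
    cases o <;> simp
  simp only [hid, ho]
  rw [lsum_tokenRuns_eq_outFrom w p _ c₂.2.2.2.2.1 fun q => c₂.2.2.2.2.2.2.getD q none]
  congr 1
  funext X
  rw [tableVal, List.getD_eq_getElem?_getD, List.getD_eq_getElem?_getD, List.getElem?_map]
  cases ν[X]? with
  | none => rfl
  | some o =>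
    cases o with
    | none => rfl
    | some w => simp [lettersOf, List.flatMap_map]

theorem tokenOutputs_valBlocks (h₂ : WellFormed c₂) (ν : Val) (u : List (ℕ ⊕ ℕ)) :
    tokenOutputs c₂ c₂.2.2.2.2.1 id (valBlocks c₂.1 c₂.2.1 c₂.2.2.2.2.1 ν) u =
      (evalWord ν u).elim [] fun w =>
        tokenOutputs c₂ c₂.2.2.2.2.1 id (fun _ => []) (w.map fun o => Sum.inr o) := by
  have htr : ∀ t ∈ c₂.2.2.2.2.1, t.2.2.2 < c₂.1 ∧ t.2.2.1.length = c₂.2.1 :=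
    fun t ht => ⟨h₂.dst_lt t ht, (h₂.asg_good t ht).length_eq⟩
  have key : ∀ p ∈ List.range c₂.1, ∀ ν' ∈ (c₂.2.2.2.2.2.1.getD p none).toList,
      tokenRuns c₂.2.2.2.2.1 (valBlocks c₂.1 c₂.2.1 c₂.2.2.2.2.1 ν) u
        [(p, ν'.map fun o => o.map fun w => w.map fun a => Sum.inr (id a))] =
      (evalWord ν u).elim [] fun w => tokenRuns c₂.2.2.2.2.1 (fun _ => [])
        (w.map fun o => Sum.inr o)
        [(p, ν'.map fun o => o.map fun w => w.map fun a => Sum.inr (id a))] := by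
    intro p hp ν' hν'
    refine tokenRuns_valBlocks htr ν u _ ⟨List.mem_range.1 hp, ?_⟩
    rw [Option.mem_toList] at hν'
    simpa using h₂.init_table_length ν' (getD_mem_of_eq_some hν')
  unfold tokenOutputs
  rw [List.flatMap_congr fun p hp => List.flatMap_congr fun ν' hν' => by rw [key p hp ν' hν']]
  cases evalWord ν u with
  | none => simp
  | some w => rfl

theorem hasDegree_tokenOutputs {M : Type*} [AddCommMonoid M] {X : ℕ} (f : List ℕ → M)
    (u : List (ℕ ⊕ ℕ)) : HasDegree X (u.count (Sum.inl X)) fun J =>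
      lsum (tokenOutputs c₂ c₂.2.2.2.2.1 id J u) f := by
  simp only [tokenOutputs, lsum_flatMap, lsum_map]
  refine HasDegree.lsum _ fun p _ => HasDegree.lsum _ fun ν _ => ?_
  have := hasDegree_tokenRuns (tr := c₂.2.2.2.2.1) (X := X) (n := 0)
    (Φ := fun (d : ℕ × Asg ℕ) (_ : ℕ → List (Block ℕ)) =>
      lsum (c₂.2.2.2.2.2.2.getD d.1 none).toList fun v =>
        lsum (subst d.2 (v.map fun x =>
          Sum.elim (fun Y => Sum.inl Y) (fun g => Sum.inr (id g)) x)).toList fun y => f (lettersOf y))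
    (fun d J L => rfl) u (p, ν.map fun o => o.map fun w => w.map fun a => Sum.inr (id a))
  rwa [zero_add] at this

end Output

/-! ### Correctness of the composition, by induction on the input. -/

section Main

variable {c₁ c₂ : Code}

theorem good_of_mem_valFamilies (h₂ : WellFormed c₂) {m : ℕ} {A : List Bool}
    {σ : ℕ → Option (List (ℕ ⊕ ℕ))} {fam : List (Option (Block ℕ))}
    (h : fam ∈ families c₂.1 c₂.2.1 m c₂.2.2.2.2.1 (fun _ => []) A σ) :
    ∀ X b, fam.getD X none = some b → GoodBlock c₂.1 c₂.2.1 b :=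
  fun _ _ hb => good_of_mem_families (goodTrans_of_wellFormed h₂) (by simp) h hb

theorem multiOut_nil (h₂ : WellFormed c₂) {A : List Bool} (hA : A.length = c₁.2.1)
    {σ : ℕ → Option (List (ℕ ⊕ ℕ))} {fam : List (Option (Block ℕ))}
    (hfam : fam ∈ families c₂.1 c₂.2.1 c₁.2.1 c₂.2.2.2.2.1 (fun _ => []) A σ) (q : ℕ) :
    multiOut (fun s => steps c₁ c₂ s) (fun s => finals c₁ c₂ s) [] (q, summaries fam)
        (tableVal (contents c₁.2.1 c₂.2.1 fam)) =
      lsum (c₁.2.2.2.2.2.2.getD q none).toList fun u =>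
        bif decide (A = occurring c₁.2.1 u) then
          lsum (tokenOutputs c₂ c₂.2.2.2.2.1 id (familyBlocks fam) u)
            fun y => ({y} : Multiset (List ℕ))
        else 0 := by
  have hgood := good_of_mem_valFamilies h₂ hfam
  have hlen := (mem_families hfam).1
  have hs := goodSummaries_summaries hlen hgood
  simp only [multiOut, finals_eq, isSome_of_mem_families hA hfam, lsum_flatMap, lsum_cond, lsum_nil]
  refine lsum_congr fun u _ => ?_
  congr 1
  rw [tokenOutputs_hom c₂.2.1 fam (symbolicBlocks_hom hgood), lsum_map]
  refine lsum_congr fun y hy => ?_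
  rw [evalWord_contents]
  · rfl
  intro z hz
  refine letters_of_mem_tokenOutputs (c₂ := c₂)
    (Q := fun g => ∀ z, g = Sum.inl z → z < c₁.2.1 * c₂.2.1 * (c₂.2.1 + 1))
    (letters_liftTrans (by simp)) (fun X b hb g hg z hz => ?_) (by simp) (by simp) hy _ hz z rfl
  subst hz
  exact inl_mem_symbolicBlocks hs hb hg

theorem multiOut_cons (h₂ : WellFormed c₂) {A : List Bool} (hA : A.length = c₁.2.1)
    {σ : ℕ → Option (List (ℕ ⊕ ℕ))} {fam : List (Option (Block ℕ))}
    (hfam : fam ∈ families c₂.1 c₂.2.1 c₁.2.1 c₂.2.2.2.2.1 (fun _ => []) A σ) (q a : ℕ)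
    (w : List ℕ) :
    multiOut (fun s => steps c₁ c₂ s) (fun s => finals c₁ c₂ s) (a :: w) (q, summaries fam)
        (tableVal (contents c₁.2.1 c₂.2.1 fam)) =
      lsum (c₁.2.2.2.2.1.filter fun t => decide (t.1 = q) && decide (t.2.1 = a)) fun t =>
        lsum (boolVectors c₁.2.1) fun A' =>
          bif decide (A = occurring c₁.2.1
              (selectedWord c₁.2.1 A' fun X => t.2.2.1.getD X none)) then
            lsum (families c₂.1 c₂.2.1 c₁.2.1 c₂.2.2.2.2.1 (familyBlocks fam) A'
              fun X => t.2.2.1.getD X none) fun fam' =>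
                multiOut (fun s => steps c₁ c₂ s) (fun s => finals c₁ c₂ s) w
                  (t.2.2.2, summaries fam') (tableVal (contents c₁.2.1 c₂.2.1 fam'))
          else 0 := by
  have hgood := good_of_mem_valFamilies h₂ hfam
  have hlen := (mem_families hfam).1
  simp only [multiOut]
  have key := fun (t : ℕ × ℕ × List (Option WordCode) × ℕ) A' =>
    lsum_multiOut_cons (c₁ := c₁) (c₂ := c₂) hlen hgood A' t.2.2.1 fun s ν =>
      multiOut (fun s => steps c₁ c₂ s) (fun s => finals c₁ c₂ s) w (t.2.2.2, s) ν
  -- The continuation is made opaque, so that unfolding `steps` concerns the present step only.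
  generalize multiOut (fun s => steps c₁ c₂ s) (fun s => finals c₁ c₂ s) w = G at key ⊢
  simp only [steps, lsum_filter, lsum_flatMap, isSome_of_mem_families hA hfam, lsum_cond,
    lsum_map, lsum_nil]
  refine lsum_congr fun t _ => ?_
  cases decide (t.1 = q) with
  | false => rfl
  | true =>
    simp only [cond_true, Bool.true_and]
    by_cases ha : t.2.1 = a
    · simp only [ha, decide_true, cond_true]
      refine lsum_congr fun A' _ => ?_
      congr 1
      exact key t A'
    · simp only [ha, decide_false, cond_false, lsum_zero]
      refine (lsum_congr fun A' _ => ?_).trans (lsum_zero (boolVectors c₁.2.1))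
      cases decide (A = occurring c₁.2.1 (selected c₁.2.1 A' t.2.2.1)) <;> rfl

/-- The outputs of the composition from all configurations that describe blocks on the contents of
the registers of the first transducer. -/
theorem lsum_multiOut (h₁ : WellFormed c₁) (h₂ : WellFormed c₂) (w : List ℕ) (q : ℕ) (ν : Val)
    (hν : ∀ X, c₁.2.1 ≤ X → ν X = none) :
    (lsum (boolVectors c₁.2.1) fun A =>
      lsum (families c₂.1 c₂.2.1 c₁.2.1 c₂.2.2.2.2.1 (fun _ => []) A
        fun X => (ν X).map fun w => w.map fun o => Sum.inr o) fun fam =>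
          multiOut (fun s => steps c₁ c₂ s) (fun s => finals c₁ c₂ s) w (q, summaries fam)
            (tableVal (contents c₁.2.1 c₂.2.1 fam))) =
    (outFrom c₁.2.2.2.2.1 (fun q => c₁.2.2.2.2.2.2.getD q none) w q ν).bind (codeSem c₂) := by
  have htr : ∀ t ∈ c₂.2.2.2.2.1, t.2.2.2 < c₂.1 ∧ t.2.2.1.length = c₂.2.1 :=
    fun t ht => ⟨h₂.dst_lt t ht, (h₂.asg_good t ht).length_eq⟩
  induction w generalizing q ν with
  | nil =>
    rw [lsum_congr fun A hA => lsum_congr fun fam hfam =>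
      multiOut_nil h₂ (mem_boolVectors.1 hA) hfam q]
    -- The output string `u` of the first transducer is summed first: only for fixed `u` can the
    -- guess `A` and the families be eliminated.
    rw [lsum_congr fun A _ => lsum_comm _ _ _, lsum_comm, outFrom, lsum_bind]
    refine lsum_congr fun u hu => ?_
    rw [Option.mem_toList] at hu
    rw [lsum_boolVectors_families (Φ := fun J => lsum (tokenOutputs c₂ c₂.2.2.2.2.1 id J u)
      fun y => ({y} : Multiset (List ℕ))) hν (h₁.final_count u (getD_mem_of_eq_some hu))
      fun X => hasDegree_tokenOutputs _ u, tokenOutputs_valBlocks h₂]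
    cases evalWord ν u with
    | none => simp
    | some w => simp [lsum_tokenOutputs]
  | cons a w ih =>
    rw [lsum_congr fun A hA => lsum_congr fun fam hfam =>
      multiOut_cons h₂ (mem_boolVectors.1 hA) hfam q a w]
    rw [lsum_congr fun A _ => lsum_comm _ _ _, lsum_comm, outFrom, lsum_bind]
    refine lsum_congr fun t ht => ?_
    have hgood := h₁.asg_good t (List.mem_of_mem_filter ht)
    -- With the transition and the next guess fixed, the present guess and the families on the old
    -- contents are summed out, which leaves the left side of the induction hypothesis for the new
    -- valuation.
    rw [lsum_congr fun A _ => lsum_comm _ _ _, lsum_comm, ← ih]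
    · refine lsum_congr fun A' _ => ?_
      -- As a functional of the available blocks, the sum over the next families has in each
      -- register the degree with which it occurs in the selected strings, at most one as the
      -- assignment is copyless.
      rw [lsum_boolVectors_families (Φ := fun J => lsum (families c₂.1 c₂.2.1 c₁.2.1 c₂.2.2.2.2.1 J
        A' fun X => t.2.2.1.getD X none) fun fam' =>
          multiOut (fun s => steps c₁ c₂ s) (fun s => finals c₁ c₂ s) w
            (t.2.2.2, summaries fam') (tableVal (contents c₁.2.1 c₂.2.1 fam'))) hν
        (count_selectedWord_le hgood A'), families_valBlocks htr]
      intro X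
      have := hasDegree_families (tr := c₂.2.2.2.2.1) (X := X) (n := 0) (k := c₂.1) (r := c₂.2.1)
        (m := c₁.2.1) (Φ := fun (fam' : List (Option (Block ℕ))) (_ : ℕ → List (Block ℕ)) =>
          multiOut (fun s => steps c₁ c₂ s) (fun s => finals c₁ c₂ s) w
            (t.2.2.2, summaries fam') (tableVal (contents c₁.2.1 c₂.2.1 fam')))
        (fun _ _ _ => rfl) A' fun X => t.2.2.1.getD X none
      rwa [zero_add] at this
    · intro X hX
      have : t.2.2.1.length ≤ X := hgood.length_eq ▸ hX
      simp [compVal, List.getElem?_eq_none this]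

theorem lsum_inits (h₁ : WellFormed c₁) (h₂ : WellFormed c₂) (w : List ℕ) :
    (lsum (inits c₁ c₂) fun e => multiOut (fun s => steps c₁ c₂ s) (fun s => finals c₁ c₂ s) w e.1
      (tableVal e.2)) = (codeSem c₁ w).bind (codeSem c₂) := by
  simp only [inits, lsum_flatMap, lsum_map, codeSem, listSem, lsum_bind]
  refine lsum_congr fun q _ => lsum_congr fun v hv => ?_
  rw [Option.mem_toList] at hv
  refine lsum_multiOut h₁ h₂ w q (tableVal v) fun X hX => ?_
  rw [← h₁.init_table_length v (getD_mem_of_eq_some hv)] at hX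
  simp [tableVal, List.getElem?_eq_none hX]

end Main

/-! ### The states of the composition -/

section States

theorem nodup_flatMap_of_key {α β : Type*} {l : List α} {f : α → List β} (key : β → α)
    (hl : l.Nodup) (hf : ∀ a ∈ l, (f a).Nodup) (hkey : ∀ a ∈ l, ∀ b ∈ f a, key b = a) :
    (l.flatMap f).Nodup := by
  refine List.nodup_flatMap.2 ⟨hf, hl.imp_of_mem fun ha ha' hne b hb hb' => ?_⟩
  exact hne ((hkey _ ha b hb).symm.trans (hkey _ ha' b hb'))

theorem mem_sections_replicate {α : Type*} {l : List α} {m : ℕ} {s : List α} :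
    s ∈ (List.replicate m l).sections ↔ s.length = m ∧ ∀ a ∈ s, a ∈ l := by
  rw [List.mem_sections]
  induction m generalizing s with
  | zero => simp +contextual
  | succ m ih =>
    rw [List.replicate_succ]
    cases s with
    | nil => simp
    | cons a s => simp [ih]; tauto

theorem length_filter_decide_eq (l : List ℕ) (Y : ℕ) :
    (l.filter fun Y' => decide (Y' = Y)).length = l.count Y := by
  rw [List.count, List.countP_eq_length_filter]
  rfl

theorem mem_shapes {r : ℕ} {h : List (Option (List ℕ))} : h ∈ shapes r ↔ GoodShape r h := by
  simp only [shapes, List.mem_filter, mem_sections_replicate, List.all_eq_true, List.mem_range,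
    decide_eq_true_eq, length_filter_decide_eq, List.mem_cons, List.mem_flatMap, List.mem_map]
  constructor
  · rintro ⟨⟨h₁, h₂⟩, h₃⟩
    have key : ∀ ys, some ys ∈ h → ys.length ≤ r ∧ ∀ Y ∈ ys, Y < r := by
      intro ys hys
      rcases h₂ _ hys with e | ⟨j, hj, ys', ⟨hl, hm⟩, e⟩
      · simp at e
      · rw [Option.some.injEq] at e
        subst e
        exact ⟨by omega, hm⟩
    have hlt : ∀ Y ∈ h.flatMap fun o => o.getD [], Y < r := by
      intro Y hY
      obtain ⟨ys, hys, hY⟩ := mem_flatMap_getD.1 hY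
      exact (key ys hys).2 Y hY
    refine ⟨h₁, fun ys hys => (key ys hys).1, hlt, fun Y => ?_⟩
    by_cases hY : Y < r
    · exact h₃ Y hY
    · rw [List.count_eq_zero.2 fun hm => hY (hlt Y hm)]
      exact zero_le_one
  · intro hh
    refine ⟨⟨hh.length_eq, fun o ho => ?_⟩, fun Y _ => hh.count_le Y⟩
    cases o with
    | none => exact Or.inl rfl
    | some ys =>
      exact Or.inr ⟨ys.length, Nat.lt_succ_of_le (hh.length_le ys ho), ys, ⟨rfl, fun Y hY =>
        hh.lt_of_mem Y (mem_flatMap_getD.2 ⟨ys, ho, hY⟩)⟩, rfl⟩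

theorem nodup_sections_replicate {α : Type*} {l : List α} (hl : l.Nodup) (m : ℕ) :
    (List.replicate m l).sections.Nodup :=
  nodup_sections fun l' hl' => by rwa [List.eq_of_mem_replicate hl']

theorem nodup_shapes (r : ℕ) : (shapes r).Nodup := by
  refine List.Nodup.filter _ (nodup_sections_replicate (List.nodup_cons.2 ⟨by simp, ?_⟩) r)
  refine nodup_flatMap_of_key (fun o => (o.getD []).length) List.nodup_range (fun j _ => ?_) ?_
  · exact (nodup_sections_replicate List.nodup_range j).map (Option.some_injective _)
  · intro j _ o ho
    obtain ⟨ys, hys, rfl⟩ := List.mem_map.1 ho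
    exact (mem_sections_replicate.1 hys).1

variable {c₁ c₂ : Code}

theorem mem_states {s : State} :
    s ∈ states c₁ c₂ ↔ s.1 < c₁.1 ∧ GoodSummaries c₁.2.1 c₂.1 c₂.2.1 s.2 := by
  obtain ⟨q, s⟩ := s
  simp only [states, List.mem_flatMap, List.mem_map, List.mem_range, mem_sections_replicate,
    Prod.mk.injEq, mem_shapes, List.mem_cons]
  constructor
  · rintro ⟨q', hq, s', ⟨hlen, hs⟩, rfl, rfl⟩
    have key : ∀ b, some b ∈ s' → b.1 < c₂.1 ∧ b.2.1 < c₂.1 ∧ GoodShape c₂.2.1 b.2.2 := by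
      intro b hb
      rcases hs _ hb with e | ⟨p, hp, p', hp', h, hh, e⟩
      · simp at e
      · rw [Option.some.injEq] at e
        subst e
        exact ⟨hp, hp', hh⟩
    exact ⟨hq, hlen, fun b hb => (key b hb).1, fun b hb => (key b hb).2.1,
      fun b hb => (key b hb).2.2⟩
  · rintro ⟨hq, hs⟩
    refine ⟨q, hq, s, ⟨hs.length_eq, fun o ho => ?_⟩, rfl, rfl⟩
    cases o with
    | none => exact Or.inl rfl
    | some b =>
      exact Or.inr ⟨b.1, hs.fst_lt b ho, b.2.1, hs.snd_lt b ho, b.2.2, hs.shape b ho, rfl⟩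

theorem nodup_states (c₁ c₂ : Code) : (states c₁ c₂).Nodup := by
  refine nodup_flatMap_of_key Prod.fst List.nodup_range (fun q _ => ?_) ?_
  · refine (nodup_sections_replicate (List.nodup_cons.2 ⟨by simp, ?_⟩) _).map
      fun s s' h => by simpa using h
    -- The default is never taken, as all these entries are defined.
    refine nodup_flatMap_of_key (fun o => (o.getD default).1) List.nodup_range (fun p _ => ?_) ?_
    · refine nodup_flatMap_of_key (fun o => (o.getD default).2.1) List.nodup_range
        (fun p' _ => ?_) ?_
      · exact (nodup_shapes _).map fun h h' e => by simpa using e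
      · intro p' _ o ho
        obtain ⟨h, _, rfl⟩ := List.mem_map.1 ho
        rfl
    · intro p _ o ho
      obtain ⟨p', _, ho⟩ := List.mem_flatMap.1 ho
      obtain ⟨h, _, rfl⟩ := List.mem_map.1 ho
      rfl
  · intro q _ s hs
    obtain ⟨s', _, rfl⟩ := List.mem_map.1 hs
    rfl

theorem mem_steps {s : State} {t : ℕ × List (Option WordCode) × State} :
    t ∈ steps c₁ c₂ s ↔ ∃ t' ∈ c₁.2.2.2.2.1, t'.1 = s.1 ∧ ∃ A ∈ boolVectors c₁.2.1,
      (s.2.map fun o => o.isSome) = occurring c₁.2.1 (selected c₁.2.1 A t'.2.2.1) ∧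
      ∃ fam ∈ families c₂.1 c₂.2.1 c₁.2.1 (liftTrans c₂.2.2.2.2.1) (symbolicBlocks c₂.2.1 s.2) A
        (fun X => t'.2.2.1.getD X none),
        t = (t'.2.1, contents c₁.2.1 c₂.2.1 fam, t'.2.2.2, summaries fam) := by
  simp only [steps, List.mem_flatMap, List.mem_filter, decide_eq_true_eq]
  constructor
  · rintro ⟨t', ⟨h₁, h₂⟩, A, hA, ht⟩
    refine ⟨t', h₁, h₂, A, hA, ?_⟩
    by_cases h : (s.2.map fun o => o.isSome) = occurring c₁.2.1 (selected c₁.2.1 A t'.2.2.1)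
    · simp only [h, decide_true, cond_true, List.mem_map] at ht
      obtain ⟨fam, hfam, rfl⟩ := ht
      exact ⟨h, fam, hfam, rfl⟩
    · simp [h] at ht
  · rintro ⟨t', h₁, h₂, A, hA, h, fam, hfam, rfl⟩
    refine ⟨t', ⟨h₁, h₂⟩, A, hA, ?_⟩
    simp only [h, decide_true, cond_true, List.mem_map]
    exact ⟨fam, hfam, rfl⟩

theorem mem_inits {e : State × List (Option (List ℕ))} :
    e ∈ inits c₁ c₂ ↔ ∃ q < c₁.1, ∃ ν, c₁.2.2.2.2.2.1.getD q none = some ν ∧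
      ∃ A ∈ boolVectors c₁.2.1, ∃ fam ∈ families c₂.1 c₂.2.1 c₁.2.1 c₂.2.2.2.2.1 (fun _ => []) A
        (fun X => (ν.getD X none).map fun w => w.map fun o => Sum.inr o),
        e = ((q, summaries fam), contents c₁.2.1 c₂.2.1 fam) := by
  simp only [inits, List.mem_flatMap, List.mem_map, List.mem_range, Option.mem_toList, eq_comm]

theorem mem_states_of_mem_steps (h₁ : WellFormed c₁) (h₂ : WellFormed c₂) {s : State}
    (hs : s ∈ states c₁ c₂) {t : ℕ × List (Option WordCode) × State} (ht : t ∈ steps c₁ c₂ s) :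
    t.2.2 ∈ states c₁ c₂ := by
  obtain ⟨t', ht', _, A, _, _, fam, hfam, rfl⟩ := mem_steps.1 ht
  refine mem_states.2 ⟨h₁.dst_lt t' ht', goodSummaries_summaries (mem_families hfam).1 fun X b hb =>
    good_of_mem_families (goodTrans_liftTrans (goodTrans_of_wellFormed h₂))
      (fun X b hb => goodBlock_symbolicBlocks (mem_states.1 hs).2 hb) hfam hb⟩

theorem mem_states_of_mem_inits (h₂ : WellFormed c₂) {e : State × List (Option (List ℕ))}
    (he : e ∈ inits c₁ c₂) : e.1 ∈ states c₁ c₂ := by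
  obtain ⟨q, hq, ν, _, A, _, fam, hfam, rfl⟩ := mem_inits.1 he
  exact mem_states.2 ⟨hq, goodSummaries_summaries (mem_families hfam).1
    (good_of_mem_valFamilies h₂ hfam)⟩

theorem length_finals_lt {s : State} (hs : s ∈ states c₁ c₂) :
    (finals c₁ c₂ s).length < finalBound c₁ c₂ := by
  refine Nat.lt_succ_of_le ?_
  rw [List.length_flatMap]
  exact List.single_le_sum (by simp) _ (List.mem_map.2 ⟨s, hs, rfl⟩)

theorem mem_multiTrans {S : Type} {S₀ : List S} {K L : ℕ}
    {step : S → List (ℕ × List (Option WordCode) × S)}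
    {t : (ℕ × ℕ × S) × ℕ × List (Option WordCode) × ℕ × ℕ × S}
    (h : t ∈ multiTrans S₀ K L step) : ∃ k < K, ∃ s ∈ S₀, ∃ t' ∈ step s, ∃ l < L,
      t = ((k, 0, s), t'.1, t'.2.1, (0, l, t'.2.2)) := by
  simp only [multiTrans, List.mem_flatMap, List.mem_map, List.mem_range] at h
  obtain ⟨k, hk, s, hs, t', ht', l, hl, rfl⟩ := h
  exact ⟨k, hk, s, hs, t', ht', l, hl, rfl⟩

theorem multiTrans_mem_multiStates (h₁ : WellFormed c₁) (h₂ : WellFormed c₂)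
    {t : (ℕ × ℕ × State) × ℕ × List (Option WordCode) × ℕ × ℕ × State}
    (h : t ∈ multiTrans (states c₁ c₂) (initBound c₁ c₂) (finalBound c₁ c₂)
      fun s => steps c₁ c₂ s) :
    t.1 ∈ multiStates (states c₁ c₂) (initBound c₁ c₂) (finalBound c₁ c₂) ∧
      t.2.2.2 ∈ multiStates (states c₁ c₂) (initBound c₁ c₂) (finalBound c₁ c₂) := by
  obtain ⟨k, hk, s, hs, t', ht', l, hl, rfl⟩ := mem_multiTrans h
  exact ⟨mem_multiStates.2 ⟨hk, Nat.succ_pos _, hs⟩,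
    mem_multiStates.2 ⟨Nat.succ_pos _, hl, mem_states_of_mem_steps h₁ h₂ hs ht'⟩⟩

theorem codeSem_composeCode (h₁ : WellFormed c₁) (h₂ : WellFormed c₂) (w : List ℕ) :
    codeSem (composeCode c₁ c₂) w = (codeSem c₁ w).bind (codeSem c₂) := by
  rw [composeCode, codeSem_numberedCode (nodup_multiStates (nodup_states c₁ c₂))
    (fun t ht => multiTrans_mem_multiStates h₁ h₂ ht), ← lsum_inits h₁ h₂]
  exact listSem_multi (nodup_states c₁ c₂)
    (fun s hs t ht => mem_states_of_mem_steps h₁ h₂ hs ht) (fun s hs => length_finals_lt hs)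
    (fun e he => mem_states_of_mem_inits h₂ he) (Nat.lt_succ_self _) w

end States

/-! ### The composition is copyless -/

section Copyless

/-- Applied twice, it turns a sum over register numbers into a sum over the triples `X`, `Y`, `i`.
-/
theorem sum_range_mul_divMod {M : Type*} [AddCommMonoid M] (a b : ℕ) (f : ℕ → ℕ → M) :
    ∑ z ∈ Finset.range (a * b), f (z / b) (z % b) =
      ∑ x ∈ Finset.range a, ∑ y ∈ Finset.range b, f x y := by
  induction a with
  | zero => simp
  | succ a ih =>
    rw [Nat.succ_mul, Finset.sum_range_add, ih, Finset.sum_range_succ]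
    congr 1
    refine Finset.sum_congr rfl fun y hy => ?_
    have hy := Finset.mem_range.1 hy
    rw [mul_comm a b, Nat.mul_add_div (by omega), Nat.mul_add_mod, Nat.div_eq_of_lt hy,
      Nat.mod_eq_of_lt hy, add_zero]

variable {Γ : Type} [BEq Γ] [LawfulBEq Γ]

theorem sum_count_segs (u : List (ℕ ⊕ Γ)) (g : Γ) :
    ((segs u).map fun l => l.count g).sum = u.count (Sum.inr g) := by
  induction u with
  | nil => simp [segs]
  | cons x u ih =>
    cases x with
    | inl Y => simp [segs_inl, ih]
    | inr a =>
      obtain ⟨b, t, h⟩ := List.exists_cons_of_ne_nil (segs_ne_nil u)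
      rw [h] at ih
      rw [segs_inr, h]
      by_cases hg : a = g
      · simp [hg] at ih ⊢
        omega
      · simpa [hg] using ih

theorem sum_range_getD_le {α : Type*} (l : List α) (d : α) (f : α → ℕ) (hd : f d = 0) (k : ℕ) :
    ∑ i ∈ Finset.range k, f (l.getD i d) ≤ (l.map f).sum := by
  induction l generalizing k with
  | nil => simp [hd]
  | cons a l ih =>
    cases k with
    | zero => simp
    | succ k =>
      rw [Finset.sum_range_succ', List.map_cons, List.sum_cons, add_comm]
      simpa using ih k

theorem flat_contents (m r : ℕ) (fam : List (Option (Block (ℕ ⊕ ℕ)))) :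
    flat (contents m r fam : Asg ℕ) = (List.range (m * r * (r + 1))).flatMap (content r fam) := by
  rw [flat, contents, List.flatMap_map]
  rfl

theorem sum_map_range (n : ℕ) (f : ℕ → ℕ) :
    ((List.range n).map f).sum = ∑ i ∈ Finset.range n, f i := by
  induction n with
  | zero => rfl
  | succ n ih => rw [List.range_succ, List.map_append, List.sum_append, ih, Finset.sum_range_succ]; simp

/-- The factors of a string share out its letters among distinct registers, so the contents
belonging to `X` contain no more than the strings of its block. -/
theorem count_contents_le {m n r : ℕ} {fam : List (Option (Block (ℕ ⊕ ℕ)))}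
    (hfam : ∀ X b, fam.getD X none = some b → GoodBlock n r b) (g : ℕ ⊕ ℕ) :
    (flat (contents m r fam : Asg ℕ)).count g ≤ ∑ X ∈ Finset.range m,
      ((fam.getD X none).elim 0 fun b => (flat b.2.2).count (Sum.inr g)) := by
  rw [flat_contents, List.count_flatMap, sum_map_range]
  have e : ∀ z, (List.count g ∘ content r fam) z =
      (fun X Y i => ((((fam.getD X none).bind fun b => b.2.2.getD Y none).map
        fun u => (segs u).getD i []).getD []).count g) (z / (r + 1) / r) (z / (r + 1) % r)
          (z % (r + 1)) := fun z => rfl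
  simp only [e]
  rw [sum_range_mul_divMod (m * r) (r + 1) fun z i =>
    (fun X Y i => ((((fam.getD X none).bind fun b => b.2.2.getD Y none).map
        fun u => (segs u).getD i []).getD []).count g) (z / r) (z % r) i,
    sum_range_mul_divMod m r fun X Y => ∑ i ∈ Finset.range (r + 1),
    (fun X Y i => ((((fam.getD X none).bind fun b => b.2.2.getD Y none).map
        fun u => (segs u).getD i []).getD []).count g) X Y i]
  refine Finset.sum_le_sum fun X _ => ?_
  dsimp only
  cases hb : fam.getD X none with
  | none => simp only [Option.bind_none, Option.map_none, Option.getD_none, List.count_nil,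
      Finset.sum_const_zero, Option.elim_none, le_refl]
  | some b =>
    simp only [Option.bind_some, Option.elim_some]
    rw [← sum_count_getD, (hfam X b hb).good.length_eq]
    refine Finset.sum_le_sum fun Y _ => ?_
    cases hu : b.2.2.getD Y none with
    | none => simp only [Option.map_none, Option.getD_none, List.count_nil,
        Finset.sum_const_zero, le_refl]
    | some u =>
      simp only [Option.map_some, Option.getD_some]
      rw [← sum_count_segs]
      exact sum_range_getD_le (segs u) [] (fun l => l.count g) (by simp) (r + 1)

variable {m n r : ℕ} {s : List (Option Summary)} {tr : List (Trans ℕ)}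

/-- Register `z` comes only from the symbolic block of the one register of the first transducer that
owns it, once for each time this register is read. Lifted transitions do not mention it. -/
theorem count_tokenRuns_le (hs : GoodSummaries m n r s) (htr : GoodTrans n r tr)
    (z : ℕ) {u : List (ℕ ⊕ ℕ)} {c d : ℕ × Asg (ℕ ⊕ ℕ)}
    (hd : d ∈ tokenRuns (liftTrans tr) (symbolicBlocks r s) u [c]) :
    (flat d.2).count (Sum.inr (Sum.inl z)) ≤
      (flat c.2).count (Sum.inr (Sum.inl z)) + u.count (Sum.inl (z / (r + 1) / r)) := by
  induction u generalizing c with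
  | nil =>
    simp only [tokenRuns, List.foldl_nil, List.mem_singleton] at hd
    simp [hd]
  | cons x u ih =>
    rw [tokenRuns_cons, List.mem_flatMap] at hd
    obtain ⟨e, he, hd⟩ := hd
    refine (ih hd).trans ?_
    have hgood := good_of_mem_moves (goodTrans_liftTrans htr)
      (fun X b hb => goodBlock_symbolicBlocks hs hb) he
    have h₁ := count_flat_compAsg_le c.2 e.2 hgood.2.count_le (Sum.inr (Sum.inl z))
    simp only [Sum.isRight_inr, if_true] at h₁
    have h₂ : (flat e.2).count (Sum.inr (Sum.inl z)) ≤
        [x].count (Sum.inl (z / (r + 1) / r)) := by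
      cases x with
      | inl X =>
        simp only [moves, Sum.elim_inl, List.mem_map, List.mem_filter] at he
        obtain ⟨b, ⟨hb, _⟩, rfl⟩ := he
        refine (count_symbolicBlocks_le hs hb z).trans ?_
        by_cases hX : z / (r + 1) / r = X <;> simp [hX]
      | inr o =>
        simp only [moves, Sum.elim_inr, List.mem_map, List.mem_filter] at he
        obtain ⟨t, ⟨ht, _⟩, rfl⟩ := he
        rw [List.count_eq_zero.2]
        · exact Nat.zero_le _
        · intro hz
          exact letters_liftTrans (Q := fun g => ∀ z, g ≠ Sum.inl z) (by simp) t ht _ hz z rfl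
    rw [← List.singleton_append, List.count_append]
    change (flat (compAsg c.2 e.2)).count _ + _ ≤ _
    omega

/-- Copylessness is inherited from the first transducer: the owner of `z` occurs at most once in all
selected strings together. -/
theorem count_contents_families_le (hs : GoodSummaries m n r s) (htr : GoodTrans n r tr)
    {A : List Bool} {σ : Asg ℕ} (hσ : GoodAsg m σ) {fam : List (Option (Block (ℕ ⊕ ℕ)))}
    (hfam : fam ∈ families n r m (liftTrans tr) (symbolicBlocks r s) A fun X => σ.getD X none)
    (z : ℕ) : (flat (contents m r fam : Asg ℕ)).count (Sum.inl z) ≤ 1 := by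
  refine (count_contents_le (fun X b hb => good_of_mem_families (goodTrans_liftTrans htr)
      (fun X b hb => goodBlock_symbolicBlocks hs hb) hfam hb) _).trans ?_
  refine le_trans ?_ (count_selectedWord_le hσ A (z / (r + 1) / r))
  rw [selectedWord, List.count_flatMap, sum_map_range]
  refine Finset.sum_le_sum fun X _ => ?_
  cases hb : fam.getD X none with
  | none => simp
  | some b =>
    obtain ⟨hA, u, hu, hb⟩ := (mem_families hfam).2 X b hb
    have := count_tokenRuns_le hs htr z (mem_blocks.1 hb).2
    rw [Option.elim_some, Function.comp_apply, hA, hu, cond_true, Option.getD_some]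
    refine this.trans (le_of_eq ?_)
    rw [List.count_eq_zero.2 (by simp [flat_idAsg]), zero_add]

theorem count_tokenOutputs_le {c₂ : Code} (h₂ : WellFormed c₂)
    (hs : GoodSummaries m c₂.1 c₂.2.1 s) {u : List (ℕ ⊕ ℕ)} {y : WordCode}
    (hy : y ∈ tokenOutputs c₂ (liftTrans c₂.2.2.2.2.1) Sum.inr (symbolicBlocks c₂.2.1 s) u)
    (z : ℕ) : y.count (Sum.inl z) ≤ u.count (Sum.inl (z / (c₂.2.1 + 1) / c₂.2.1)) := by
  simp only [tokenOutputs, List.mem_flatMap, List.mem_map, Option.mem_toList] at hy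
  obtain ⟨p, _, ν, hν, d, hd, v, hv, y', hy', rfl⟩ := hy
  rw [count_lettersOf]
  have h₁ := count_tokenRuns_le hs (goodTrans_of_wellFormed h₂) z hd
  -- The output string is viewed as an assignment with a single entry, so the bound for compositions
  -- applies to it.
  have h₃ := count_flat_compAsg_le d.2 [some (v.map fun x =>
    Sum.elim (fun Y => Sum.inl Y) (fun g => Sum.inr (Sum.inr g)) x)] ?_ (Sum.inr (Sum.inl z))
  · have e₁ : compAsg d.2 [some (v.map fun x =>
        Sum.elim (fun Y => Sum.inl Y) (fun g => Sum.inr (Sum.inr g)) x)] = [some y'] := by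
      simp only [compAsg, List.map_cons, List.map_nil, Option.bind_some, hy']
    have e₂ : ∀ w : List (ℕ ⊕ (ℕ ⊕ ℕ)), flat [some w] = w := by simp [flat]
    rw [e₁, e₂, e₂, List.count_eq_zero.2 (_ : Sum.inr (Sum.inl z) ∉ v.map _)] at h₃
    · have h₀ : (flat (ν.map fun o => o.map fun w => w.map fun a =>
          (Sum.inr (Sum.inr a) : ℕ ⊕ (ℕ ⊕ ℕ)))).count (Sum.inr (Sum.inl z)) = 0 := by
        refine List.count_eq_zero.2 fun hz => ?_
        obtain ⟨w, hw, hz⟩ := mem_flat.1 hz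
        obtain ⟨o, ho, e⟩ := List.mem_map.1 hw
        obtain ⟨w', rfl, rfl⟩ := Option.map_eq_some_iff.1 e
        simp at hz
      simp only [h₀, ite_self, add_zero, zero_add] at h₁ h₃
      exact h₃.trans h₁
    · intro hz
      obtain ⟨x, _, e⟩ := List.mem_map.1 hz
      cases x <;> simp at e
  · intro Y
    have e₂ : ∀ w : List (ℕ ⊕ (ℕ ⊕ ℕ)), flat [some w] = w := by simp [flat]
    rw [e₂]
    refine le_of_eq_of_le ?_ (h₂.final_count v (getD_mem_of_eq_some hv) Y)
    exact List.count_map_of_injective _ _ lift_injective (Sum.inl Y)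

end Copyless

/-! ### The code of the composition is well-formed -/

section Wellformedness

variable {c₁ c₂ : Code}

theorem idxOf_lt_length {S : Type*} [DecidableEq S] {l : List S} {s : S} (h : s ∈ l) :
    l.idxOf s < l.length := List.idxOf_lt_length_of_mem h

/-- One predicate on the disjoint union treats the range of the registers of the composition and the
output alphabet together. -/
theorem letters_symbolic (h₂ : WellFormed c₂) {s : State} (hs : s ∈ states c₁ c₂) :
    (∀ t ∈ liftTrans c₂.2.2.2.2.1, ∀ g, Sum.inr g ∈ flat t.2.2.1 →
      Sum.elim (fun z => z < c₁.2.1 * c₂.2.1 * (c₂.2.1 + 1)) (fun o => o ∈ c₂.2.2.2.1) g) ∧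
    ∀ X, ∀ b ∈ symbolicBlocks c₂.2.1 s.2 X, ∀ g, Sum.inr g ∈ flat b.2.2 →
      Sum.elim (fun z => z < c₁.2.1 * c₂.2.1 * (c₂.2.1 + 1)) (fun o => o ∈ c₂.2.2.2.1) g := by
  refine ⟨letters_liftTrans fun t ht o ho => h₂.asg_over t ht o ho, fun X b hb g hg => ?_⟩
  obtain ⟨Y, hY, i, hi, hX, rfl⟩ := letters_symbolicBlocks (mem_states.1 hs).2 hb hg
  exact regIndex_lt hX hY hi

theorem goodAsg_of_mem_steps (h₁ : WellFormed c₁) (h₂ : WellFormed c₂) {s : State}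
    (hs : s ∈ states c₁ c₂) {t : ℕ × List (Option WordCode) × State} (ht : t ∈ steps c₁ c₂ s) :
    GoodAsg (c₁.2.1 * c₂.2.1 * (c₂.2.1 + 1)) t.2.1 ∧
      ∀ o, Sum.inr o ∈ flat t.2.1 → o ∈ c₂.2.2.2.1 := by
  obtain ⟨t', ht', _, A, _, _, fam, hfam, rfl⟩ := mem_steps.1 ht
  have key : ∀ g ∈ flat (contents c₁.2.1 c₂.2.1 fam : Asg ℕ),
      Sum.elim (fun z => z < c₁.2.1 * c₂.2.1 * (c₂.2.1 + 1)) (fun o => o ∈ c₂.2.2.2.1) g := by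
    intro g hg
    rw [flat_contents, List.mem_flatMap] at hg
    obtain ⟨z, _, hg⟩ := hg
    obtain ⟨X, b, hb, hg⟩ := mem_content hg
    exact letters_of_mem_families (letters_symbolic h₂ hs).1 (letters_symbolic h₂ hs).2 hfam hb g hg
  exact ⟨⟨by simp [contents], fun z hz => key _ hz, count_contents_families_le (mem_states.1 hs).2
    (goodTrans_of_wellFormed h₂) (h₁.asg_good t' ht') hfam⟩, fun o ho => key _ ho⟩

theorem mem_inits_of_mem_composeCode {v : List (Option (List ℕ))}
    (hv : some v ∈ (composeCode c₁ c₂).2.2.2.2.2.1) : ∃ e ∈ inits c₁ c₂, v = e.2 := by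
  obtain ⟨s, _, hs⟩ := List.mem_map.1 hv
  obtain ⟨e, he, h⟩ := Option.bind_eq_some_iff.1 hs
  refine ⟨e, List.mem_of_getElem? he, ?_⟩
  cases hd : decide (e.1 = s.2.2) with
  | false => simp [hd] at h
  | true =>
    rw [hd, cond_true, Option.some.injEq] at h
    exact h.symm

theorem mem_finals_of_mem_composeCode {y : WordCode}
    (hy : some y ∈ (composeCode c₁ c₂).2.2.2.2.2.2) : ∃ s ∈ states c₁ c₂, y ∈ finals c₁ c₂ s := by
  obtain ⟨⟨k, l, s⟩, hs, hy⟩ := List.mem_map.1 hy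
  exact ⟨s, (mem_multiStates.1 hs).2.2, List.mem_of_getElem? hy⟩

theorem wellFormed_composeCode (h₁ : WellFormed c₁) (h₂ : WellFormed c₂) :
    WellFormed (composeCode c₁ c₂) := by
  have hT : ∀ t ∈ (composeCode c₁ c₂).2.2.2.2.1, ∃ s ∈ states c₁ c₂, ∃ t' ∈ steps c₁ c₂ s,
      t.1 < (composeCode c₁ c₂).1 ∧ t.2.2.2 < (composeCode c₁ c₂).1 ∧ t.2.1 = t'.1 ∧
        t.2.2.1 = t'.2.1 := by
    intro t ht
    obtain ⟨t'', ht'', rfl⟩ := List.mem_map.1 ht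
    have := multiTrans_mem_multiStates h₁ h₂ ht''
    obtain ⟨k, hk, s, hs, t', ht', l, hl, rfl⟩ := mem_multiTrans ht''
    exact ⟨s, hs, t', ht', idxOf_lt_length this.1,
      idxOf_lt_length this.2, rfl, rfl⟩
  have hF : ∀ y, some y ∈ (composeCode c₁ c₂).2.2.2.2.2.2 → ∃ s ∈ states c₁ c₂, ∃ u,
      some u ∈ c₁.2.2.2.2.2.2 ∧ y ∈ tokenOutputs c₂ (liftTrans c₂.2.2.2.2.1) Sum.inr
        (symbolicBlocks c₂.2.1 s.2) u := by
    intro y hy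
    obtain ⟨s, hs, hy⟩ := mem_finals_of_mem_composeCode hy
    refine ⟨s, hs, ?_⟩
    rw [finals_eq, List.mem_flatMap] at hy
    obtain ⟨u, hu, hy⟩ := hy
    rw [Option.mem_toList] at hu
    refine ⟨u, getD_mem_of_eq_some hu, ?_⟩
    revert hy
    cases decide ((s.2.map fun o => o.isSome) = occurring c₁.2.1 u) with
    | false => simp
    | true => exact id
  have hFl : ∀ y, some y ∈ (composeCode c₁ c₂).2.2.2.2.2.2 → ∀ g ∈ y,
      Sum.elim (fun z => z < c₁.2.1 * c₂.2.1 * (c₂.2.1 + 1)) (fun o => o ∈ c₂.2.2.2.1) g := by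
    intro y hy
    obtain ⟨s, hs, u, _, hy⟩ := hF y hy
    exact letters_of_mem_tokenOutputs (e := Sum.inr)
      (Q := Sum.elim (fun z => z < c₁.2.1 * c₂.2.1 * (c₂.2.1 + 1)) (fun o => o ∈ c₂.2.2.2.1))
      (letters_symbolic h₂ hs).1 (letters_symbolic h₂ hs).2
      (fun v hv w hw o ho => h₂.init_over v hv w hw o ho) (fun u hu o ho => h₂.final_over u hu o ho)
      hy
  constructor
  · intro t ht
    obtain ⟨s, hs, t', ht', h, _⟩ := hT t ht
    exact h
  · intro t ht
    obtain ⟨s, hs, t', ht', _, h, _⟩ := hT t ht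
    exact h
  · intro t ht
    obtain ⟨s, hs, t', ht', _, _, h, _⟩ := hT t ht
    rw [h]
    obtain ⟨t'', ht'', _, A, _, _, fam, hfam, rfl⟩ := mem_steps.1 ht'
    exact h₁.letter_mem t'' ht''
  · intro t ht
    obtain ⟨s, hs, t', ht', _, _, _, h⟩ := hT t ht
    rw [h]
    exact (goodAsg_of_mem_steps h₁ h₂ hs ht').1
  · intro t ht
    obtain ⟨s, hs, t', ht', _, _, _, h⟩ := hT t ht
    rw [h]
    exact (goodAsg_of_mem_steps h₁ h₂ hs ht').2
  · exact List.length_map ..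
  · intro v hv
    obtain ⟨e, he, rfl⟩ := mem_inits_of_mem_composeCode hv
    obtain ⟨q, _, ν, _, A, _, fam, _, rfl⟩ := mem_inits.1 he
    simp [contents, composeCode, numberedCode]
  · intro v hv w hw o ho
    obtain ⟨e, he, rfl⟩ := mem_inits_of_mem_composeCode hv
    obtain ⟨q, _, ν, _, A, _, fam, hfam, rfl⟩ := mem_inits.1 he
    obtain ⟨z, _, e⟩ := List.mem_map.1 hw
    rw [Option.some.injEq] at e
    subst e
    obtain ⟨X, b, hb, hg⟩ := mem_content ho
    exact letters_of_mem_families (Q := fun o => o ∈ c₂.2.2.2.1)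
      (fun t ht o ho => h₂.asg_over t ht o ho) (by simp) hfam hb o hg
  · exact List.length_map ..
  · exact fun y hy z hz => hFl y hy _ hz
  · intro y hy z
    obtain ⟨s, hs, u, hu, hy⟩ := hF y hy
    exact (count_tokenOutputs_le h₂ (mem_states.1 hs).2 hy z).trans (h₁.final_count u hu _)
  · exact fun y hy o ho => hFl y hy _ ho

end Wellformedness

/-! ### Codes of transducers -/

section Codes

variable {r : ℕ}

theorem wordCode_injective : Function.Injective (Sum.map Fin.val id : Fin r ⊕ ℕ → ℕ ⊕ ℕ) :=
  Fin.val_injective.sumMap Function.injective_id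

theorem count_wordCode (u : RegWord r) (X : Fin r) :
    (wordCode u).count (Sum.inl X.val) = u.count (Sum.inl X) :=
  List.count_map_of_injective u _ wordCode_injective (Sum.inl X)

theorem inl_mem_wordCode {u : RegWord r} {Y : ℕ} (h : Sum.inl Y ∈ wordCode u) : Y < r := by
  obtain ⟨x, _, hx⟩ := List.mem_map.1 h
  cases x with
  | inl X => simp only [Sum.map_inl, Sum.inl.injEq] at hx; omega
  | inr o => simp at hx

theorem inr_mem_wordCode {u : RegWord r} {o : ℕ} : Sum.inr o ∈ wordCode u ↔ Sum.inr o ∈ u :=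
  List.mem_map_of_injective (a := Sum.inr o) (f := (Sum.map Fin.val id : Fin r ⊕ ℕ → ℕ ⊕ ℕ))
    wordCode_injective

theorem count_wordCode_le_one {u : RegWord r} :
    (∀ Y, (wordCode u).count (Sum.inl Y) ≤ 1) ↔ ∀ X : Fin r, u.count (Sum.inl X) ≤ 1 := by
  refine ⟨fun h X => count_wordCode u X ▸ h X, fun h Y => ?_⟩
  by_cases hY : Sum.inl Y ∈ wordCode u
  · exact (count_wordCode u ⟨Y, inl_mem_wordCode hY⟩).trans_le (h _)
  · rw [List.count_eq_zero.2 hY]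
    exact Nat.zero_le 1

theorem mem_flat_ofFn {σ : Assignment r} {x : ℕ ⊕ ℕ} :
    x ∈ flat (List.ofFn fun X => (σ X).map wordCode) ↔ ∃ X u, σ X = some u ∧ x ∈ wordCode u := by
  simp only [mem_flat, List.mem_ofFn, Option.map_eq_some_iff]
  constructor
  · rintro ⟨_, ⟨X, u, h, rfl⟩, hx⟩
    exact ⟨X, u, h, hx⟩
  · rintro ⟨X, u, h, hx⟩
    exact ⟨_, ⟨X, u, h, rfl⟩, hx⟩

theorem over_iff {σ : Assignment r} {A : Finset ℕ} :
    (∀ o, Sum.inr o ∈ flat (List.ofFn fun X => (σ X).map wordCode) → o ∈ A) ↔ σ.Over A := by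
  simp only [mem_flat_ofFn, inr_mem_wordCode]
  exact ⟨fun h X u hu o ho => h o ⟨X, u, hu, ho⟩, fun h o ⟨X, u, hu, ho⟩ => h X u hu o ho⟩

theorem goodAsg_iff {σ : Assignment r} :
    GoodAsg r (List.ofFn fun X => (σ X).map wordCode) ↔ σ.Copyless := by
  have key : ∀ X : Fin r, (flat (List.ofFn fun X => (σ X).map wordCode)).count (Sum.inl X.val) =
      ∑ Y : Fin r, ((σ Y).getD []).count (Sum.inl X) := by
    intro X
    rw [flat, List.count_flatMap, List.map_ofFn, List.sum_ofFn]
    refine Finset.sum_congr rfl fun Y _ => ?_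
    simp only [Function.comp_apply]
    cases σ Y with
    | none => simp
    | some u => exact count_wordCode u X
  have hlt : ∀ Y, Sum.inl Y ∈ flat (List.ofFn fun X => (σ X).map wordCode) → Y < r := by
    intro Y hY
    obtain ⟨X, u, _, hY⟩ := mem_flat_ofFn.1 hY
    exact inl_mem_wordCode hY
  refine ⟨fun h X => key X ▸ h.count_le X, fun h => ⟨List.length_ofFn, hlt, fun Y => ?_⟩⟩
  by_cases hY : Sum.inl Y ∈ flat (List.ofFn fun X => (σ X).map wordCode)
  · exact (key ⟨Y, hlt Y hY⟩).trans_le (h _)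
  · rw [List.count_eq_zero.2 hY]
    exact Nat.zero_le 1

theorem wellFormed_code (T : NSST) : WellFormed T.code := by
  constructor
  · simp [code]
  · simp [code]
  · simpa [code] using T.trans_letter_mem
  · intro t ht
    obtain ⟨t, ht', rfl⟩ := List.mem_map.1 ht
    exact goodAsg_iff.2 (T.trans_asg_copyless t ht')
  · intro t ht o ho
    obtain ⟨t, ht', rfl⟩ := List.mem_map.1 ht
    exact (Finset.mem_sort _).2 (over_iff.2 (T.trans_asg_over t ht') o ho)
  · exact List.length_ofFn
  · intro v hv
    obtain ⟨q, hq⟩ := List.mem_ofFn.1 hv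
    obtain ⟨ν, _, rfl⟩ := Option.map_eq_some_iff.1 hq
    exact List.length_ofFn
  · intro v hv w hw o ho
    obtain ⟨q, hq⟩ := List.mem_ofFn.1 hv
    obtain ⟨ν, hν, rfl⟩ := Option.map_eq_some_iff.1 hq
    obtain ⟨X, hX⟩ := List.mem_ofFn.1 hw
    exact (Finset.mem_sort _).2 (T.init_over q ν hν X w hX o ho)
  · exact List.length_ofFn
  · intro u hu Y hY
    obtain ⟨q, hq⟩ := List.mem_ofFn.1 hu
    obtain ⟨u, _, rfl⟩ := Option.map_eq_some_iff.1 hq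
    exact inl_mem_wordCode hY
  · intro u hu
    obtain ⟨q, hq⟩ := List.mem_ofFn.1 hu
    obtain ⟨u, hu', rfl⟩ := Option.map_eq_some_iff.1 hq
    exact count_wordCode_le_one.2 (T.final_copyless q u hu')
  · intro u hu o ho
    obtain ⟨q, hq⟩ := List.mem_ofFn.1 hu
    obtain ⟨u, hu', rfl⟩ := Option.map_eq_some_iff.1 hq
    exact (Finset.mem_sort _).2 (T.final_over q u hu' o (inr_mem_wordCode.1 ho))

theorem exists_wordCode_eq {u : WordCode} (h : ∀ Y, Sum.inl Y ∈ u → Y < r) :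
    ∃ v : RegWord r, wordCode v = u := by
  have : u ∈ Set.range (List.map (Sum.map Fin.val id : Fin r ⊕ ℕ → ℕ ⊕ ℕ)) := by
    rw [Set.range_list_map]
    rintro (Y | o) hx
    · exact ⟨Sum.inl ⟨Y, h Y hx⟩, rfl⟩
    · exact ⟨Sum.inr o, rfl⟩
  exact this

theorem exists_ofFn_eq {α β : Type*} {n : ℕ} {f : α → β} {l : List β} (hl : l.length = n)
    (h : ∀ b ∈ l, ∃ a, f a = b) : ∃ g : Fin n → α, (List.ofFn fun i => f (g i)) = l := by
  subst hl
  choose g hg using fun i : Fin l.length => h l[i] (List.getElem_mem i.2)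
  exact ⟨g, by simp only [hg]; exact List.ofFn_getElem⟩

/-- Converse to `wellFormed_code`. The alphabets have to be sorted lists of finite sets, since codes
of transducers have this form. -/
theorem exists_code_eq {c : Code} (h : WellFormed c) {A B : Finset ℕ} (hA : c.2.2.1 = A.sort)
    (hB : c.2.2.2.1 = B.sort) : ∃ T : NSST, T.code = c ∧ T.inAlph = A ∧ T.outAlph = B := by
  obtain ⟨n, r, _, _, tr, ini, fin⟩ := c
  obtain ⟨src_lt, dst_lt, letter_mem, asg_good, asg_over, init_length, init_table_length, init_over,
    final_length, final_lt, final_count, final_over⟩ := h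
  dsimp only at *
  subst hA hB
  simp only [Finset.mem_sort] at letter_mem asg_over init_over final_over
  have hword : ∀ o : Option WordCode, (∀ u, o = some u → ∀ Y, Sum.inl Y ∈ u → Y < r) →
      ∃ v : Option (RegWord r), v.map wordCode = o := by
    rintro (_ | u) hu
    · exact ⟨none, rfl⟩
    · obtain ⟨v, rfl⟩ := exists_wordCode_eq (hu u rfl)
      exact ⟨some v, rfl⟩
  obtain ⟨trans, rfl⟩ : ∃ trans : List (Transition n r), (trans.map fun t =>
      (t.src.val, t.letter, List.ofFn fun X => (t.asg X).map wordCode, t.dst.val)) = tr := by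
    have : tr ∈ Set.range (List.map fun t : Transition n r =>
      (t.src.val, t.letter, List.ofFn fun X => (t.asg X).map wordCode, t.dst.val)) := by
      rw [Set.range_list_map]
      rintro ⟨p, a, σ, q⟩ ht
      obtain ⟨τ, rfl⟩ := exists_ofFn_eq (asg_good _ ht).length_eq fun o ho => hword o fun u hu Y hY =>
        (asg_good _ ht).lt_of_mem Y (mem_flat.2 ⟨u, hu ▸ ho, hY⟩)
      exact ⟨⟨⟨p, src_lt _ ht⟩, a, τ, ⟨q, dst_lt _ ht⟩⟩, rfl⟩
    exact this
  obtain ⟨init, rfl⟩ : ∃ init : Fin n → Option (RegVal r),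
      (List.ofFn fun q => (init q).map fun ν => List.ofFn ν) = ini := by
    refine exists_ofFn_eq (f := fun o : Option (RegVal r) => o.map fun ν => List.ofFn ν) init_length ?_
    rintro (_ | v) hv
    · exact ⟨none, rfl⟩
    · obtain ⟨ν, rfl⟩ := exists_ofFn_eq (f := id) (init_table_length v hv) fun b _ => ⟨b, rfl⟩
      exact ⟨some ν, rfl⟩
  obtain ⟨final, rfl⟩ : ∃ final : Fin n → Option (RegWord r),
      (List.ofFn fun q => (final q).map wordCode) = fin :=
    exists_ofFn_eq final_length fun o ho => hword o fun u hu => final_lt u (hu ▸ ho)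
  have hfin : ∀ q u, final q = some u → some (wordCode u) ∈
      List.ofFn fun q => (final q).map wordCode :=
    fun q u hu => List.mem_ofFn.2 ⟨q, by rw [hu, Option.map_some]⟩
  refine ⟨⟨n, r, A, B, trans, init, final, fun t ht => letter_mem _ (List.mem_map_of_mem ht),
    fun t ht => over_iff.1 (asg_over _ (List.mem_map_of_mem ht)),
    fun t ht => goodAsg_iff.1 (asg_good _ (List.mem_map_of_mem ht)),
    fun q ν hν X u hu => init_over (List.ofFn ν) (List.mem_ofFn.2 ⟨q, by rw [hν, Option.map_some]⟩)
      u (List.mem_ofFn.2 ⟨X, hu⟩),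
    fun q u hu o ho => final_over _ (hfin q u hu) o (inr_mem_wordCode.2 ho),
    fun q u hu => count_wordCode_le_one.1 (final_count _ (hfin q u hu))⟩, rfl, rfl, rfl⟩

end Codes

/-! ### Numbers of runs -/

section Lengths

theorem sum_map_le {α : Type*} {l : List α} {f : α → ℕ} {k B : ℕ} (hl : l.length ≤ k)
    (h : ∀ a ∈ l, f a ≤ B) : (l.map f).sum ≤ k * B := by
  refine (List.sum_le_card_nsmul _ B ?_).trans ?_
  · simpa using h
  · rw [List.length_map, smul_eq_mul]
    exact Nat.mul_le_mul_right B hl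

theorem length_flatMap_le {α β : Type*} {l : List α} {f : α → List β} {k B : ℕ}
    (hl : l.length ≤ k) (h : ∀ a ∈ l, (f a).length ≤ B) : (l.flatMap f).length ≤ k * B := by
  rw [List.length_flatMap]
  exact sum_map_le hl h

theorem length_toList_flatMap_le {α β : Type*} {o : Option α} {f : α → List β} {B : ℕ}
    (h : ∀ a, o = some a → (f a).length ≤ B) : (o.toList.flatMap f).length ≤ B := by
  cases o with
  | none => simp
  | some a => simpa using h a rfl

theorem length_sections_le {α : Type*} {L : List (List α)} {B : ℕ} (h : ∀ l ∈ L, l.length ≤ B) :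
    L.sections.length ≤ B ^ L.length := by
  induction L with
  | nil => simp [List.sections]
  | cons l L ih =>
    rw [List.sections, List.length_cons, pow_succ]
    refine length_flatMap_le (ih fun l hl => h l (List.mem_cons_of_mem _ hl)) fun s _ => ?_
    rw [List.length_map]
    exact h l (List.mem_cons_self ..)

theorem length_boolVectors_le {r m : ℕ} (h : r ≤ m) : (boolVectors r).length ≤ 2 ^ m := by
  refine (length_sections_le (B := 2) fun l hl => ?_).trans ?_
  · rw [List.eq_of_mem_replicate hl]
    exact le_rfl
  · rw [List.length_replicate]
    exact Nat.pow_le_pow_right two_pos h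

variable {Γ : Type} {tr : List (Trans Γ)} {J : ℕ → List (Block Γ)} {m n r : ℕ}

theorem length_moves_le (htr : tr.length ≤ m) (hJ : ∀ X, (J X).length ≤ m) (x : ℕ ⊕ ℕ) (p : ℕ) :
    (moves tr J x p).length ≤ m := by
  cases x with
  | inl X =>
    rw [moves, Sum.elim_inl, List.length_map]
    exact (List.length_filter_le ..).trans (hJ X)
  | inr o =>
    rw [moves, Sum.elim_inr, List.length_map]
    exact (List.length_filter_le ..).trans htr

theorem length_tokenRuns_le (htr : tr.length ≤ m) (hJ : ∀ X, (J X).length ≤ m)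
    (u : List (ℕ ⊕ ℕ)) (c : ℕ × Asg Γ) : (tokenRuns tr J u [c]).length ≤ m ^ u.length := by
  induction u generalizing c with
  | nil => exact le_rfl
  | cons x u ih =>
    rw [tokenRuns_cons, List.length_cons, pow_succ']
    exact length_flatMap_le (length_moves_le htr hJ x c.1) fun d _ => ih _

/-- A block is given by one of at most m first states and one of at most m moves for each of at most
m tokens. The summand 1 covers the option `none`. -/
theorem length_families_le {k : ℕ} {A : List Bool} {σ : ℕ → Option (List (ℕ ⊕ ℕ))} (hm : 1 ≤ m)
    (htr : tr.length ≤ m) (hJ : ∀ X, (J X).length ≤ m) (hn : n ≤ m) (hk : k ≤ m)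
    (hσ : ∀ X u, σ X = some u → u.length ≤ m) :
    (families n r k tr J A σ).length ≤ (m * m ^ m + 1) ^ m := by
  refine (length_sections_le (B := m * m ^ m + 1) fun l hl => ?_).trans ?_
  · obtain ⟨X, _, rfl⟩ := List.mem_map.1 hl
    cases A.getD X false with
    | false => simp
    | true =>
      rw [cond_true, List.length_map]
      cases hu : σ X with
      | none => simp
      | some u =>
        refine (length_flatMap_le (B := m ^ m) (List.length_range.trans_le hn)
          fun p _ => ?_).trans (Nat.le_succ _)
        rw [List.length_map]
        exact (length_tokenRuns_le htr hJ u _).trans (Nat.pow_le_pow_right hm (hσ X u hu))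
  · rw [List.length_map, List.length_range]
    exact Nat.pow_le_pow_right (by omega) hk

end Lengths

/-! ### Lengths of strings -/

section Words

variable {Γ : Type} {tr : List (Trans Γ)} {J : ℕ → List (Block Γ)}

/-- All strings of the assignment have length at most `W`. -/
def IsShort (W : ℕ) (σ : Asg Γ) : Prop := ∀ u, some u ∈ σ → u.length ≤ W

/-- The condition on `W` is for the letters, which are kept and have length one. -/
theorem length_subst_le {σ : Asg Γ} {W : ℕ} (hσ : IsShort W σ) (hW : 1 ≤ W) {u v : List (ℕ ⊕ Γ)}
    (h : subst σ u = some v) : v.length ≤ W * u.length := by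
  induction u generalizing v with
  | nil =>
    rw [subst_nil, Option.some.injEq] at h
    simp [← h]
  | cons x u ih =>
    rw [List.length_cons, Nat.mul_succ]
    cases x with
    | inl Y =>
      rw [subst_inl, Option.bind_eq_some_iff] at h
      obtain ⟨v', hv', h⟩ := h
      obtain ⟨y, hy, rfl⟩ := Option.map_eq_some_iff.1 h
      have := ih hv'
      have := hσ y (getD_mem_of_eq_some hy)
      rw [List.length_append]
      omega
    | inr g =>
      rw [subst_inr] at h
      obtain ⟨v', hv', rfl⟩ := Option.map_eq_some_iff.1 h
      have := ih hv'
      rw [List.length_cons]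
      omega

theorem IsShort.comp {σ τ : Asg Γ} {W D : ℕ} (hσ : IsShort W σ) (hW : 1 ≤ W) (hτ : IsShort D τ) :
    IsShort (W * D) (compAsg σ τ) := by
  intro v hv
  obtain ⟨o, ho, h⟩ := List.mem_map.1 hv
  obtain ⟨u, rfl, h⟩ := Option.bind_eq_some_iff.1 h
  exact (length_subst_le hσ hW h).trans (Nat.mul_le_mul_left W (hτ u ho))

/-- A crude bound that ignores copylessness: each token multiplies the length by at most `D`. An
exponential bound is all that is needed. -/
theorem isShort_of_mem_tokenRuns {D W : ℕ} (hD : 1 ≤ D) (hW : 1 ≤ W)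
    (htr : ∀ t ∈ tr, IsShort D t.2.2.1) (hJ : ∀ X, ∀ b ∈ J X, IsShort D b.2.2)
    {u : List (ℕ ⊕ ℕ)} {c d : ℕ × Asg Γ} (hc : IsShort W c.2) (hd : d ∈ tokenRuns tr J u [c]) :
    IsShort (W * D ^ u.length) d.2 := by
  induction u generalizing c W with
  | nil =>
    simp only [tokenRuns, List.foldl_nil, List.mem_singleton] at hd
    simpa [hd] using hc
  | cons x u ih =>
    rw [tokenRuns_cons, List.mem_flatMap] at hd
    obtain ⟨e, he, hd⟩ := hd
    rw [List.length_cons, pow_succ', ← mul_assoc]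
    refine ih (Nat.mul_pos hW hD) (hc.comp hW ?_) hd
    cases x with
    | inl X =>
      simp only [moves, Sum.elim_inl, List.mem_map, List.mem_filter] at he
      obtain ⟨b, ⟨hb, _⟩, rfl⟩ := he
      exact hJ X b hb
    | inr o =>
      simp only [moves, Sum.elim_inr, List.mem_map, List.mem_filter] at he
      obtain ⟨t, ⟨ht, _⟩, rfl⟩ := he
      exact htr t ht

theorem isShort_idAsg (r : ℕ) : IsShort 1 (idAsg r : Asg Γ) := by
  intro u hu
  obtain ⟨Y, _, h⟩ := List.mem_map.1 hu
  rw [Option.some.injEq] at h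
  simp [← h]

theorem length_le_of_mem_segs {u : List (ℕ ⊕ Γ)} {l : List Γ} (hl : l ∈ segs u) :
    l.length ≤ u.length := by
  induction u generalizing l with
  | nil =>
    simp only [segs, List.foldr_nil, List.mem_singleton] at hl
    simp [hl]
  | cons x u ih =>
    cases x with
    | inl Y =>
      rw [segs_inl, List.mem_cons] at hl
      rcases hl with rfl | hl
      · simp
      · exact (ih hl).trans (Nat.le_succ _)
    | inr a =>
      obtain ⟨b, t, h⟩ := List.exists_cons_of_ne_nil (segs_ne_nil u)
      rw [segs_inr, h, List.headI_cons, List.tail_cons, List.mem_cons] at hl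
      rw [h] at ih
      rcases hl with rfl | hl
      · exact Nat.succ_le_succ (ih (List.mem_cons_self ..))
      · exact (ih (List.mem_cons_of_mem _ hl)).trans (Nat.le_succ _)

theorem length_content_le {r W : ℕ} {fam : List (Option (Block Γ))}
    (h : ∀ X b, fam.getD X none = some b → IsShort W b.2.2) (z : ℕ) :
    (content r fam z).length ≤ W := by
  rw [content]
  cases hb : fam.getD (z / (r + 1) / r) none with
  | none => simp
  | some b =>
    rw [Option.bind_some]
    cases hu : b.2.2.getD (z / (r + 1) % r) none with
    | none => simp
    | some u =>
      rw [Option.map_some, Option.getD_some]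
      refine le_trans ?_ (h _ b hb u (getD_mem_of_eq_some hu))
      by_cases hi : z % (r + 1) < (segs u).length
      · rw [List.getD_eq_getElem _ _ hi]
        exact length_le_of_mem_segs (List.getElem_mem hi)
      · rw [List.getD_eq_default _ _ (by omega)]
        simp

theorem length_content_families_le {n r k m D : ℕ} {A : List Bool}
    {σ : ℕ → Option (List (ℕ ⊕ ℕ))} {fam : List (Option (Block Γ))} (hD : 1 ≤ D)
    (htr : ∀ t ∈ tr, IsShort D t.2.2.1) (hJ : ∀ X, ∀ b ∈ J X, IsShort D b.2.2)
    (hσ : ∀ X u, σ X = some u → u.length ≤ m) (hfam : fam ∈ families n r k tr J A σ) (z : ℕ) :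
    (content r fam z).length ≤ D ^ m := by
  refine length_content_le (fun X b hb v hv => ?_) z
  obtain ⟨_, u, hu, hb⟩ := (mem_families hfam).2 X b hb
  refine (isShort_of_mem_tokenRuns hD le_rfl htr hJ (isShort_idAsg r) (mem_blocks.1 hb).2 v
    hv).trans ?_
  rw [one_mul]
  exact Nat.pow_le_pow_right hD (hσ X u hu)

theorem length_lettersOf_le (u : List (ℕ ⊕ Γ)) : (lettersOf u).length ≤ u.length := by
  refine (length_flatMap_le (B := 1) le_rfl fun x _ => ?_).trans_eq (mul_one _)
  cases x <;> simp

/-- At most r registers alternate with at most r + 1 symbols for factors. -/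
theorem isShort_unfoldShape {r X : ℕ} {h : List (Option (List ℕ))} (hh : GoodShape r h) :
    IsShort (2 * r + 1) (unfoldShape r X h) := by
  intro u hu
  obtain ⟨Y, _, e⟩ := List.mem_map.1 hu
  obtain ⟨ys, hys, rfl⟩ := Option.map_eq_some_iff.1 e
  have := hh.length_le ys (getD_mem_of_eq_some hys)
  rw [List.length_cons, List.length_flatMap]
  simp
  omega

theorem isShort_symbolicBlocks {k n r : ℕ} {s : List (Option Summary)} (hs : GoodSummaries k n r s)
    {X : ℕ} {b : Block (ℕ ⊕ ℕ)} (hb : b ∈ symbolicBlocks r s X) : IsShort (2 * r + 1) b.2.2 := by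
  obtain ⟨b', hb', rfl⟩ := mem_symbolicBlocks hb
  exact isShort_unfoldShape (hs.shape b' (getD_mem_of_eq_some hb'))

theorem isShort_liftTrans {tr : List (Trans ℕ)} {D : ℕ} (h : ∀ t ∈ tr, IsShort D t.2.2.1) :
    ∀ t ∈ liftTrans tr, IsShort D t.2.2.1 := by
  intro t ht
  obtain ⟨t, ht', rfl⟩ := List.mem_map.1 ht
  intro u hu
  obtain ⟨o, ho, e⟩ := List.mem_map.1 hu
  obtain ⟨u', rfl, rfl⟩ := Option.map_eq_some_iff.1 e
  rw [List.length_map]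
  exact h t ht' u' ho

theorem length_symbolicBlocks_le (r : ℕ) (s : List (Option Summary)) (X : ℕ) :
    (symbolicBlocks r s X).length ≤ 1 := by
  rw [symbolicBlocks, List.length_map]
  cases s.getD X none <;> simp

end Words

/-! ### The size of the composition -/

section Sizes

/-- The number of symbols needed to write down a table of strings. -/
def tableCodeSize {α : Type} (l : List (Option (List α))) : ℕ :=
  (l.map fun o => o.elim 0 fun u => u.length + 1).sum

/-- The size of a transducer, in terms of its code. -/
def codeSize (c : Code) : ℕ :=
  c.1 + c.2.1 + c.2.2.1.length + c.2.2.2.1.length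
    + (c.2.2.2.2.1.map fun t => tableCodeSize t.2.2.1 + 1).sum
    + (c.2.2.2.2.2.1.map fun o => o.elim 0 fun v => tableCodeSize v + 1).sum
    + tableCodeSize c.2.2.2.2.2.2

theorem tableCodeSize_ofFn {r : ℕ} {α β : Type} (f : Fin r → Option (List α))
    (g : List α → List β) (hg : ∀ u, (g u).length = u.length) :
    tableCodeSize (List.ofFn fun X => (f X).map g) = tableSize f := by
  rw [tableCodeSize, List.map_ofFn, List.sum_ofFn, tableSize]
  refine Finset.sum_congr rfl fun X _ => ?_
  rw [Function.comp_apply]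
  cases f X with
  | none => rfl
  | some u => simp [hg]

theorem codeSize_code (T : NSST) : codeSize T.code = T.size := by
  have h₁ : ∀ {n : ℕ} (f : Fin n → Option (RegWord T.numRegs)),
      tableCodeSize (List.ofFn fun X => (f X).map wordCode) = tableSize f :=
    fun f => tableCodeSize_ofFn f wordCode fun u => by simp [wordCode]
  have h₂ : ∀ ν : RegVal T.numRegs, tableCodeSize (List.ofFn ν) = tableSize ν := fun ν => by
    simpa using tableCodeSize_ofFn ν id fun _ => rfl
  have h₃ : ((List.ofFn fun q => (T.init q).map fun ν => List.ofFn ν).map fun o =>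
      o.elim 0 fun v => tableCodeSize v + 1).sum =
      ∑ q : Fin T.numStates, (T.init q).elim 0 (fun ν => tableSize ν + 1) := by
    rw [List.map_ofFn, List.sum_ofFn]
    refine Finset.sum_congr rfl fun q _ => ?_
    rw [Function.comp_apply]
    cases T.init q with
    | none => rfl
    | some ν => simp [h₂]
  simp only [codeSize, code, size, List.map_map, Finset.length_sort, h₃, h₁]
  simp only [Function.comp_def, h₁, tableSize]

/-- All data of the code are bounded by `m`. -/
structure Bounded (m : ℕ) (c : Code) : Prop where
  numStates_le : c.1 ≤ m
  numRegs_le : c.2.1 ≤ m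
  inAlph_le : c.2.2.1.length ≤ m
  outAlph_le : c.2.2.2.1.length ≤ m
  trans_le : c.2.2.2.2.1.length ≤ m
  asg_le : ∀ t ∈ c.2.2.2.2.1, IsShort m t.2.2.1
  init_le : ∀ v, some v ∈ c.2.2.2.2.2.1 → ∀ w, some w ∈ v → w.length ≤ m
  final_le : ∀ u, some u ∈ c.2.2.2.2.2.2 → u.length ≤ m

theorem le_tableCodeSize {α : Type} {l : List (Option (List α))} {u : List α} (h : some u ∈ l) :
    u.length ≤ tableCodeSize l :=
  (Nat.le_succ _).trans
    (List.single_le_sum (by simp) _ (List.mem_map_of_mem (f := fun o => o.elim 0 fun u => u.length + 1) h))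

theorem bounded_of_codeSize_le {m : ℕ} {c : Code} (h : codeSize c ≤ m) : Bounded m c := by
  rw [codeSize] at h
  have ht : ∀ t ∈ c.2.2.2.2.1, tableCodeSize t.2.2.1 + 1 ≤
      (c.2.2.2.2.1.map fun t => tableCodeSize t.2.2.1 + 1).sum := fun t ht =>
    List.single_le_sum (by simp) _ (List.mem_map_of_mem (f := fun t => tableCodeSize t.2.2.1 + 1) ht)
  have hi : ∀ v, some v ∈ c.2.2.2.2.2.1 → tableCodeSize v + 1 ≤
      (c.2.2.2.2.2.1.map fun o => o.elim 0 fun v => tableCodeSize v + 1).sum := fun v hv =>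
    List.single_le_sum (by simp) _
      (List.mem_map_of_mem (f := fun o => o.elim 0 fun v => tableCodeSize v + 1) hv)
  have hl : c.2.2.2.2.1.length ≤ (c.2.2.2.2.1.map fun t => tableCodeSize t.2.2.1 + 1).sum := by
    refine (List.card_nsmul_le_sum _ 1 fun x hx => ?_).trans' (by simp)
    obtain ⟨t, _, rfl⟩ := List.mem_map.1 hx
    exact Nat.le_add_left 1 _
  refine ⟨by omega, by omega, by omega, by omega, by omega, fun t h' u hu => ?_,
    fun v hv w hw => ?_, fun u hu => ?_⟩
  · have := ht t h'
    have := le_tableCodeSize hu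
    omega
  · have := hi v hv
    have := le_tableCodeSize hw
    omega
  · have := le_tableCodeSize hu
    omega

theorem IsShort.mono {Γ : Type} {V W : ℕ} (h : V ≤ W) {σ : Asg Γ} (hσ : IsShort V σ) :
    IsShort W σ := fun u hu => (hσ u hu).trans h

/-- A bound for the number of families of blocks. -/
def familyBound (m : ℕ) : ℕ := (m * m ^ m + 1) ^ m

/-- A bound for the number of states up to multiplicities. -/
def stateBound (m : ℕ) : ℕ := m * (m * (m * (((m + 1) * m ^ m + 1) ^ m)) + 1) ^ m

/-- A bound for the number of steps from a state. -/
def stepBound (m : ℕ) : ℕ := m * (2 ^ m * familyBound m)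

/-- A bound for the number of copies of the states. -/
def copyBound (m : ℕ) : ℕ := (stepBound m + 1) * (stateBound m * (m * m ^ m) + 1)

/-- A bound for the size of the tables of the composition. -/
def tableBound (m : ℕ) : ℕ := m * m * (m + 1) * ((2 * m + 1) ^ m + 1) + 1

/-- A bound for the size of the composition. -/
def sizeBound (m : ℕ) : ℕ :=
  copyBound m * stateBound m + m * m * (m + 1) + m + m +
    copyBound m * (stateBound m * stepBound m) * tableBound m +
    copyBound m * stateBound m * tableBound m +
    copyBound m * stateBound m * (m * (2 * m + 1) ^ m * m + 1)

variable {m : ℕ} {c₁ c₂ : Code}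

theorem length_shapes_le {r : ℕ} (hm : 1 ≤ m) (hr : r ≤ m) :
    (shapes r).length ≤ ((m + 1) * m ^ m + 1) ^ m := by
  refine (List.length_filter_le ..).trans
    ((length_sections_le (B := (m + 1) * m ^ m + 1) fun l hl => ?_).trans ?_)
  · rw [List.eq_of_mem_replicate hl, List.length_cons]
    refine Nat.succ_le_succ (length_flatMap_le (by simpa using hr) fun j hj => ?_)
    rw [List.length_map]
    refine (length_sections_le (B := m) fun l hl => ?_).trans ?_
    · rw [List.eq_of_mem_replicate hl, List.length_range]
      exact hr
    · rw [List.length_replicate]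
      have := List.mem_range.1 hj
      exact Nat.pow_le_pow_right hm (by omega)
  · rw [List.length_replicate]
    exact Nat.pow_le_pow_right (by omega) hr

theorem length_states_le (hm : 1 ≤ m) (b₁ : Bounded m c₁) (b₂ : Bounded m c₂) :
    (states c₁ c₂).length ≤ stateBound m := by
  refine length_flatMap_le (List.length_range.trans_le b₁.numStates_le) fun q _ => ?_
  rw [List.length_map]
  refine (length_sections_le (B := m * (m * (((m + 1) * m ^ m + 1) ^ m)) + 1)
    fun l hl => ?_).trans ?_
  · rw [List.eq_of_mem_replicate hl, List.length_cons]
    refine Nat.succ_le_succ (length_flatMap_le (List.length_range.trans_le b₂.numStates_le)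
      fun p _ => length_flatMap_le (List.length_range.trans_le b₂.numStates_le) fun p' _ => ?_)
    rw [List.length_map]
    exact length_shapes_le hm b₂.numRegs_le
  · rw [List.length_replicate]
    exact Nat.pow_le_pow_right (by omega) b₁.numRegs_le

theorem length_liftTrans (tr : List (Trans ℕ)) : (liftTrans tr).length = tr.length :=
  List.length_map ..

theorem length_steps_le (hm : 1 ≤ m) (b₁ : Bounded m c₁) (b₂ : Bounded m c₂) (s : State) :
    (steps c₁ c₂ s).length ≤ stepBound m := by
  refine length_flatMap_le ((List.length_filter_le ..).trans b₁.trans_le) fun t ht => ?_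
  refine length_flatMap_le (length_boolVectors_le b₁.numRegs_le) fun A _ => ?_
  have ht := (List.mem_filter.1 ht).1
  cases decide ((s.2.map fun o => o.isSome) = occurring c₁.2.1 (selected c₁.2.1 A t.2.2.1)) with
  | false => simp
  | true =>
    rw [cond_true, List.length_map]
    exact length_families_le hm ((length_liftTrans _).trans_le b₂.trans_le)
      (fun X => (length_symbolicBlocks_le ..).trans hm) b₂.numStates_le b₁.numRegs_le
      fun X u hu => b₁.asg_le t ht u (getD_mem_of_eq_some hu)

theorem length_inits_le (hm : 1 ≤ m) (b₁ : Bounded m c₁) (b₂ : Bounded m c₂) :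
    (inits c₁ c₂).length ≤ stepBound m := by
  refine length_flatMap_le (List.length_range.trans_le b₁.numStates_le) fun q _ => ?_
  refine length_toList_flatMap_le fun ν hν => ?_
  refine length_flatMap_le (length_boolVectors_le b₁.numRegs_le) fun A _ => ?_
  rw [List.length_map]
  refine length_families_le hm b₂.trans_le (fun X => Nat.zero_le m) b₂.numStates_le b₁.numRegs_le
    fun X u hu => ?_
  obtain ⟨w, hw, rfl⟩ := Option.map_eq_some_iff.1 hu
  rw [List.length_map]
  exact b₁.init_le ν (getD_mem_of_eq_some hν) w (getD_mem_of_eq_some hw)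

theorem length_finals_le (hm : 1 ≤ m) (b₁ : Bounded m c₁) (b₂ : Bounded m c₂) (s : State) :
    (finals c₁ c₂ s).length ≤ m * m ^ m := by
  refine length_toList_flatMap_le fun u hu => ?_
  cases decide ((s.2.map fun o => o.isSome) = occurring c₁.2.1 u) with
  | false => simp
  | true =>
    rw [cond_true]
    refine length_flatMap_le (List.length_range.trans_le b₂.numStates_le) fun p _ => ?_
    refine length_toList_flatMap_le fun ν _ => ?_
    refine (length_flatMap_le (B := 1) (length_tokenRuns_le
      ((length_liftTrans _).trans_le b₂.trans_le)
      (fun X => (length_symbolicBlocks_le ..).trans hm) u _) fun d _ => ?_).trans ?_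
    · refine length_toList_flatMap_le fun v _ => ?_
      rw [List.length_map]
      exact Option.length_toList_le
    · rw [mul_one]
      exact Nat.pow_le_pow_right hm (b₁.final_le u (getD_mem_of_eq_some hu))

theorem length_le_of_mem_finals (hm : 1 ≤ m) (b₁ : Bounded m c₁) (b₂ : Bounded m c₂) {s : State}
    (hs : s ∈ states c₁ c₂) {y : WordCode} (hy : y ∈ finals c₁ c₂ s) :
    y.length ≤ m * (2 * m + 1) ^ m * m := by
  rw [finals_eq, List.mem_flatMap] at hy
  obtain ⟨u, hu, hy⟩ := hy
  rw [Option.mem_toList] at hu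
  have hy : y ∈ tokenOutputs c₂ (liftTrans c₂.2.2.2.2.1) Sum.inr (symbolicBlocks c₂.2.1 s.2) u := by
    revert hy
    cases decide ((s.2.map fun o => o.isSome) = occurring c₁.2.1 u) with
    | false => simp
    | true => exact id
  simp only [tokenOutputs, List.mem_flatMap, List.mem_map, Option.mem_toList] at hy
  obtain ⟨p, _, ν, hν, d, hd, v, hv, y', hy', rfl⟩ := hy
  have hr := b₂.numRegs_le
  -- `W` bounds the initial values of the second transducer; `D` bounds the strings of its
  -- transitions as well as those of the symbolic blocks.
  have hd := isShort_of_mem_tokenRuns (D := 2 * m + 1) (W := m) (by omega) hm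
    (isShort_liftTrans fun t ht => (b₂.asg_le t ht).mono (by omega))
    (fun X b hb => (isShort_symbolicBlocks (mem_states.1 hs).2 hb).mono (by omega))
    (fun w hw => by
      obtain ⟨o, ho, e⟩ := List.mem_map.1 hw
      obtain ⟨w, rfl, rfl⟩ := Option.map_eq_some_iff.1 e
      rw [List.length_map]
      exact b₂.init_le ν (getD_mem_of_eq_some hν) w ho) hd
  refine (length_lettersOf_le y').trans ((length_subst_le hd ?_ hy').trans ?_)
  · exact Nat.mul_pos hm (pow_pos (by omega) _)
  · rw [List.length_map]
    exact Nat.mul_le_mul (Nat.mul_le_mul_left m (Nat.pow_le_pow_right (by omega)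
      (b₁.final_le u (getD_mem_of_eq_some hu)))) (b₂.final_le v (getD_mem_of_eq_some hv))

theorem tableCodeSize_le {α : Type} {l : List (Option (List α))} {k W : ℕ} (hl : l.length ≤ k)
    (h : ∀ u, some u ∈ l → u.length ≤ W) : tableCodeSize l ≤ k * (W + 1) := by
  refine sum_map_le hl fun o ho => ?_
  cases o with
  | none => exact Nat.zero_le _
  | some u => exact Nat.succ_le_succ (h u ho)

theorem tableCodeSize_contents_le {Γ : Type} {k r W : ℕ} {fam : List (Option (Block Γ))}
    (hk : k ≤ m) (hr : r ≤ m) (h : ∀ z, (content r fam z).length ≤ W) :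
    tableCodeSize (contents k r fam) ≤ m * m * (m + 1) * (W + 1) := by
  refine tableCodeSize_le ?_ fun u hu => ?_
  · rw [contents, List.length_map, List.length_range]
    exact Nat.mul_le_mul (Nat.mul_le_mul hk hr) (Nat.succ_le_succ hr)
  · obtain ⟨z, _, e⟩ := List.mem_map.1 hu
    rw [Option.some.injEq] at e
    exact e ▸ h z

theorem size_of_mem_steps_le (b₁ : Bounded m c₁) (b₂ : Bounded m c₂) {s : State}
    (hs : s ∈ states c₁ c₂) {t : ℕ × List (Option WordCode) × State} (ht : t ∈ steps c₁ c₂ s) :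
    tableCodeSize t.2.1 + 1 ≤ tableBound m := by
  obtain ⟨t', ht', _, A, _, _, fam, hfam, rfl⟩ := mem_steps.1 ht
  have hr := b₂.numRegs_le
  exact Nat.succ_le_succ (tableCodeSize_contents_le b₁.numRegs_le b₂.numRegs_le fun z =>
    length_content_families_le (by omega)
      (isShort_liftTrans fun t ht => (b₂.asg_le t ht).mono (by omega))
      (fun X b hb => (isShort_symbolicBlocks (mem_states.1 hs).2 hb).mono (by omega))
      (fun X u hu => b₁.asg_le t' ht' u (getD_mem_of_eq_some hu)) hfam z)

theorem size_of_mem_inits_le (b₁ : Bounded m c₁) (b₂ : Bounded m c₂)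
    {e : State × List (Option (List ℕ))} (he : e ∈ inits c₁ c₂) :
    tableCodeSize e.2 + 1 ≤ tableBound m := by
  obtain ⟨q, _, ν, hν, A, _, fam, hfam, rfl⟩ := mem_inits.1 he
  refine Nat.succ_le_succ (tableCodeSize_contents_le b₁.numRegs_le b₂.numRegs_le fun z =>
    length_content_families_le (by omega) (fun t ht => (b₂.asg_le t ht).mono (by omega))
      (by simp) (fun X u hu => ?_) hfam z)
  obtain ⟨w, hw, rfl⟩ := Option.map_eq_some_iff.1 hu
  rw [List.length_map]
  exact b₁.init_le ν (getD_mem_of_eq_some hν) w (getD_mem_of_eq_some hw)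

theorem codeSize_composeCode_le (hm : 1 ≤ m) (b₁ : Bounded m c₁) (b₂ : Bounded m c₂) :
    codeSize (composeCode c₁ c₂) ≤ sizeBound m := by
  have hK : initBound c₁ c₂ ≤ stepBound m + 1 := Nat.succ_le_succ (length_inits_le hm b₁ b₂)
  have hL : finalBound c₁ c₂ ≤ stateBound m * (m * m ^ m) + 1 :=
    Nat.succ_le_succ (length_flatMap_le (length_states_le hm b₁ b₂)
      fun s _ => length_finals_le hm b₁ b₂ s)
  have hS : (multiStates (states c₁ c₂) (initBound c₁ c₂) (finalBound c₁ c₂)).length ≤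
      copyBound m * stateBound m := by
    rw [copyBound, mul_assoc]
    refine length_flatMap_le (List.length_range.trans_le hK) fun k _ =>
      length_flatMap_le (List.length_range.trans_le hL) fun l _ => ?_
    rw [List.length_map]
    exact length_states_le hm b₁ b₂
  have hT : (multiTrans (states c₁ c₂) (initBound c₁ c₂) (finalBound c₁ c₂)
      fun s => steps c₁ c₂ s).length ≤ copyBound m * (stateBound m * stepBound m) := by
    -- The factors are put in the order in which `multiTrans` is nested: first copies, states,
    -- steps, copies of the target.
    rw [copyBound, mul_assoc, mul_comm (_ + 1 : ℕ) (stateBound m * stepBound m), mul_assoc]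
    refine length_flatMap_le (List.length_range.trans_le hK) fun k _ =>
      length_flatMap_le (length_states_le hm b₁ b₂) fun s _ =>
        length_flatMap_le (length_steps_le hm b₁ b₂ s) fun t _ => ?_
    rw [List.length_map, List.length_range]
    exact hL
  have h₁ : ((composeCode c₁ c₂).2.2.2.2.1.map fun t => tableCodeSize t.2.2.1 + 1).sum ≤
      copyBound m * (stateBound m * stepBound m) * tableBound m := by
    refine sum_map_le ((List.length_map ..).trans_le hT) fun t ht => ?_
    obtain ⟨t', ht', rfl⟩ := List.mem_map.1 ht
    obtain ⟨k, _, s, hs, t'', ht'', l, _, rfl⟩ := mem_multiTrans ht'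
    exact size_of_mem_steps_le b₁ b₂ hs ht''
  have h₂ : ((composeCode c₁ c₂).2.2.2.2.2.1.map fun o =>
      o.elim 0 fun v => tableCodeSize v + 1).sum ≤ copyBound m * stateBound m * tableBound m := by
    refine sum_map_le ((List.length_map ..).trans_le hS) fun o ho => ?_
    cases o with
    | none => exact Nat.zero_le _
    | some v =>
      obtain ⟨e, he, rfl⟩ := mem_inits_of_mem_composeCode ho
      exact size_of_mem_inits_le b₁ b₂ he
  have h₃ : tableCodeSize (composeCode c₁ c₂).2.2.2.2.2.2 ≤
      copyBound m * stateBound m * (m * (2 * m + 1) ^ m * m + 1) := by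
    refine tableCodeSize_le ((List.length_map ..).trans_le hS) fun y hy => ?_
    obtain ⟨s, hs, hy⟩ := mem_finals_of_mem_composeCode hy
    exact length_le_of_mem_finals hm b₁ b₂ hs hy
  refine Nat.add_le_add (Nat.add_le_add (Nat.add_le_add (Nat.add_le_add (Nat.add_le_add
    (Nat.add_le_add hS ?_) b₁.inAlph_le) b₂.outAlph_le) h₁) h₂) h₃
  exact Nat.mul_le_mul (Nat.mul_le_mul b₁.numRegs_le b₂.numRegs_le) (Nat.succ_le_succ b₂.numRegs_le)

end Sizes

/-! ### Exponential bounds -/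

section Exponential

/-- Functions bounded by two to the power of a polynomial. -/
def ExpBounded (f : ℕ → ℕ) : Prop := ∃ P : Polynomial ℕ, ∀ m, f m ≤ 2 ^ P.eval m

variable {f g : ℕ → ℕ}

theorem expBounded_const (k : ℕ) : ExpBounded fun _ => k :=
  ⟨Polynomial.C k, fun m => by simpa using Nat.lt_two_pow_self.le⟩

theorem expBounded_id : ExpBounded fun m => m :=
  ⟨Polynomial.X, fun m => by simpa using Nat.lt_two_pow_self.le⟩

theorem ExpBounded.mul (hf : ExpBounded f) (hg : ExpBounded g) : ExpBounded fun m => f m * g m := by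
  obtain ⟨P, hP⟩ := hf
  obtain ⟨Q, hQ⟩ := hg
  refine ⟨P + Q, fun m => ?_⟩
  rw [Polynomial.eval_add, pow_add]
  exact Nat.mul_le_mul (hP m) (hQ m)

theorem ExpBounded.add (hf : ExpBounded f) (hg : ExpBounded g) : ExpBounded fun m => f m + g m := by
  obtain ⟨P, hP⟩ := hf
  obtain ⟨Q, hQ⟩ := hg
  refine ⟨P + Q + 1, fun m => ?_⟩
  have h₁ : 2 ^ P.eval m ≤ 2 ^ (P.eval m + Q.eval m) := Nat.pow_le_pow_right two_pos (by omega)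
  have h₂ : 2 ^ Q.eval m ≤ 2 ^ (P.eval m + Q.eval m) := Nat.pow_le_pow_right two_pos (by omega)
  have := hP m
  have := hQ m
  rw [Polynomial.eval_add, Polynomial.eval_add, Polynomial.eval_one, pow_succ]
  change f m + g m ≤ _
  omega

/-- Raising to the power m multiplies the exponent by m, which keeps it polynomial. All powers in
the bounds have base of this class and exponent m. -/
theorem ExpBounded.pow_self (hf : ExpBounded f) : ExpBounded fun m => f m ^ m := by
  obtain ⟨P, hP⟩ := hf
  refine ⟨P * Polynomial.X, fun m => ?_⟩
  rw [Polynomial.eval_mul, Polynomial.eval_X, pow_mul]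
  exact Nat.pow_le_pow_left (hP m) m

theorem expBounded_sizeBound : ExpBounded sizeBound := by
  have h1 := expBounded_const 1
  have hm := expBounded_id
  have hp := hm.pow_self
  have hfam : ExpBounded familyBound := ((hm.mul hp).add h1).pow_self
  have hstate : ExpBounded stateBound := hm.mul
    (((hm.mul (hm.mul ((((hm.add h1).mul hp).add h1).pow_self))).add h1).pow_self)
  have hstep : ExpBounded stepBound := hm.mul ((expBounded_const 2).pow_self.mul hfam)
  have hcopy : ExpBounded copyBound := (hstep.add h1).mul ((hstate.mul (hm.mul hp)).add h1)
  have hw : ExpBounded fun m => (2 * m + 1) ^ m := (((expBounded_const 2).mul hm).add h1).pow_self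
  have hr : ExpBounded fun m => m * m * (m + 1) := (hm.mul hm).mul (hm.add h1)
  have htable : ExpBounded tableBound := (hr.mul (hw.add h1)).add h1
  exact ((((((hcopy.mul hstate).add hr).add hm).add hm).add
    ((hcopy.mul (hstate.mul hstep)).mul htable)).add ((hcopy.mul hstate).mul htable)).add
    ((hcopy.mul hstate).mul (((hm.mul hw).mul hm).add h1))

end Exponential

end NSST.Compose

/-! ### The theorem. -/

theorem theorem4 :
    ∃ (f : NSST.Code → NSST.Code → NSST.Code) (P : MvPolynomial (Fin 2) ℕ) (C : ℕ),
      Computable₂ f ∧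
      ∀ T₁ T₂ : NSST, T₁.outAlph ⊆ T₂.inAlph →
        ∃ T : NSST,
          f T₁.code T₂.code = T.code ∧
          T.inAlph = T₁.inAlph ∧
          T.outAlph = T₂.outAlph ∧
          (∀ D : List ℕ, (∀ a ∈ D, a ∈ T₁.inAlph) → T.sem D = NSST.compSem T₁ T₂ D) ∧
          T.size ≤ C * 2 ^ MvPolynomial.eval ![T₁.size, T₂.size] P := by
  obtain ⟨P, hP⟩ := NSST.Compose.expBounded_sizeBound
  refine ⟨NSST.Compose.composeCode,
    -- The bound is taken at m = |T₁| + |T₂| + 1, which dominates the data of both codes; the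
    -- summand 1 ensures `1 ≤ m`, as the estimates assume.
    Polynomial.aeval (MvPolynomial.X 0 + MvPolynomial.X 1 + 1 : MvPolynomial (Fin 2) ℕ) P, 1,
    NSST.Compose.composeCode_computable, fun T₁ T₂ _ => ?_⟩
  have h₁ := NSST.Compose.wellFormed_code T₁
  have h₂ := NSST.Compose.wellFormed_code T₂
  obtain ⟨T, hT, hA, hB⟩ := NSST.Compose.exists_code_eq
    (NSST.Compose.wellFormed_composeCode h₁ h₂) (A := T₁.inAlph) (B := T₂.outAlph) rfl rfl
  refine ⟨T, hT.symm, hA, hB, fun D _ => ?_, ?_⟩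
  · rw [NSST.Compose.sem_eq_codeSem, hT, NSST.Compose.codeSem_composeCode h₁ h₂, NSST.compSem,
      NSST.Compose.sem_eq_codeSem]
    exact congrArg _ (funext fun w => (NSST.Compose.sem_eq_codeSem T₂ w).symm)
  · have e : MvPolynomial.eval ![T₁.size, T₂.size]
        (Polynomial.aeval (MvPolynomial.X 0 + MvPolynomial.X 1 + 1 : MvPolynomial (Fin 2) ℕ) P) =
        P.eval (T₁.size + T₂.size + 1) := by
      rw [← MvPolynomial.coe_aeval_eq_eval, Polynomial.aeval_def, Polynomial.eval₂_eq_sum_range]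
      simp [Polynomial.eval_eq_sum_range]
    rw [one_mul, e, ← NSST.Compose.codeSize_code, hT]
    refine (NSST.Compose.codeSize_composeCode_le (by omega)
      (NSST.Compose.bounded_of_codeSize_le ?_) (NSST.Compose.bounded_of_codeSize_le ?_)).trans (hP _)
    · rw [NSST.Compose.codeSize_code]
      omega
    · rw [NSST.Compose.codeSize_code]
      omega
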